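/- Let $k$ be an algebraically closed field, $A$ a finite-dimensional (unital, associative) $k$-algebra, and $G$ a finite group acting on $A$ by $k$-algebra automorphisms such that the characteristic of $k$ does not divide $|G|$. Let $A*G$ be the skew group algebra: $A\otimes_k kG$ as a vector space, with $(a\otimes g)(a'\otimes g')=a\,g(a')\otimes gg'$. Modules are finite-dimensional left modules and $\mathrm{Sim}(C)$ is the set of isomorphism classes of simple modules of an algebra $C$. *Quasi-hereditary and directed algebras.* Let $\le$ be a partial order on $\mathrm{Sim}(C)$, let $P_L$ be the projective cover of $L$, and put $\Delta_L=P_L/\sum_{L'\not\le L,\ \varphi\in\mathrm{Hom}_C(P_{L'},P_L)}\mathrm{im}\,\varphi$. The order is adapted if every module with simple top $L$ and simple socle $L'$, where $L,L'$ are incomparable, has a composition factor $L''$ with $L''>L$ and $L''>L'$. The pair $(C,\le)$ is quasi-hereditary if $\le$ is adapted, ${}_CC$ has a finite filtration with all subquotients of the form $\Delta_L$, and $\mathrm{Ext}^1_C(\Delta_L,\Delta_L)=0$ and $\mathrm{End}_C(\Delta_L)=k$ for all $L$. It is directed if $\le$ is adapted and $\Delta_L\cong L$ for all $L$. *Exact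 Borel subalgebras.* Let $D\subseteq C$ be a subalgebra and $\le_D$ a partial order on $\mathrm{Sim}(D)$. Then $(D,\le_D)$ is an exact Borel subalgebra of $(C,\le)$ if $(C,\le)$ is quasi-hereditary, $C$ is projective as a right $D$-module, $(D,\le_D)$ is directed, and there is a bijection $i:\mathrm{Sim}(D)\to\mathrm{Sim}(C)$ with $C\otimes_D L\cong\Delta_{i(L)}$ for all $L\in\mathrm{Sim}(D)$. It is an order-compatible exact Borel subalgebra if, moreover, $i$ can be chosen so that $L\le_D L'\iff i(L)\le i(L')$. *Orders and the group action.* For an $A$-module $M$ let $gM$ be $M$ with $a\in A$ acting as $g^{-1}(a)$. A partial order $\le_A$ on $\mathrm{Sim}(A)$ is $G$-equivariant if $L<_AL'\iff gL<_AhL'$ for all $L,L'\in \mathrm{Sim}(A)$ and $g,h\in G$. It induces the order $\le_{A*G}$ on $\mathrm{Sim}(A*G)$ for which $S<_{A*G}S'$ if and only if $L<_AL'$ for all simple direct summands $L$ of $S|_A$ and $L'$ of $S'|_A$. **Theorem.** Let $\le_A$ be a $G$-equivariant partial order on $\mathrm{Sim}(A)$ such that $(A,\le_A)$ is quasi-hereditary,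 and let $B\subseteq A$ be a subalgebra with $g(B)=B$ for all $g\in G$. Let $B*G\subseteq A*G$ be the subalgebra $B\otimes_k kG$. Then there is a partial order $\le_B$ on $\mathrm{Sim}(B)$ such that $(B,\le_B)$ is an exact Borel subalgebra of $(A,\le_A)$ if and only if there is a partial order $\le_{B*G}$ on $\mathrm{Sim}(B*G)$ such that $(B*G,\le_{B*G})$ is an exact Borel subalgebra of $(A*G,\le_{A*G})$. The same equivalence holds with "order-compatible exact Borel subalgebra" in place of "exact Borel subalgebra" on both sides. -/

import Mathlib

open scoped TensorProduct

universe u v w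

namespace QuasiHer

section Modules

/-- Restriction of scalars: the `S`-module `M` regarded as an `R`-module along `f : R →+* S`. -/
def Res {R : Type*} {S : Type*} [Ring R] [Ring S] (_f : R →+* S) (M : Type*) : Type _ := M

instance {R : Type*} {S : Type*} [Ring R] [Ring S] (f : R →+* S) (M : Type*) [AddCommGroup M] :
    AddCommGroup (Res f M) := inferInstanceAs (AddCommGroup M)

instance {R : Type*} {S : Type*} [Ring R] [Ring S] (f : R →+* S) (M : Type*) [AddCommGroup M]
    [Module S M] : Module R (Res f M) := Module.compHom M f

variable (A : Type u) [Ring A]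

/-- The top `M / rad M`, where `rad M` is the intersection of the maximal submodules. -/
abbrev Top (M : Type*) [AddCommGroup M] [Module A M] := M ⧸ Module.jacobson A M

/-- The socle, the sum of the simple submodules. -/
def socle (M : Type*) [AddCommGroup M] [Module A M] : Submodule A M :=
  sSup {N | IsSimpleModule A N}

/-- `N ∣ M`: the module `N` is isomorphic to a direct summand of `M`. -/
def IsSummand (N M : Type*) [AddCommGroup N] [Module A N] [AddCommGroup M] [Module A M] : Prop :=
  ∃ X Y : Submodule A M, IsCompl X Y ∧ Nonempty (N ≃ₗ[A] X)

/-- `L` is isomorphic to a subquotient of `M` (for simple `L`: a composition factor). -/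
def IsCompositionFactor (L M : Type*) [AddCommGroup L] [Module A L] [AddCommGroup M]
    [Module A M] : Prop :=
  ∃ X Y : Submodule A M, X ≤ Y ∧ Nonempty (L ≃ₗ[A] (Y ⧸ X.submoduleOf Y))

variable {A}

/-- A projective cover: an epimorphism from a projective module with superfluous kernel. -/
structure IsProjectiveCover {P M : Type*} [AddCommGroup P] [Module A P] [AddCommGroup M]
    [Module A M] (π : P →ₗ[A] M) : Prop where
  projective : Module.Projective A P
  surjective : Function.Surjective π
  superfluous : ∀ N : Submodule A P, N ⊔ LinearMap.ker π = ⊤ → N = ⊤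

variable (A)

/-- Two maximal left ideals are equivalent when their simple quotient modules are isomorphic. -/
def simSetoid : Setoid {m : Submodule A A // IsCoatom m} where
  r m n := Nonempty ((A ⧸ m.1) ≃ₗ[A] (A ⧸ n.1))
  iseqv := ⟨fun _ => ⟨LinearEquiv.refl A _⟩, fun ⟨e⟩ => ⟨e.symm⟩, fun ⟨e⟩ ⟨f⟩ => ⟨e.trans f⟩⟩

/-- The set of isomorphism classes of simple left `A`-modules. -/
def Sim : Type u := Quotient (simSetoid A)

variable {A}

/-- The maximal left ideal `m` for which `A ⧸ m` is the chosen representative of the class. -/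
noncomputable def Sim.ideal (L : Sim A) : Submodule A A := (Quotient.out L).1

/-- The chosen simple module representing an isomorphism class. -/
abbrev Sim.Mod (L : Sim A) : Type u := A ⧸ L.ideal

theorem Sim.isCoatom_ideal (L : Sim A) : IsCoatom L.ideal := (Quotient.out L).2

instance (L : Sim A) : IsSimpleModule A L.Mod :=
  isSimpleModule_iff_isCoatom.mpr L.isCoatom_ideal

theorem Sim.eq_of_equiv {L L' : Sim A} (h : Nonempty (L.Mod ≃ₗ[A] L'.Mod)) : L = L' := by
  rw [← Quotient.out_eq L, ← Quotient.out_eq L']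
  exact Quotient.sound h

theorem Sim.exists_equiv (M : Type*) [AddCommGroup M] [Module A M] [IsSimpleModule A M] :
    ∃ L : Sim A, Nonempty (M ≃ₗ[A] L.Mod) := by
  obtain ⟨m, hm, ⟨e⟩⟩ := isSimpleModule_iff_quot_maximal.mp (inferInstance : IsSimpleModule A M)
  let q : {m : Submodule A A // IsCoatom m} := ⟨m, Ideal.isMaximal_def.mp hm⟩
  obtain ⟨f⟩ : Nonempty ((A ⧸ (Quotient.out (Quotient.mk (simSetoid A) q)).1) ≃ₗ[A] (A ⧸ q.1)) :=
    Quotient.mk_out (s := simSetoid A) q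
  exact ⟨Quotient.mk (simSetoid A) q, ⟨e.trans f.symm⟩⟩

theorem exists_isProjectiveCover [IsArtinianRing A] (L : Sim A) :
    ∃ (P : Submodule A A) (π : P →ₗ[A] L.Mod), IsProjectiveCover π := by
  obtain ⟨P, ⟨⟨Q, hPQ⟩, hPm⟩, hmin⟩ := WellFounded.has_min
    (wellFounded_lt (α := Submodule A A))
    {P : Submodule A A | (∃ Q, IsCompl P Q) ∧ ¬ P ≤ L.ideal}
    ⟨⊤, ⟨⊥, isCompl_top_bot⟩, fun h => L.isCoatom_ideal.1 (top_le_iff.mp h)⟩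
  let π : P →ₗ[A] L.Mod := L.ideal.mkQ ∘ₗ P.subtype
  have hπ0 : π ≠ 0 := by
    intro h
    apply hPm
    intro x hx
    have := LinearMap.congr_fun h ⟨x, hx⟩
    simpa [π] using this
  have hπ : Function.Surjective π := LinearMap.surjective_of_ne_zero hπ0
  have hproj : Module.Projective A P :=
    Module.Projective.of_split P.subtype (P.projectionOnto Q hPQ) (by
      ext x
      simp)
  refine ⟨P, π, hproj, hπ, fun N hN => ?_⟩
  have hs : Function.Surjective (π ∘ₗ N.subtype) := by
    intro y
    obtain ⟨p, rfl⟩ := hπ y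
    obtain ⟨n, hn, z, hz, rfl⟩ := Submodule.mem_sup.mp (hN ▸ Submodule.mem_top : p ∈ N ⊔ _)
    refine ⟨⟨n, hn⟩, ?_⟩
    have : π z = 0 := hz
    simp [this]
  obtain ⟨f, hf⟩ := Module.projective_lifting_property (π ∘ₗ N.subtype) π hs
  let F : Module.End A P := N.subtype ∘ₗ f
  have hF : ∀ x, π (F x) = π x := fun x => LinearMap.congr_fun hf x
  have hFn : ∀ n x, π ((F ^ n) x) = π x := by
    intro n
    induction n with
    | zero => intro x; simp
    | succ n ih => intro x; rw [pow_succ, Module.End.mul_apply, ih, hF]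
  obtain ⟨n, hn, hn1⟩ := ((F.eventually_isCompl_ker_pow_range_pow).and
    (Filter.eventually_ge_atTop 1)).exists
  have hR : LinearMap.range (F ^ n) = ⊤ := by
    have hle : (LinearMap.range (F ^ n)).map P.subtype ≤ P := Submodule.map_subtype_le _ _
    have hmem : (LinearMap.range (F ^ n)).map P.subtype ∈
        {P : Submodule A A | (∃ Q, IsCompl P Q) ∧ ¬ P ≤ L.ideal} := by
      constructor
      · refine ⟨(LinearMap.ker (F ^ n)).map P.subtype ⊔ Q, ?_⟩
        have hd := hn.symm
        constructor
        · have h1 : Disjoint ((LinearMap.range (F ^ n)).map P.subtype)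
              ((LinearMap.ker (F ^ n)).map P.subtype) :=
            (Submodule.disjoint_map P.injective_subtype hd.disjoint)
          have h2 : Disjoint (((LinearMap.range (F ^ n)).map P.subtype) ⊔
              ((LinearMap.ker (F ^ n)).map P.subtype)) Q := by
            rw [← Submodule.map_sup, hd.sup_eq_top, Submodule.map_top, Submodule.range_subtype]
            exact hPQ.disjoint
          exact h1.disjoint_sup_right_of_disjoint_sup_left h2
        · rw [codisjoint_iff, ← sup_assoc, ← Submodule.map_sup, hd.sup_eq_top,
            Submodule.map_top, Submodule.range_subtype]
          exact hPQ.sup_eq_top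
      · intro h
        apply hπ0
        ext x
        rw [← hFn n x]
        have := h (Submodule.mem_map_of_mem (LinearMap.mem_range_self (F ^ n) x))
        simpa [π] using this
    have heq : (LinearMap.range (F ^ n)).map P.subtype = P := by
      by_contra hne
      exact hmin _ hmem (lt_of_le_of_ne hle hne)
    apply Submodule.map_injective_of_injective P.injective_subtype
    rw [heq, Submodule.map_top, Submodule.range_subtype]
  rw [eq_top_iff, ← hR]
  rintro _ ⟨x, rfl⟩
  obtain ⟨j, rfl⟩ := Nat.exists_eq_add_of_le' hn1
  rw [pow_succ', Module.End.mul_apply]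
  exact (f _).2

end Modules

section Algebras

theorem exists_isProjectiveCover_of_finite (k : Type w) [Field k] {A : Type u} [Ring A]
    [Algebra k A] [Module.Finite k A] (L : Sim A) :
    ∃ (P : Submodule A A) (π : P →ₗ[A] L.Mod), IsProjectiveCover π :=
  haveI := IsArtinianRing.of_finite k A
  exists_isProjectiveCover L

variable (k : Type w) [Field k] {A : Type u} [Ring A] [Algebra k A] [Module.Finite k A]

/-- The projective cover `P_L` of the simple module `L`, realised as a left ideal. -/
noncomputable def cover (L : Sim A) : Submodule A A :=
  (exists_isProjectiveCover_of_finite k L).choose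

theorem cover_spec (L : Sim A) : ∃ π : cover k L →ₗ[A] L.Mod, IsProjectiveCover π :=
  (exists_isProjectiveCover_of_finite k L).choose_spec

/-- The sum of the images of all homomorphisms `P_{L'} → P_L` with `L' ≰ L`. -/
noncomputable def standardKernel (le : Sim A → Sim A → Prop) (L : Sim A) : Submodule A (cover k L) :=
  ⨆ (L' : Sim A) (_ : ¬ le L' L) (φ : cover k L' →ₗ[A] cover k L), LinearMap.range φ

/-- The standard module `Δ_L` for the order `le`. -/
abbrev Standard (le : Sim A → Sim A → Prop) (L : Sim A) : Type u :=
  cover k L ⧸ standardKernel k le L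

/-- The strict relation belonging to `le`. -/
def Lt {X : Type*} (le : X → X → Prop) (x y : X) : Prop := le x y ∧ x ≠ y

/-- `le` is an adapted partial order on the simple modules: every (finite-dimensional) module with
simple top `L` and simple socle `L'`, where `L` and `L'` are incomparable, has a composition factor
`L''` with `L'' > L` and `L'' > L'`. -/
structure IsAdapted (le : Sim A → Sim A → Prop) : Prop where
  partialOrder : IsPartialOrder (Sim A) le
  exists_gt : ∀ (M : Type u) [AddCommGroup M] [Module A M] [Module.Finite A M] (L L' : Sim A),
    Nonempty (Top A M ≃ₗ[A] L.Mod) → Nonempty (socle A M ≃ₗ[A] L'.Mod) →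
    ¬ le L L' → ¬ le L' L →
    ∃ L'' : Sim A, IsCompositionFactor A L''.Mod M ∧ Lt le L L'' ∧ Lt le L' L''

/-- `M` has a finite filtration whose subquotients are standard modules. -/
def HasStandardFiltration (le : Sim A → Sim A → Prop) (M : Type*) [AddCommGroup M]
    [Module A M] : Prop :=
  ∃ (n : ℕ) (F : ℕ → Submodule A M), F 0 = ⊥ ∧ F n = ⊤ ∧ ∀ i < n, F i ≤ F (i + 1) ∧
    ∃ L : Sim A, Nonempty ((F (i + 1) ⧸ (F i).submoduleOf (F (i + 1))) ≃ₗ[A] Standard k le L)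

/-- `(A, le)` is quasi-hereditary: `le` is an adapted partial order, `A` is filtered by standard
modules, and every standard module is exceptional, i.e. has no self-extensions and only scalar
endomorphisms. -/
structure IsQuasiHereditary (le : Sim A → Sim A → Prop) : Prop where
  adapted : IsAdapted le
  filtration : HasStandardFiltration k le A
  ext_eq_zero : ∀ L : Sim A, Subsingleton (CategoryTheory.Abelian.Ext
    (ModuleCat.of A (Standard k le L)) (ModuleCat.of A (Standard k le L)) 1)
  end_eq_scalars : ∀ L : Sim A,
    Function.Bijective (algebraMap k (Module.End A (Standard k le L)))

/-- `(A, le)` is directed: `le` is an adapted partial order and the standard modules are simple. -/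
structure IsDirectedAlgebra (le : Sim A → Sim A → Prop) : Prop where
  adapted : IsAdapted le
  standard_equiv : ∀ L : Sim A, Nonempty (Standard k le L ≃ₗ[A] L.Mod)

variable {k}

/-- The induced module `A ⊗_B M`, as the quotient of `A ⊗_k M` by the elements
`a b ⊗ m - a ⊗ b m`. -/
abbrev Induced (B : Subalgebra k A) (M : Type*) [AddCommGroup M] [Module k M] [Module B M] :=
  (A ⊗[k] M) ⧸ Submodule.span A
    {x : A ⊗[k] M | ∃ (a : A) (b : B) (m : M), x = (a * b) ⊗ₜ[k] m - a ⊗ₜ[k] (b • m)}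

/-- `A` is projective as a right `B`-module. -/
def IsRightProjective (B : Subalgebra k A) : Prop :=
  Module.Projective (↥B)ᵐᵒᵖ (Res (RingHom.op B.val.toRingHom) A)

/-- `(B, leB)` is an exact Borel subalgebra of the quasi-hereditary algebra `(A, leA)`, the
bijection `i` matching the simple `B`-modules with the simple `A`-modules. -/
structure IsExactBorelVia (leA : Sim A → Sim A → Prop) (B : Subalgebra k A)
    (leB : Sim B → Sim B → Prop) (i : Sim B ≃ Sim A) : Prop where
  quasiHereditary : IsQuasiHereditary k leA
  projective : IsRightProjective B
  directed : IsDirectedAlgebra k leB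
  induced_equiv : ∀ L : Sim B, Nonempty (Induced B L.Mod ≃ₗ[A] Standard k leA (i L))

/-- `(B, leB)` is an exact Borel subalgebra of `(A, leA)`. -/
def IsExactBorel (leA : Sim A → Sim A → Prop) (B : Subalgebra k A)
    (leB : Sim B → Sim B → Prop) : Prop :=
  ∃ i : Sim B ≃ Sim A, IsExactBorelVia leA B leB i

/-- `(B, leB)` is an exact Borel subalgebra of `(A, leA)` for a bijection of the simple modules
that is an isomorphism of partially ordered sets. -/
def IsOrderedExactBorel (leA : Sim A → Sim A → Prop) (B : Subalgebra k A)
    (leB : Sim B → Sim B → Prop) : Prop :=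
  ∃ i : Sim B ≃ Sim A, IsExactBorelVia leA B leB i ∧ ∀ L L', leB L L' ↔ leA (i L) (i L')

end Algebras

section Skew

/- `SkewMonoidAlgebra A G` is the skew group algebra `A * G`: `single g a` stands for `a ⊗ g`, and
`single g a * single h b = single (g * h) (a * g • b)`. -/

instance {k A G : Type*} [Field k] [Ring A] [Algebra k A] [Module.Finite k A] [Finite G] :
    Module.Finite k (SkewMonoidAlgebra A G) :=
  Module.Finite.equiv (SkewMonoidAlgebra.coeffLinearEquiv (S := k) (k := A) (G := G)).symm

variable {k : Type w} [Field k] {A : Type u} [Ring A] [Algebra k A]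
  {G : Type v} [Group G] [MulSemiringAction G A]

/-- The module `gM`: the group `M` on which `a` acts as `g⁻¹(a)`. -/
abbrev Twist (g : G) (M : Type*) := Res (MulSemiringAction.toRingHom G A g⁻¹) M

/-- `le` is `G`-equivariant: `L < L'` if and only if `gL < hL'`, for all `g` and `h` in `G`. -/
def IsEquivariant (G : Type v) [Group G] [MulSemiringAction G A]
    (le : Sim A → Sim A → Prop) : Prop :=
  ∀ (g h : G) (L L' N N' : Sim A),
    Nonempty (Twist (A := A) g L.Mod ≃ₗ[A] N.Mod) →
    Nonempty (Twist (A := A) h L'.Mod ≃ₗ[A] N'.Mod) → (Lt le L L' ↔ Lt le N N')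

/-- The inclusion `A → A * G`, `a ↦ a ⊗ 1`. -/
noncomputable def incl : A →+* SkewMonoidAlgebra A G where
  toFun a := SkewMonoidAlgebra.single 1 a
  map_one' := rfl
  map_mul' a b := by simp [SkewMonoidAlgebra.single_mul_single]
  map_zero' := SkewMonoidAlgebra.single_zero 1
  map_add' a b := SkewMonoidAlgebra.single_add 1 a b

/-- The order on the simple `A * G`-modules induced by an order on the simple `A`-modules:
`S < S'` if and only if `L < L'` for all simple direct summands `L` of the restriction of `S`
to `A` and `L'` of the restriction of `S'` to `A`. -/
def inducedLE (le : Sim A → Sim A → Prop) (S S' : Sim (SkewMonoidAlgebra A G)) : Prop :=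
  S = S' ∨ ∀ L L' : Sim A, IsSummand A L.Mod (Res (incl (A := A) (G := G)) S.Mod) →
    IsSummand A L'.Mod (Res (incl (A := A) (G := G)) S'.Mod) → Lt le L L'

variable [SMulCommClass G k A]

/-- For a `G`-stable subalgebra `B` of `A`, the subalgebra `B * G` of `A * G`: the elements all of
whose coefficients lie in `B`. -/
def skewSubalgebra (B : Subalgebra k A)
    (hB : ∀ g : G, B.map (MulSemiringAction.toAlgHom k A g) = B) :
    Subalgebra k (SkewMonoidAlgebra A G) where
  carrier := {x | ∀ g, x.coeff g ∈ B}
  mul_mem' := by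
    classical
    intro x y hx hy g
    rw [SkewMonoidAlgebra.coeff_mul]
    refine Subalgebra.sum_mem _ fun a _ => Subalgebra.sum_mem _ fun b _ => ?_
    dsimp only
    split_ifs
    · refine B.mul_mem (hx a) ?_
      have h : MulSemiringAction.toAlgHom k A a (y.coeff b) ∈
          B.map (MulSemiringAction.toAlgHom k A a) := Subalgebra.mem_map.mpr ⟨_, hy b, rfl⟩
      rw [hB a] at h
      exact h
    · exact B.zero_mem
  add_mem' := by
    intro x y hx hy g
    rw [SkewMonoidAlgebra.coeff_add]
    exact B.add_mem (hx g) (hy g)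
  algebraMap_mem' := by
    classical
    intro r g
    rw [SkewMonoidAlgebra.coe_algebraMap, Function.comp_apply, SkewMonoidAlgebra.coeff_single_apply]
    split_ifs
    · exact B.algebraMap_mem r
    · exact B.zero_mem

end Skew

end QuasiHer

open QuasiHer

/-! The proof compares modules over a ring `R` with modules over a skew group ring `Γ` of `G` over
`R`. `SkewExt` records just enough of `Γ` to treat `A * G` over `A` and `B * G` over `B` alike.
Coinduction `CoInd` is right adjoint to restriction and, through the coefficient at `1`, also left
adjoint to it. As `|G|` is invertible in `k`, averaging gives Maschke's theorem, so radicals over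
`R` and over `Γ` coincide (`restrictScalars_jacobson`). By Clifford theory the constituents of a
simple `Γ`-module form one `G`-orbit (`Over.conj`, `Over.conj_of_over`), so for an equivariant order
a single pair of constituents decides the strict induced relation `overLE`.

Standard modules are handled orbit by orbit, through a property stable under restriction and
coinduction. `RelStd` asks that the composition factors lie in the orbit of `L` or below it, that
the module be projective relative to all such modules, and that its simple quotients lie in the
orbit. Such a module, if finite, is a direct sum of standard modules (`RelStd.exists_equiv_pi`), and
is a single one if its top is simple (`RelStd.equiv_of_isTop`). Coinducing a standard filtration of
`A` therefore filters `A * G`, which gives `isQuasiHereditary_overLE`.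

The conditions on `B` are moved separately. Right projectivity is expressed by dual bases.
Directedness for an order means that the factors of `rad P_L` are strictly larger than `L`; the
relation `InRad` can be followed along `Over` in both directions, so its freedom from cycles is
inherited both ways.

The matching of simple modules is encoded in `Star`: a `B`-semisimple submodule generating a
semisimple `A`-module contains every `B`-semisimple submodule. For an exact Borel subalgebra this is
Schur's lemma together with injectivity of the matching (`star_of_isTopInd`). Conversely it makes
the nonzero modules `A ⊗_B L` have simple tops, each simple module occurring exactly once
(`Star.exists_equiv`). `Star.skew` and `Star.of_skew` pass it between `B` and `B * G`, and `RelStd`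
then identifies the induced modules as standard. For the order-compatible version the order is
pulled back along the new bijection, and `Over.compat` shows that the two bijections respect
restriction. -/

namespace QuasiHer

/-! ### Modules with a unique maximal submodule. -/

section Tops

variable {R : Type*} [Ring R] {M N L X : Type*} [AddCommGroup M] [Module R M] [AddCommGroup N]
  [Module R N] [AddCommGroup L] [Module R L] [AddCommGroup X] [Module R X]

theorem exists_factor (f : M →ₗ[R] N) (hf : Function.Surjective f) (p : M →ₗ[R] L)
    (h : LinearMap.ker f ≤ LinearMap.ker p) : ∃ g : N →ₗ[R] L, g ∘ₗ f = p := by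
  refine ⟨(LinearMap.ker f).liftQ p h ∘ₗ (f.quotKerEquivOfSurjective hf).symm, ?_⟩
  ext x
  have : (f.quotKerEquivOfSurjective hf).symm (f x) = Submodule.Quotient.mk x := by
    rw [LinearEquiv.symm_apply_eq]; rfl
  simp [this]

/-- `p` is an epimorphism whose kernel contains every proper submodule. -/
structure IsTop (p : M →ₗ[R] L) : Prop where
  surjective : Function.Surjective p
  le_ker : ∀ N : Submodule R M, N ≠ ⊤ → N ≤ LinearMap.ker p

theorem isTop_of_superfluous [IsSimpleModule R L] (p : M →ₗ[R] L) (hp : Function.Surjective p)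
    (h : ∀ N : Submodule R M, N ⊔ LinearMap.ker p = ⊤ → N = ⊤) : IsTop p := by
  refine ⟨hp, fun N hN => ?_⟩
  have hc : IsCoatom (LinearMap.ker p) := LinearMap.isCoatom_ker_of_surjective hp
  by_contra hle
  refine hN (h N (hc.2 _ ?_))
  exact lt_of_le_of_ne le_sup_right fun he => hle (he ▸ le_sup_left)

namespace IsTop

variable {p : M →ₗ[R] L}

theorem jacobson_eq [IsSimpleModule R L] (h : IsTop p) :
    Module.jacobson R M = LinearMap.ker p := by
  have hc : IsCoatom (LinearMap.ker p) := LinearMap.isCoatom_ker_of_surjective h.surjective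
  refine le_antisymm (sInf_le hc) (le_sInf fun N hN => ?_)
  exact ((h.le_ker N hN.1).eq_or_lt.resolve_right fun hlt => hc.1 (hN.2 _ hlt)).ge

theorem surjective_of_comp_ne_zero [IsSimpleModule R L] (h : IsTop p) (f : X →ₗ[R] M)
    (hf : p ∘ₗ f ≠ 0) : Function.Surjective f := by
  rw [← LinearMap.range_eq_top]
  by_contra hne
  refine hf (LinearMap.ext fun x => ?_)
  exact h.le_ker _ hne (LinearMap.mem_range_self f x)

theorem ker_le_of_ne_zero (h : IsTop p) (f : M →ₗ[R] N) (hf : f ≠ 0) :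
    LinearMap.ker f ≤ LinearMap.ker p :=
  h.le_ker _ fun he => hf (LinearMap.ker_eq_top.mp he)

theorem exists_of_surjective [Nontrivial N] (h : IsTop p) (f : M →ₗ[R] N)
    (hf : Function.Surjective f) : ∃ q : N →ₗ[R] L, q ∘ₗ f = p ∧ IsTop q := by
  have hf0 : f ≠ 0 := by
    rintro rfl
    obtain ⟨y, hy⟩ := exists_ne (0 : N)
    obtain ⟨x, rfl⟩ := hf y
    exact hy rfl
  obtain ⟨q, hq⟩ := exists_factor f hf p (h.ker_le_of_ne_zero f hf0)
  refine ⟨q, hq, fun y => ?_, fun U hU y hy => ?_⟩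
  · obtain ⟨x, rfl⟩ := h.surjective y
    exact ⟨f x, LinearMap.congr_fun hq x⟩
  · obtain ⟨x, rfl⟩ := hf y
    have : U.comap f ≠ ⊤ := fun he => hU (by
      rw [eq_top_iff]
      rintro z -
      obtain ⟨x, rfl⟩ := hf z
      exact (he ▸ Submodule.mem_top : x ∈ U.comap f))
    have := h.le_ker _ this (show x ∈ U.comap f from hy)
    rw [LinearMap.mem_ker] at this ⊢
    rw [← this, ← hq]; rfl

theorem exists_equiv_of_ne_zero [IsSimpleModule R L] [IsSimpleModule R N] (h : IsTop p)
    (f : M →ₗ[R] N) (hf : f ≠ 0) : ∃ e : L ≃ₗ[R] N, (e : L →ₗ[R] N) ∘ₗ p = f := by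
  have hs : Function.Surjective f := LinearMap.surjective_of_ne_zero hf
  have h1 := h.ker_le_of_ne_zero f hf
  have hc : IsCoatom (LinearMap.ker f) := LinearMap.isCoatom_ker_of_surjective hs
  have hc' : IsCoatom (LinearMap.ker p) := LinearMap.isCoatom_ker_of_surjective h.surjective
  have h2 : LinearMap.ker p = LinearMap.ker f :=
    (h1.eq_or_lt.resolve_right fun hlt => hc'.1 (hc.2 _ hlt)).symm
  obtain ⟨g, hg⟩ := exists_factor p h.surjective f h2.le
  have : g ≠ 0 := by rintro rfl; exact hf (by rw [← hg, LinearMap.zero_comp])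
  exact ⟨LinearEquiv.ofBijective g (LinearMap.bijective_of_ne_zero this), hg⟩

theorem of_equiv {N' : Type*} [AddCommGroup N'] [Module R N'] (h : IsTop p) (e : N' ≃ₗ[R] M) :
    IsTop (p ∘ₗ (e : N' →ₗ[R] M)) := by
  refine ⟨h.surjective.comp e.surjective, fun U hU y hy => ?_⟩
  have := h.le_ker (U.map (e : N' →ₗ[R] M)) (fun he => hU ?_) (Submodule.mem_map_of_mem hy)
  · exact this
  · rw [eq_top_iff]
    rintro z -
    obtain ⟨x, hx, hxz⟩ := (he ▸ Submodule.mem_top : (e z) ∈ U.map (e : N' →ₗ[R] M))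
    rwa [← e.injective hxz]

theorem comp_equiv {L' : Type*} [AddCommGroup L'] [Module R L'] (h : IsTop p) (e : L ≃ₗ[R] L') :
    IsTop ((e : L →ₗ[R] L') ∘ₗ p) := by
  refine ⟨e.surjective.comp h.surjective, fun U hU y hy => ?_⟩
  have := h.le_ker U hU hy
  rw [LinearMap.mem_ker] at this ⊢
  simp [this]

theorem ne_zero [IsSimpleModule R L] (h : IsTop p) : p ≠ 0 := by
  rintro rfl
  have := IsSimpleModule.nontrivial R L
  obtain ⟨y, hy⟩ := exists_ne (0 : L)
  obtain ⟨x, rfl⟩ := h.surjective y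
  exact hy rfl

end IsTop

theorem exists_ne_zero_simple_quotient [Module.Finite R M] [Nontrivial M] :
    ∃ (L : Sim R) (f : M →ₗ[R] L.Mod), Function.Surjective f := by
  obtain ⟨m, hm, -⟩ := (eq_top_or_exists_le_coatom (⊥ : Submodule R M)).resolve_left bot_ne_top
  have : IsSimpleModule R (M ⧸ m) := isSimpleModule_iff_isCoatom.mpr hm
  obtain ⟨L, ⟨e⟩⟩ := Sim.exists_equiv (A := R) (M ⧸ m)
  exact ⟨L, (e : _ →ₗ[R] L.Mod) ∘ₗ m.mkQ, e.surjective.comp m.mkQ_surjective⟩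

theorem exists_simple_submodule [IsArtinianRing R] [Nontrivial M] :
    ∃ N : Submodule R M, IsSimpleModule R N := by
  obtain ⟨x, hx⟩ := exists_ne (0 : M)
  have hne : Submodule.span R {x} ≠ ⊥ := by simpa using hx
  have : IsArtinian R (Submodule.span R {x}) := isArtinian_span_of_finite R (Set.finite_singleton x)
  have : Nontrivial (Submodule.span R {x}) := (Submodule.nontrivial_iff_ne_bot).mpr hne
  obtain ⟨N, hN, -⟩ := (eq_bot_or_exists_atom_le (⊤ : Submodule R (Submodule.span R {x}))).resolve_left
    top_ne_bot
  have := isSimpleModule_iff_isAtom.mpr hN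
  refine ⟨N.map (Submodule.subtype _), ?_⟩
  exact IsSimpleModule.congr (Submodule.equivMapOfInjective _ (Submodule.subtype_injective _) N).symm

theorem Sim.nonzero_hom_eq {L L' : Sim R} (f : L.Mod →ₗ[R] L'.Mod) (hf : f ≠ 0) : L = L' :=
  Sim.eq_of_equiv ⟨LinearEquiv.ofBijective f (LinearMap.bijective_of_ne_zero hf)⟩

theorem map_jacobson_eq_zero [IsSemisimpleModule R N] (f : M →ₗ[R] N) {x : M}
    (hx : x ∈ Module.jacobson R M) : f x = 0 := by
  have := Module.map_jacobson_le f (Submodule.mem_map_of_mem hx)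
  rwa [IsSemisimpleModule.jacobson_eq_bot, Submodule.mem_bot] at this

theorem eq_top_of_sup_jacobson [Module.Finite R M] (N : Submodule R M)
    (h : N ⊔ Module.jacobson R M = ⊤) : N = ⊤ := by
  by_contra hne
  obtain ⟨m, hm, hle⟩ := (eq_top_or_exists_le_coatom N).resolve_left hne
  exact hm.1 (top_le_iff.mp (h ▸ sup_le hle (sInf_le hm)))

end Tops

/-! ### Composition factors detected by maps from projective covers. -/

section Factors

variable (k : Type w) [Field k] {R : Type u} [Ring R] [Algebra k R] [Module.Finite k R]

/-- The chosen projection of the projective cover of `L` onto `L`. -/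
noncomputable def coverMap (L : Sim R) : cover k L →ₗ[R] L.Mod := (cover_spec k L).choose

theorem coverMap_isTop (L : Sim R) : IsTop (coverMap k L) :=
  isTop_of_superfluous _ (cover_spec k L).choose_spec.surjective
    (cover_spec k L).choose_spec.superfluous

instance (L : Sim R) : Module.Projective R (cover k L) := (cover_spec k L).choose_spec.projective

variable {M N X : Type*} [AddCommGroup M] [Module R M] [AddCommGroup N] [Module R N]
  [AddCommGroup X] [Module R X]

/-- `L` is a composition factor of `M`, expressed by a nonzero map from the projective cover. -/
def Fac (L : Sim R) (M : Type*) [AddCommGroup M] [Module R M] : Prop :=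
  ∃ f : cover k L →ₗ[R] M, f ≠ 0

variable {k}

theorem cover_lift {L : Sim R} (p : M →ₗ[R] N) (hp : Function.Surjective p)
    (f : cover k L →ₗ[R] N) : ∃ h : cover k L →ₗ[R] M, p ∘ₗ h = f :=
  Module.projective_lifting_property p f hp

theorem Fac.of_injective {L : Sim R} (h : Fac k L M) (i : M →ₗ[R] N)
    (hi : Function.Injective i) : Fac k L N := by
  obtain ⟨f, hf⟩ := h
  refine ⟨i ∘ₗ f, fun h0 => hf ?_⟩
  ext x
  exact hi (by simpa using LinearMap.congr_fun h0 x)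

theorem Fac.of_surjective {L : Sim R} (h : Fac k L N) (p : M →ₗ[R] N)
    (hp : Function.Surjective p) : Fac k L M := by
  obtain ⟨f, hf⟩ := h
  obtain ⟨g, rfl⟩ := cover_lift p hp f
  exact ⟨g, fun h0 => hf (by rw [h0, LinearMap.comp_zero])⟩

theorem Fac.equiv {L : Sim R} (h : Fac k L M) (e : M ≃ₗ[R] N) : Fac k L N :=
  h.of_injective (e : M →ₗ[R] N) e.injective

theorem Fac.of_le {L : Sim R} {U V : Submodule R M} (h : Fac k L U) (hUV : U ≤ V) : Fac k L V :=
  h.of_injective (Submodule.inclusion hUV) (Submodule.inclusion_injective hUV)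

theorem Fac.of_submodule {L : Sim R} {U : Submodule R M} (h : Fac k L U) : Fac k L M :=
  h.of_injective U.subtype U.subtype_injective

theorem Fac.of_range {L : Sim R} {f : M →ₗ[R] N} (h : Fac k L (LinearMap.range f)) : Fac k L M :=
  h.of_surjective f.rangeRestrict f.surjective_rangeRestrict

theorem Fac.pi {ι : Type*} {F : ι → Type*} [∀ i, AddCommGroup (F i)] [∀ i, Module R (F i)]
    {L : Sim R} (h : Fac k L (∀ i, F i)) : ∃ i, Fac k L (F i) := by
  obtain ⟨f, hf⟩ := h
  by_contra! hc
  refine hf (LinearMap.ext fun x => funext fun i => ?_)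
  by_contra hx
  exact hc i ⟨LinearMap.proj i ∘ₗ f, fun h0 => hx (LinearMap.congr_fun h0 x)⟩

theorem Fac.nontrivial {L : Sim R} (h : Fac k L M) : Nontrivial M := by
  obtain ⟨f, hf⟩ := h
  by_contra hc
  rw [not_nontrivial_iff_subsingleton] at hc
  exact hf (LinearMap.ext fun x => Subsingleton.elim _ _)

theorem fac_of_surjective_simple {L : Sim R} (f : M →ₗ[R] L.Mod) (hf : f ≠ 0) : Fac k L M := by
  refine Fac.of_surjective ⟨coverMap k L, (coverMap_isTop k L).ne_zero⟩ f
    (LinearMap.surjective_of_ne_zero hf)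

theorem fac_of_injective_simple {L : Sim R} (f : L.Mod →ₗ[R] M) (hf : f ≠ 0) : Fac k L M :=
  Fac.of_injective ⟨coverMap k L, (coverMap_isTop k L).ne_zero⟩ f (LinearMap.injective_of_ne_zero hf)

theorem exists_fac (k : Type w) [Field k] {R : Type u} [Ring R] [Algebra k R] [Module.Finite k R]
    (M : Type*) [AddCommGroup M] [Module R M] [Nontrivial M] : ∃ L : Sim R, Fac k L M := by
  have := IsArtinianRing.of_finite k R
  obtain ⟨N, hN⟩ := exists_simple_submodule (R := R) (M := M)
  obtain ⟨L, ⟨e⟩⟩ := Sim.exists_equiv (A := R) N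
  have := IsSimpleModule.nontrivial R N
  refine ⟨L, Fac.of_submodule (U := N) (Fac.equiv ⟨coverMap k L, (coverMap_isTop k L).ne_zero⟩ e.symm)⟩

/-- In a semisimple module a composition factor is a submodule. -/
theorem Fac.exists_hom [IsSemisimpleModule R M] {L : Sim R} (h : Fac k L M) :
    ∃ f : L.Mod →ₗ[R] M, f ≠ 0 := by
  obtain ⟨f, hf⟩ := h
  obtain ⟨g, hg⟩ := exists_factor (coverMap k L) (coverMap_isTop k L).surjective f (by
    rw [← (coverMap_isTop k L).jacobson_eq]
    exact fun x hx => map_jacobson_eq_zero f hx)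
  exact ⟨g, fun h0 => hf (by rw [← hg, h0, LinearMap.zero_comp])⟩

theorem Fac.exists_hom_to [IsSemisimpleModule R M] {L : Sim R} (h : Fac k L M) :
    ∃ f : M →ₗ[R] L.Mod, f ≠ 0 := by
  obtain ⟨f, hf⟩ := h.exists_hom
  have hi := LinearMap.injective_of_ne_zero hf
  obtain ⟨g, hg⟩ := IsSemisimpleModule.extension_property f hi LinearMap.id
  refine ⟨g, fun h0 => ?_⟩
  rw [h0, LinearMap.zero_comp] at hg
  have := IsSimpleModule.nontrivial R L.Mod
  obtain ⟨y, hy⟩ := exists_ne (0 : L.Mod)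
  exact hy (LinearMap.congr_fun hg y).symm

theorem Fac.eq_of_simple {L L' : Sim R} (h : Fac k L L'.Mod) : L = L' := by
  obtain ⟨f, hf⟩ := h.exists_hom
  exact Sim.nonzero_hom_eq f hf

theorem fac_self (L : Sim R) : Fac k L L.Mod := ⟨coverMap k L, (coverMap_isTop k L).ne_zero⟩

theorem Fac.of_ker {L : Sim R} (h : Fac k L M) (p : M →ₗ[R] N) :
    Fac k L (LinearMap.ker p) ∨ Fac k L N := by
  obtain ⟨f, hf⟩ := h
  by_cases h0 : p ∘ₗ f = 0
  · refine Or.inl ⟨f.codRestrict _ fun x => LinearMap.congr_fun h0 x, fun h1 => hf ?_⟩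
    ext x
    exact congrArg Subtype.val (LinearMap.congr_fun h1 x)
  · exact Or.inr ⟨_, h0⟩

/-- The kernel of a nonzero `f` lies in `rad P_L`, so the image of `f` modulo `f (rad P_L)` is `P_L
/ rad P_L`. -/
theorem isCompositionFactor_of_fac {L : Sim R} (h : Fac k L M) :
    IsCompositionFactor R L.Mod M := by
  obtain ⟨f, hf⟩ := h
  have ht := coverMap_isTop k L
  set K := LinearMap.ker (coverMap k L)
  have hle : K.map f ≤ LinearMap.range f := LinearMap.map_le_range
  refine ⟨K.map f, LinearMap.range f, hle, ?_⟩
  let q : cover k L →ₗ[R] (LinearMap.range f ⧸ (K.map f).submoduleOf (LinearMap.range f)) :=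
    Submodule.mkQ _ ∘ₗ f.rangeRestrict
  have hq : Function.Surjective q := (Submodule.mkQ_surjective _).comp f.surjective_rangeRestrict
  have hk : LinearMap.ker q = K := by
    ext x
    have hx : x ∈ LinearMap.ker q ↔ f x ∈ K.map f := by
      change (Submodule.Quotient.mk (f.rangeRestrict x) : _ ⧸ _) = 0 ↔ _
      rw [Submodule.Quotient.mk_eq_zero]; rfl
    rw [hx]
    constructor
    · rintro ⟨y, hy, hxy⟩
      have : x - y ∈ LinearMap.ker f := by
        rw [LinearMap.mem_ker, map_sub, hxy]; simp
      have h2 := K.add_mem (ht.ker_le_of_ne_zero f hf this) hy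
      simpa using h2
    · exact fun hx => ⟨x, hx, rfl⟩
  obtain e1 := q.quotKerEquivOfSurjective hq
  obtain e2 := (coverMap k L).quotKerEquivOfSurjective ht.surjective
  exact ⟨e2.symm.trans ((Submodule.quotEquivOfEq _ _ hk.symm).trans e1)⟩

theorem fac_of_isCompositionFactor {L : Sim R} (h : IsCompositionFactor R L.Mod M) :
    Fac k L M := by
  obtain ⟨X, Y, -, ⟨e⟩⟩ := h
  have h1 : Fac k L Y := Fac.of_surjective ((fac_self L).equiv e) _ (Submodule.mkQ_surjective _)
  exact h1.of_submodule

theorem fac_iff {L : Sim R} : IsCompositionFactor R L.Mod M ↔ Fac k L M :=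
  ⟨fac_of_isCompositionFactor, isCompositionFactor_of_fac⟩

/-- A module whose simple quotients lie in `D` is generated by the projective covers of `D`. -/
theorem eq_top_of_forall_cover [Module.Finite R M] (U : Submodule R M)
    (h : ∀ (L : Sim R) (f : M →ₗ[R] L.Mod), f ≠ 0 → ∀ φ : cover k L →ₗ[R] M,
      LinearMap.range φ ≤ U) : U = ⊤ := by
  by_contra hU
  have : Nontrivial (M ⧸ U) := Submodule.Quotient.nontrivial_iff.mpr hU
  obtain ⟨L, f, hf⟩ := exists_ne_zero_simple_quotient (R := R) (M := M ⧸ U)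
  have hs : Function.Surjective (f ∘ₗ U.mkQ) := hf.comp U.mkQ_surjective
  obtain ⟨φ, hφ⟩ := cover_lift (f ∘ₗ U.mkQ) hs (coverMap k L)
  have hr := h L (f ∘ₗ U.mkQ) (by
    intro h0
    exact (coverMap_isTop k L).ne_zero (by rw [← hφ, h0, LinearMap.zero_comp])) φ
  refine (coverMap_isTop k L).ne_zero (LinearMap.ext fun x => ?_)
  rw [← hφ]
  have : U.mkQ (φ x) = 0 := by
    rw [Submodule.mkQ_apply, Submodule.Quotient.mk_eq_zero]
    exact hr (LinearMap.mem_range_self φ x)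
  simp only [LinearMap.comp_apply, this, map_zero, LinearMap.zero_apply]

end Factors

/-! ### The strict relation of a partial order. -/

section Orders

variable {X : Type*} {le : X → X → Prop}

theorem Lt.trans (h : IsPartialOrder X le) {x y z : X} (h1 : Lt le x y) (h2 : Lt le y z) :
    Lt le x z :=
  ⟨trans_of le h1.1 h2.1, fun e => h1.2 (antisymm_of le h1.1 (e ▸ h2.1))⟩

theorem Lt.not_le (h : IsPartialOrder X le) {x y : X} (h1 : Lt le x y) : ¬ le y x :=
  fun h2 => h1.2 (antisymm_of le h1.1 h2)

end Orders

/-! ### Finiteness of the set of simple modules. -/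

section Noetherian

variable (k : Type w) [Field k] {R : Type u} [Ring R] [Algebra k R] [Module.Finite k R]

theorem isNoetherian_of_field (k : Type w) [Field k] {R : Type u} [Ring R] [Algebra k R] [Module.Finite k R]
    (M : Type*) [AddCommGroup M] [Module R M] [Module.Finite R M] :
    IsNoetherian R M := by
  have := IsArtinianRing.of_finite k R
  infer_instance

theorem isArtinian_of_field (k : Type w) [Field k] {R : Type u} [Ring R] [Algebra k R] [Module.Finite k R]
    (M : Type*) [AddCommGroup M] [Module R M] [Module.Finite R M] :
    IsArtinian R M := by
  have := IsArtinianRing.of_finite k R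
  infer_instance

theorem finite_submodule_of_field (k : Type w) [Field k] {R : Type u} [Ring R] [Algebra k R] [Module.Finite k R]
    {M : Type*} [AddCommGroup M] [Module R M] [Module.Finite R M]
    (N : Submodule R M) : Module.Finite R N := by
  have := isNoetherian_of_field k (R := R) M
  infer_instance

instance (L : Sim R) : Module.Finite R (cover k L) := finite_submodule_of_field k _

variable {k}

/-- A sum of submodules is a quotient of their direct sum, and a nonzero map into a direct sum has a
nonzero coordinate. -/
theorem Fac.iSup {ι : Type*} {M : Type*} [AddCommGroup M] [Module R M] {U : ι → Submodule R M}
    {L : Sim R} (h : Fac k L (⨆ i, U i : Submodule R M)) : ∃ i, Fac k L (U i) := by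
  classical
  have hr := Submodule.iSup_eq_range_dfinsupp_lsum U
  rw [hr] at h
  obtain ⟨f, hf⟩ := h.of_range
  by_contra! hc
  refine hf (LinearMap.ext fun x => DFinsupp.ext fun i => ?_)
  by_contra hx
  exact hc i ⟨DFinsupp.lapply i ∘ₗ f, fun h0 => hx (LinearMap.congr_fun h0 x)⟩

/-- Well-founded induction on submodules: each step splits off one simple quotient and so adds at
most one factor. -/
theorem finite_setOf_fac (M : Type*) [AddCommGroup M] [Module R M] [Module.Finite R M] :
    {L : Sim R | Fac k L M}.Finite := by
  have := isArtinian_of_field k (R := R) M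
  have key : ∀ U : Submodule R M, {L : Sim R | Fac k L U}.Finite := by
    intro U
    induction U using WellFoundedLT.induction with
    | _ U ih =>
    have := finite_submodule_of_field k U
    rcases subsingleton_or_nontrivial U with hs | hn
    · convert Set.finite_empty
      rw [Set.eq_empty_iff_forall_notMem]
      intro L hL
      have := Fac.nontrivial hL
      exact false_of_nontrivial_of_subsingleton U
    · obtain ⟨L0, f, hf⟩ := exists_ne_zero_simple_quotient (R := R) (M := U)
      have hlt : (LinearMap.ker f).map U.subtype < U := by
        refine lt_of_le_of_ne (Submodule.map_subtype_le _ _) fun he => ?_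
        have : LinearMap.ker f = ⊤ := by
          apply Submodule.map_injective_of_injective U.injective_subtype
          rw [he, Submodule.map_top, Submodule.range_subtype]
        exact (LinearMap.isCoatom_ker_of_surjective hf).1 this
      refine ((ih _ hlt).union (Set.finite_singleton L0)).subset fun L hL => ?_
      rcases Fac.of_ker hL f with h | h
      · exact Or.inl (h.equiv (Submodule.equivMapOfInjective _ U.injective_subtype _))
      · exact Or.inr h.eq_of_simple
  refine (key ⊤).subset fun L hL => ?_
  exact Fac.equiv hL Submodule.topEquiv.symm

theorem finite_sim (k : Type w) [Field k] (R : Type u) [Ring R] [Algebra k R] [Module.Finite k R] :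
    Finite (Sim R) := by
  rw [← Set.finite_univ_iff]
  refine (finite_setOf_fac (k := k) R).subset fun L _ => ?_
  exact (fac_self L).of_surjective L.ideal.mkQ L.ideal.mkQ_surjective

end Noetherian

/-! ### Traces of projective covers, standard modules and adapted orders. -/

section Traces

variable {k : Type w} [Field k] {R : Type u} [Ring R] [Algebra k R] [Module.Finite k R]

variable (k) in
/-- The sum of the images in `P_L` of the projective covers of the simple modules in `D`. -/
noncomputable def trace (D : Set (Sim R)) (L : Sim R) : Submodule R (cover k L) :=
  ⨆ (L' : Sim R) (_ : L' ∈ D) (φ : cover k L' →ₗ[R] cover k L), LinearMap.range φ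

variable {D : Set (Sim R)} {L : Sim R}

theorem range_le_trace {L' : Sim R} (h : L' ∈ D) (φ : cover k L' →ₗ[R] cover k L) :
    LinearMap.range φ ≤ trace k D L :=
  le_iSup₂_of_le L' h (le_iSup (fun φ : cover k L' →ₗ[R] cover k L => LinearMap.range φ) φ)

theorem trace_le {U : Submodule R (cover k L)}
    (h : ∀ L' ∈ D, ∀ φ : cover k L' →ₗ[R] cover k L, LinearMap.range φ ≤ U) :
    trace k D L ≤ U :=
  iSup_le fun L' => iSup_le fun hL' => iSup_le fun φ => h L' hL' φ

theorem Fac.trace {T : Sim R} (h : Fac k T (trace k D L)) :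
    ∃ L' ∈ D, ∃ φ : cover k L' →ₗ[R] cover k L, Fac k T (LinearMap.range φ) := by
  let U : (Σ L' : D, cover k L'.1 →ₗ[R] cover k L) → Submodule R (cover k L) :=
    fun p => LinearMap.range p.2
  obtain ⟨⟨L', φ⟩, hp⟩ := Fac.iSup (U := U)
    (h.of_le (trace_le fun L' hL' φ => le_iSup U ⟨⟨L', hL'⟩, φ⟩))
  exact ⟨L'.1, L'.2, φ, hp⟩

theorem not_fac_quotient_trace {L' : Sim R} (h : L' ∈ D) :
    ¬ Fac k L' (cover k L ⧸ trace k D L) := by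
  rintro ⟨f, hf⟩
  obtain ⟨g, rfl⟩ := cover_lift _ (Submodule.mkQ_surjective _) f
  refine hf (LinearMap.ext fun x => ?_)
  rw [LinearMap.comp_apply, Submodule.mkQ_apply, LinearMap.zero_apply,
    Submodule.Quotient.mk_eq_zero]
  exact range_le_trace h g (LinearMap.mem_range_self g x)

theorem trace_le_ker {X : Type*} [AddCommGroup X] [Module R X] (f : cover k L →ₗ[R] X)
    (h : ∀ L' ∈ D, ¬ Fac k L' X) : trace k D L ≤ LinearMap.ker f := by
  refine trace_le fun L' hL' φ => ?_
  rintro _ ⟨x, rfl⟩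
  by_contra hx
  exact h L' hL' ⟨f ∘ₗ φ, fun h0 => hx (LinearMap.congr_fun h0 x)⟩

theorem trace_le_ker_coverMap (h : L ∉ D) : trace k D L ≤ LinearMap.ker (coverMap k L) := by
  refine trace_le_ker _ fun L' hL' hf => h ?_
  rwa [← hf.eq_of_simple]

theorem exists_isTop_quotient {K : Submodule R (cover k L)}
    (h : K ≤ LinearMap.ker (coverMap k L)) :
    ∃ q : (cover k L ⧸ K) →ₗ[R] L.Mod, q ∘ₗ K.mkQ = coverMap k L ∧ IsTop q := by
  have : Nontrivial (cover k L ⧸ K) := Submodule.Quotient.nontrivial_iff.mpr fun he =>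
    (coverMap_isTop k L).ne_zero (LinearMap.ker_eq_top.mp (top_le_iff.mp (he ▸ h)))
  exact (coverMap_isTop k L).exists_of_surjective K.mkQ K.mkQ_surjective

theorem socle_simple {M : Type*} [AddCommGroup M] [Module R M] (V : Submodule R M)
    [hV : IsSimpleModule R V] (h : ∀ U : Submodule R M, U ≠ ⊥ → V ≤ U) : socle R M = V := by
  refine le_antisymm (sSup_le fun U hU => ?_) (le_sSup hV)
  have hU' : IsSimpleModule R U := hU
  have ha := isSimpleModule_iff_isAtom.mp hU'
  have hv := isSimpleModule_iff_isAtom.mp hV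
  rcases (h U ha.1).eq_or_lt with he | hlt
  · exact he.ge
  · exact absurd (ha.2 _ hlt) hv.1

/-- The form in which adaptedness is used: `M` need not have simple socle. A further quotient of the
cover is cut down until its socle is the given `T`; its top is still `L`. -/
theorem IsAdapted.exists_fac_gt {le : Sim R → Sim R → Prop} (h : IsAdapted le) {L T : Sim R}
    (K : Submodule R (cover k L)) (hT : Fac k T (cover k L ⧸ K)) (hle : ¬ le T L) :
    ∃ T', Fac k T' (cover k L ⧸ K) ∧ Lt le L T' ∧ le T T' := by
  have hpo := h.partialOrder
  by_cases hLT : le L T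
  · exact ⟨T, hT, ⟨hLT, fun e => hle (e ▸ refl_of le L)⟩, refl_of le T⟩
  obtain ⟨f, hf⟩ := hT
  obtain ⟨g, rfl⟩ := cover_lift _ K.mkQ_surjective f
  have hn := isNoetherian_of_field k (R := R) (cover k L)
  -- `K'` is maximal among the submodules above `K` that do not contain the image of `g`. In the
  -- quotient every nonzero submodule then contains the image of `g`, which is therefore simple and
  -- equal to the socle.
  obtain ⟨K', ⟨hKK', hgK'⟩, hmax⟩ := WellFounded.has_min
    (wellFounded_gt (α := Submodule R (cover k L)))
    {K' | K ≤ K' ∧ ¬ LinearMap.range g ≤ K'} ⟨K, le_rfl, fun hr => hf (by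
      ext x
      have := hr (LinearMap.mem_range_self g x)
      simpa using this)⟩
  let M := cover k L ⧸ K'
  let g' : cover k T →ₗ[R] M := K'.mkQ ∘ₗ g
  have hg' : g' ≠ 0 := fun h0 => hgK' (by
    rintro _ ⟨x, rfl⟩
    exact (Submodule.Quotient.mk_eq_zero K').mp (LinearMap.congr_fun h0 x))
  have hmin : ∀ U : Submodule R M, U ≠ ⊥ → LinearMap.range g' ≤ U := by
    intro U hU
    by_contra hc
    have hle' : K' ≤ U.comap K'.mkQ := by
      intro x hx
      rw [Submodule.mem_comap, Submodule.mkQ_apply, (Submodule.Quotient.mk_eq_zero K').mpr hx]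
      exact U.zero_mem
    refine hmax (U.comap K'.mkQ) ⟨hKK'.trans hle', fun hr => hc ?_⟩ (lt_of_le_of_ne hle' ?_)
    · rintro _ ⟨x, rfl⟩
      exact hr (LinearMap.mem_range_self g x)
    · intro he
      apply hU
      rw [eq_bot_iff]
      intro y hy
      obtain ⟨x, rfl⟩ := K'.mkQ_surjective y
      have : x ∈ U.comap K'.mkQ := hy
      rw [← he] at this
      exact (Submodule.Quotient.mk_eq_zero K').mpr this
  have hat : IsAtom (LinearMap.range g') := by
    refine ⟨fun hb => hg' (LinearMap.range_eq_bot.mp hb), fun U hU => ?_⟩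
    by_contra hne
    exact absurd (hmin U hne) (not_le_of_gt hU)
  have hs := isSimpleModule_iff_isAtom.mpr hat
  obtain ⟨e1, -⟩ := (coverMap_isTop k T).exists_equiv_of_ne_zero g'.rangeRestrict (by
    intro h0
    exact hg' (LinearMap.ext fun x => congrArg Subtype.val (LinearMap.congr_fun h0 x)))
  have hsoc : socle R M = LinearMap.range g' := socle_simple _ hmin
  have hK'le : K' ≤ LinearMap.ker (coverMap k L) :=
    (coverMap_isTop k L).le_ker _ fun he => hgK' (he ▸ le_top)
  obtain ⟨q, -, hq⟩ := exists_isTop_quotient hK'le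
  have e2 : Top R M ≃ₗ[R] L.Mod :=
    (Submodule.quotEquivOfEq _ _ hq.jacobson_eq).trans (q.quotKerEquivOfSurjective hq.surjective)
  obtain ⟨L'', h1, h2, h3⟩ := h.exists_gt M L T ⟨e2⟩
    ⟨(LinearEquiv.ofEq _ _ hsoc).trans e1.symm⟩ hLT hle
  refine ⟨L'', ?_, h2, h3.1⟩
  exact (fac_of_isCompositionFactor h1).of_surjective (Submodule.factor hKK')
    (Submodule.factor_surjective hKK')

/-- If a factor not below `L` survived after factoring out the covers of all simple modules above
`L`, adaptedness would produce a surviving factor above `L`. -/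
theorem IsAdapted.standardKernel_eq {le : Sim R → Sim R → Prop} (h : IsAdapted le) (L : Sim R) :
    standardKernel k le L = trace k {L' | Lt le L L'} L := by
  have hpo := h.partialOrder
  refine le_antisymm (trace_le fun L' hL' φ => ?_)
    (trace_le fun L' hL' φ => range_le_trace (hL'.not_le hpo) φ)
  by_contra hc
  obtain ⟨T', h1, h2, -⟩ := h.exists_fac_gt (k := k) (T := L') (trace k {L' | Lt le L L'} L)
    ⟨Submodule.mkQ _ ∘ₗ φ, fun h0 => hc (by
      rintro _ ⟨x, rfl⟩
      have := LinearMap.congr_fun h0 x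
      simpa using this)⟩ hL'
  exact not_fac_quotient_trace h2 h1

theorem fac_standard_le {le : Sim R → Sim R → Prop} {L T : Sim R}
    (hT : Fac k T (Standard k le L)) : le T L := by
  by_contra hc
  exact not_fac_quotient_trace (D := {L' | ¬ le L' L}) hc hT

theorem standardKernel_le_ker {le : Sim R → Sim R → Prop} (h : IsPartialOrder (Sim R) le)
    (L : Sim R) : standardKernel k le L ≤ LinearMap.ker (coverMap k L) :=
  trace_le_ker_coverMap fun hc => hc (refl_of le L)

theorem exists_isTop_standard {le : Sim R → Sim R → Prop} (h : IsPartialOrder (Sim R) le)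
    (L : Sim R) : ∃ q : Standard k le L →ₗ[R] L.Mod,
      q ∘ₗ (standardKernel k le L).mkQ = coverMap k L ∧ IsTop q :=
  exists_isTop_quotient (standardKernel_le_ker h L)

/-- The kernel is generated by images of covers of simple modules strictly above `L`, none of which
is a factor of the standard module. -/
theorem IsAdapted.hom_standardKernel_eq_zero {le : Sim R → Sim R → Prop} (h : IsAdapted le)
    {L : Sim R} (f : standardKernel k le L →ₗ[R] Standard k le L) : f = 0 := by
  have hle : trace k {L' | Lt le L L'} L ≤
      (LinearMap.ker f).map (standardKernel k le L).subtype := by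
    refine trace_le fun L' hL' φ => ?_
    have hφ : ∀ x, φ x ∈ standardKernel k le L := fun x => by
      rw [h.standardKernel_eq]
      exact range_le_trace (D := {L' | Lt le L L'}) hL' φ (LinearMap.mem_range_self φ x)
    rintro _ ⟨x, rfl⟩
    refine ⟨φ.codRestrict _ hφ x, ?_, rfl⟩
    by_contra hx
    exact hL'.not_le h.partialOrder (fac_standard_le (k := k)
      ⟨f ∘ₗ φ.codRestrict _ hφ, fun h0 => hx (LinearMap.congr_fun h0 x)⟩)
  rw [← h.standardKernel_eq] at hle
  ext x
  obtain ⟨y, hy, hyx⟩ := hle x.2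
  have : y = x := Subtype.ext hyx
  subst this
  rw [LinearMap.mem_ker.mp hy]; rfl

-- The long exact sequence of the projective presentation makes `Ext¹` a quotient of the maps from
-- the kernel to the standard module, all of which vanish. The Ext condition in quasi-heredity thus
-- follows from adaptedness.
open CategoryTheory in
theorem IsAdapted.subsingleton_ext {le : Sim R → Sim R → Prop} (h : IsAdapted le) (L : Sim R) :
    Subsingleton (CategoryTheory.Abelian.Ext
      (ModuleCat.of R (Standard k le L)) (ModuleCat.of R (Standard k le L)) 1) := by
  let S : ShortComplex (ModuleCat R) := ShortComplex.mk
    (ModuleCat.ofHom (standardKernel k le L).subtype) (ModuleCat.ofHom (standardKernel k le L).mkQ)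
    (by ext x; simp)
  have hS : S.ShortExact := by
    refine { exact := ?_, mono_f := ?_, epi_g := ?_ }
    · rw [ShortComplex.moduleCat_exact_iff]
      intro x hx
      refine ⟨⟨x, ?_⟩, rfl⟩
      have : (standardKernel k le L).mkQ x = 0 := hx
      simpa using this
    · exact (ModuleCat.mono_iff_injective _).mpr (Submodule.injective_subtype _)
    · exact (ModuleCat.epi_iff_surjective _).mpr (Submodule.mkQ_surjective _)
  have hP : Projective S.X₂ := (IsProjective.iff_projective _).mp
    (inferInstanceAs (Module.Projective R (cover k L)))
  refine ⟨fun x y => ?_⟩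
  have key : ∀ x : Abelian.Ext S.X₃ (ModuleCat.of R (Standard k le L)) 1, x = 0 := by
    intro x
    obtain ⟨y, rfl⟩ := Abelian.Ext.contravariant_sequence_exact₃ hS _ x
      (Abelian.Ext.eq_zero_of_projective _) (n₀ := 0) rfl
    obtain ⟨f, rfl⟩ := Abelian.Ext.mk₀_bijective _ _ |>.2 y
    have : f = 0 := by
      apply ModuleCat.hom_ext
      exact h.hom_standardKernel_eq_zero f.hom
    rw [this, Abelian.Ext.mk₀_zero, Abelian.Ext.comp_zero]
  rw [key x, key y]

end Traces

/-! ### Directed algebras and the factors of radicals of projective covers. -/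

section Directed

variable {k : Type w} [Field k] {R : Type u} [Ring R] [Algebra k R] [Module.Finite k R]

variable (k) in
/-- `T'` is a composition factor of the radical of the projective cover of `T`. -/
def InRad (T T' : Sim R) : Prop := Fac k T' (Module.jacobson R (cover k T))

theorem inRad_of_isTop {M : Type*} [AddCommGroup M] [Module R M] {L T : Sim R}
    {p : M →ₗ[R] L.Mod} (hp : IsTop p) (h : Fac k T (LinearMap.ker p)) : InRad k L T := by
  obtain ⟨g, hg⟩ := cover_lift p hp.surjective (coverMap k L)
  have hs : Function.Surjective g :=
    hp.surjective_of_comp_ne_zero g (hg ▸ (coverMap_isTop k L).ne_zero)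
  unfold InRad
  rw [(coverMap_isTop k L).jacobson_eq]
  refine h.of_surjective (g.restrict (p := LinearMap.ker (coverMap k L)) fun x hx => ?_) ?_
  · rw [← hg] at hx; exact hx
  · rintro ⟨y, hy⟩
    obtain ⟨x, rfl⟩ := hs y
    exact ⟨⟨x, by rw [← hg]; exact hy⟩, rfl⟩

theorem wellFounded_gt_of_finite {X : Type*} [Finite X] {le : X → X → Prop}
    (h : IsPartialOrder X le) : WellFounded fun x y => Lt le y x :=
  have : IsTrans X fun x y => Lt le y x := ⟨fun _ _ _ h1 h2 => h2.trans h h1⟩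
  have : Std.Irrefl fun x y => Lt le y x := ⟨fun _ hx => hx.2 rfl⟩
  Finite.wellFounded_of_trans_of_irrefl _

/-- Induction from the top of the order. As the standard module is simple, `rad P_L` is generated by
images of `P_{L'}` with `L' > L`; a factor of such an image is `L'` or a factor of `rad P_{L'}`. -/
theorem IsDirectedAlgebra.lt_of_inRad {le : Sim R → Sim R → Prop} (h : IsDirectedAlgebra k le)
    {L T : Sim R} (hT : InRad k L T) : Lt le L T := by
  have hpo := h.adapted.partialOrder
  have := finite_sim k R
  revert T
  induction L using (wellFounded_gt_of_finite hpo).induction with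
  | _ L ih =>
  intro T hT
  have hle : LinearMap.ker (coverMap k L) ≤ standardKernel k le L := by
    obtain ⟨q, hq, hqt⟩ := exists_isTop_standard (k := k) hpo L
    obtain ⟨e⟩ := h.standard_equiv L
    have : IsSimpleModule R (Standard k le L) := IsSimpleModule.congr e
    have hi := LinearMap.injective_of_ne_zero hqt.ne_zero
    intro x hx
    rw [← hq] at hx
    have := hi (a₁ := (standardKernel k le L).mkQ x) (a₂ := 0) (by rw [map_zero]; exact hx)
    simpa using this
  unfold InRad at hT
  rw [(coverMap_isTop k L).jacobson_eq] at hT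
  obtain ⟨L', hL', φ, h1⟩ := (hT.of_le (hle.trans (h.adapted.standardKernel_eq L).le)).trace
  rcases h1.of_range.of_ker (coverMap k L') with h2 | h2
  · rw [← (coverMap_isTop k L').jacobson_eq] at h2
    exact Lt.trans hpo hL' (ih L' hL' h2)
  · rwa [h2.eq_of_simple]

theorem eq_or_inRad {M : Type*} [AddCommGroup M] [Module R M] {L L' : Sim R}
    {p : M →ₗ[R] L.Mod} (hp : IsTop p) (f : L'.Mod →ₗ[R] M) (hf : f ≠ 0) :
    L' = L ∨ InRad k L L' := by
  by_cases h0 : p ∘ₗ f = 0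
  · have hk : ∀ x, f x ∈ LinearMap.ker p := fun x => LinearMap.mem_ker.mpr (LinearMap.congr_fun h0 x)
    refine Or.inr (inRad_of_isTop hp (fac_of_injective_simple (f.codRestrict _ hk) fun h1 => hf ?_))
    rw [← LinearMap.subtype_comp_codRestrict f _ hk, h1, LinearMap.comp_zero]
  · exact Or.inl (Sim.nonzero_hom_eq _ h0)

theorem exists_isTop_of_top_equiv {M : Type*} [AddCommGroup M] [Module R M] [Module.Finite R M]
    {L : Sim R} (e : Top R M ≃ₗ[R] L.Mod) : ∃ p : M →ₗ[R] L.Mod, IsTop p := by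
  refine ⟨e.toLinearMap ∘ₗ (Module.jacobson R M).mkQ, isTop_of_superfluous _
    (e.surjective.comp (Submodule.mkQ_surjective _)) ?_⟩
  rw [LinearEquiv.ker_comp, Submodule.ker_mkQ]
  exact eq_top_of_sup_jacobson

/-- The condition on incomparable pairs is vacuous: the socle of a module with top `L` is `L` itself
or a factor of `rad P_L`, hence comparable with `L`. -/
theorem isAdapted_of_inRad {le : Sim R → Sim R → Prop} (hpo : IsPartialOrder (Sim R) le)
    (h : ∀ L T, InRad k L T → Lt le L T) : IsAdapted le := by
  refine { partialOrder := hpo, exists_gt := ?_ }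
  rintro M _ _ _ L L' ⟨e1⟩ ⟨e2⟩ h1 h2
  obtain ⟨p, hp⟩ := exists_isTop_of_top_equiv e1
  have hf : (socle R M).subtype ∘ₗ e2.symm.toLinearMap ≠ 0 := by
    intro h0
    have := IsSimpleModule.nontrivial R L'.Mod
    obtain ⟨y, hy⟩ := exists_ne (0 : L'.Mod)
    refine hy (e2.symm.injective (Subtype.ext ?_))
    rw [map_zero]
    exact LinearMap.congr_fun h0 y
  rcases eq_or_inRad (k := k) hp _ hf with he | hr
  · exact absurd (he ▸ refl_of le L') h1
  · exact absurd (h _ _ hr).1 h1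

/-- Converse of `IsDirectedAlgebra.lt_of_inRad`. The simple quotients of `rad P_L` are strictly
above `L`, so their covers, which generate the radical, all enter the kernel of the standard module.
-/
theorem isDirectedAlgebra_of_inRad {le : Sim R → Sim R → Prop} (hpo : IsPartialOrder (Sim R) le)
    (h : ∀ L T, InRad k L T → Lt le L T) : IsDirectedAlgebra k le := by
  refine ⟨isAdapted_of_inRad hpo h, fun L => ?_⟩
  · obtain ⟨q, hq, hqt⟩ := exists_isTop_standard (k := k) hpo L
    have hle : LinearMap.ker (coverMap k L) ≤ standardKernel k le L := by
      have := finite_submodule_of_field k (LinearMap.ker (coverMap k L))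
      rw [← Submodule.submoduleOf_eq_top]
      refine eq_top_of_forall_cover (k := k) _ fun L' f hf φ => ?_
      rintro _ ⟨x, rfl⟩
      have h1 : InRad k L L' := by
        unfold InRad
        rw [(coverMap_isTop k L).jacobson_eq]
        exact fac_of_surjective_simple f hf
      exact range_le_trace (D := {L' | ¬ le L' L}) ((h _ _ h1).not_le hpo)
        ((LinearMap.ker (coverMap k L)).subtype ∘ₗ φ) ⟨x, rfl⟩
    refine ⟨LinearEquiv.ofBijective q ⟨?_, hqt.surjective⟩⟩
    rw [← LinearMap.ker_eq_bot, eq_bot_iff]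
    intro y hy
    obtain ⟨x, rfl⟩ := Submodule.mkQ_surjective _ y
    have : x ∈ LinearMap.ker (coverMap k L) := by rw [← hq]; exact hy
    simpa using hle this

end Directed

/-- `Γ` is a skew group ring of `G` over `R`: it contains `R`, it has units `u g` inducing the
action of `G` on `R`, and every element is uniquely of the form `∑ r_g u_g`; the map `c` is the
coefficient at `1`. -/
class SkewExt (R Γ G : Type*) [Ring R] [Ring Γ] [Group G] [Fintype G] [MulSemiringAction G R]
    [Module R Γ] where
  u : G →* Γ
  c : Γ →ₗ[R] R
  u_mul_smul_one : ∀ (g : G) (r : R), u g * (r • 1) = (g • r) • u g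
  sum_c : ∀ x : Γ, ∑ g, c (x * u g⁻¹) • u g = x
  c_one : c 1 = 1
  c_u : ∀ g : G, g ≠ 1 → c (u g) = 0

/-! ### Modules over skew group rings: translates and restriction of semisimple modules. -/

section Basic

set_option linter.unusedSectionVars false

variable (R Γ : Type*) {G : Type*} [Ring R] [Ring Γ] [Group G] [Fintype G] [MulSemiringAction G R]
  [Module R Γ] [SkewExt R Γ G]

/-- The unit of the skew group ring belonging to a group element. -/
abbrev uu : G →* Γ := SkewExt.u (R := R)

variable (G) in
/-- The coefficient at `1`. -/
abbrev cc : Γ →ₗ[R] R := SkewExt.c (G := G)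

variable {R Γ}

variable {M X : Type*} [AddCommGroup M] [Module R M] [Module Γ M] [IsScalarTower R Γ M]
  [AddCommGroup X] [Module R X] [Module Γ X] [IsScalarTower R Γ X]

theorem uu_smul_smul (g : G) (r : R) (m : M) :
    uu R Γ g • r • m = (g • r) • uu R Γ g • m := by
  rw [← one_smul Γ m, ← smul_assoc r (1 : Γ) m, smul_smul, SkewExt.u_mul_smul_one, smul_assoc,
    one_smul]

theorem uu_inv_smul_uu (g : G) (m : M) : uu R Γ g⁻¹ • uu R Γ g • m = m := by
  rw [smul_smul, ← map_mul, inv_mul_cancel, map_one, one_smul]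

theorem uu_smul_uu_inv (g : G) (m : M) : uu R Γ g • uu R Γ g⁻¹ • m = m := by
  rw [smul_smul, ← map_mul, mul_inv_cancel, map_one, one_smul]

variable (R G) in
theorem sum_c_smul (x : Γ) (m : M) :
    ∑ g : G, cc R Γ G (x * uu R Γ g⁻¹) • uu R Γ g • m = x • m := by
  conv_rhs => rw [← SkewExt.sum_c (R := R) (G := G) x]
  rw [Finset.sum_smul]
  exact Finset.sum_congr rfl fun g _ => (smul_assoc _ _ _).symm

/-- A map compatible with the coefficients and with the group is linear over the skew group ring. -/
def linearOfStable (f : M →ₗ[R] X) (h : ∀ (g : G) m, f (uu R Γ g • m) = uu R Γ g • f m) :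
    M →ₗ[Γ] X where
  toFun := f
  map_add' := f.map_add
  map_smul' x m := by
    rw [← sum_c_smul R G x m, map_sum, RingHom.id_apply, ← sum_c_smul R G x (f m)]
    exact Finset.sum_congr rfl fun g _ => by rw [map_smul, h]

/-- A submodule over the coefficients that is stable under the group. -/
def submoduleOfStable (N : Submodule R M) (h : ∀ (g : G), ∀ m ∈ N, uu R Γ g • m ∈ N) :
    Submodule Γ M where
  carrier := N
  add_mem' := N.add_mem
  zero_mem' := N.zero_mem
  smul_mem' x m hm := by
    rw [← sum_c_smul R G x m]
    exact N.sum_mem fun g _ => N.smul_mem _ (h g m hm)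

theorem finite_skew (G : Type*) [Group G] [Fintype G] [MulSemiringAction G R]
    [SkewExt R Γ G] : Module.Finite R Γ := by
  classical
  refine ⟨⟨Finset.univ.image (uu R Γ : G → Γ), ?_⟩⟩
  rw [eq_top_iff]
  rintro x -
  rw [← SkewExt.sum_c (R := R) (G := G) x]
  exact Submodule.sum_mem _ fun g _ => Submodule.smul_mem _ _
    (Submodule.subset_span (by simp))

variable (Γ) in
theorem finite_restrict (G : Type*) [Group G] [Fintype G] [MulSemiringAction G R]
    [SkewExt R Γ G]
    (M : Type*) [AddCommGroup M] [Module R M] [Module Γ M]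
    [IsScalarTower R Γ M] [Module.Finite Γ M] : Module.Finite R M :=
  have := finite_skew G (R := R) (Γ := Γ)
  Module.Finite.trans Γ M

/-- The translate `g N` of a submodule. -/
def translate (g : G) (N : Submodule R M) : Submodule R M where
  carrier := {m | uu R Γ g⁻¹ • m ∈ N}
  add_mem' {a b} ha hb := by
    rw [Set.mem_ofPred_eq, smul_add]; exact N.add_mem ha hb
  zero_mem' := by rw [Set.mem_ofPred_eq, smul_zero]; exact N.zero_mem
  smul_mem' r m hm := by
    rw [Set.mem_ofPred_eq, uu_smul_smul]; exact N.smul_mem _ hm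

theorem mem_translate {g : G} {N : Submodule R M} {m : M} :
    m ∈ translate (Γ := Γ) g N ↔ uu R Γ g⁻¹ • m ∈ N := Iff.rfl

variable (Γ) in
/-- Translation of submodules as an automorphism of the lattice of submodules. -/
def translateIso (g : G) : Submodule R M ≃o Submodule R M where
  toFun := translate (Γ := Γ) g
  invFun := translate (Γ := Γ) g⁻¹
  left_inv N := by
    ext m
    rw [mem_translate, mem_translate, inv_inv, uu_inv_smul_uu]
  right_inv N := by
    ext m
    rw [mem_translate, mem_translate, inv_inv, uu_smul_uu_inv]
  map_rel_iff' {N N'} := by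
    refine ⟨fun h m hm => ?_, fun h m hm => h hm⟩
    have : uu R Γ g • m ∈ translate (Γ := Γ) g N := by
      rw [mem_translate, uu_inv_smul_uu]; exact hm
    have := h this
    change uu R Γ g • m ∈ translate (Γ := Γ) g N' at this
    rwa [mem_translate, uu_inv_smul_uu] at this

theorem uu_smul_mem_of_translate_eq {N : Submodule R M}
    (h : ∀ g : G, translateIso Γ g N = N) (g : G) (m : M) (hm : m ∈ N) : uu R Γ g • m ∈ N := by
  rw [← h g]
  change uu R Γ g • m ∈ translate (Γ := Γ) g N
  rwa [mem_translate, uu_inv_smul_uu]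

variable (Γ) in
-- Translation by `g` is an automorphism of the lattice of submodules, so it permutes the atoms.
theorem translate_sSup_atoms (g : G) :
    translateIso Γ g (sSup {N : Submodule R M | IsAtom N}) = sSup {N : Submodule R M | IsAtom N} := by
  rw [map_sSup, sSup_eq_iSup]
  refine le_antisymm (iSup₂_le ?_) (sSup_le fun N hN => ?_)
  · rintro _ ⟨N, hN, rfl⟩
    exact le_sSup ((OrderIso.isAtom_iff (translateIso Γ g) N).mpr hN)
  · refine le_iSup₂_of_le N ⟨(translateIso Γ g).symm N, ?_, by simp⟩ le_rfl
    exact (OrderIso.isAtom_iff (translateIso Γ g).symm N).mpr hN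

variable (Γ) in
theorem translate_jacobson (g : G) :
    translateIso Γ g (Module.jacobson R M) = Module.jacobson R M := by
  rw [Module.jacobson, map_sInf, sInf_eq_iInf]
  refine le_antisymm (le_sInf fun N hN => ?_) (le_iInf₂ ?_)
  · refine iInf₂_le_of_le N ⟨(translateIso Γ g).symm N, ?_, by simp⟩ le_rfl
    exact (OrderIso.isCoatom_iff (translateIso Γ g).symm N).mpr hN
  · rintro _ ⟨N, hN, rfl⟩
    exact sInf_le ((OrderIso.isCoatom_iff (translateIso Γ g) N).mpr hN)

/-- A module generated over the skew group ring by a semisimple submodule is semisimple. -/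
theorem isSemisimple_of_span_eq_top (G : Type*) [Group G] [Fintype G] [MulSemiringAction G R]
    [SkewExt R Γ G]
    (N : Submodule R M) [IsSemisimpleModule R N]
    (h : Submodule.span Γ (N : Set M) = ⊤) : IsSemisimpleModule R M := by
  set s : Submodule R M := sSup {N : Submodule R M | IsAtom N}
  let s' : Submodule Γ M := submoduleOfStable s
    (uu_smul_mem_of_translate_eq fun g : G => translate_sSup_atoms Γ g)
  have hN : N ≤ s := by
    have h1 := IsSemisimpleModule.sSup_simples_eq_top R N
    have h2 : (⊤ : Submodule R N) ≤ s.comap N.subtype := by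
      rw [← h1]
      refine sSup_le fun U hU => ?_
      rw [← Submodule.map_le_iff_le_comap]
      have : IsSimpleModule R U := hU
      have : IsSimpleModule R (U.map N.subtype) :=
        IsSimpleModule.congr (Submodule.equivMapOfInjective _ N.injective_subtype U).symm
      exact le_sSup (isSimpleModule_iff_isAtom.mp this)
    exact fun x hx => h2 (x := ⟨x, hx⟩) Submodule.mem_top
  have hs' : s' = ⊤ := by
    rw [eq_top_iff, ← h, Submodule.span_le]
    exact fun x hx => hN hx
  refine IsSemisimpleModule.of_sSup_simples_eq_top ?_
  simp_rw [isSimpleModule_iff_isAtom]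
  rw [eq_top_iff]
  intro x _
  have : x ∈ s' := hs' ▸ Submodule.mem_top
  exact this

variable (R) in
-- Clifford's theorem: any simple `R`-submodule generates the whole module over `Γ`.
theorem isSemisimple_of_isSimple (G : Type*) [Group G] [Fintype G] [MulSemiringAction G R]
    [SkewExt R Γ G]
    [IsArtinianRing R] [IsSimpleModule Γ M] :
    IsSemisimpleModule R M := by
  have := IsSimpleModule.nontrivial Γ M
  obtain ⟨N, hN⟩ := exists_simple_submodule (R := R) (M := M)
  refine isSemisimple_of_span_eq_top G N ?_ (Γ := Γ)
  refine (eq_bot_or_eq_top _).resolve_left fun hb => ?_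
  have : N ≠ ⊥ := (isSimpleModule_iff_isAtom.mp hN).1
  refine this (eq_bot_iff.mpr fun x hx => ?_)
  have : x ∈ Submodule.span Γ (N : Set M) := Submodule.subset_span hx
  rwa [hb] at this

variable (R Γ) in
theorem isSemisimple_restrict (G : Type*) [Group G] [Fintype G] [MulSemiringAction G R]
    [SkewExt R Γ G]
    [IsArtinianRing R] [IsSemisimpleModule Γ M] :
    IsSemisimpleModule R M := by
  have hs := IsSemisimpleModule.sSup_simples_eq_top Γ M
  rw [sSup_eq_iSup'] at hs
  let p : {m : Submodule Γ M | IsSimpleModule Γ m} → Submodule R M := fun m =>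
    (m.1).restrictScalars R
  have hp : ∀ i, IsSemisimpleModule R (p i) := fun i => by
    have : IsSimpleModule Γ i.1 := i.2
    exact isSemisimple_of_isSimple (M := i.1) R G (Γ := Γ)
  refine isSemisimpleModule_of_isSemisimpleModule_submodule' (p := p) hp ?_
  apply_fun Submodule.restrictScalars R at hs
  rw [Submodule.restrictScalars_top] at hs
  rw [← hs, eq_comm]
  exact map_iSup (Submodule.restrictScalarsLatticeHom R Γ M) _

end Basic

/-! ### Coinduction as a two-sided adjoint of restriction, and averaging. -/

section CoInduction

set_option linter.unusedSectionVars false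

variable {R Γ : Type*} [Ring R] [Ring Γ] [Module R Γ] [IsScalarTower R Γ Γ]

/-- Right multiplication by `x` as a map of left modules. -/
def rightMul (x : Γ) : Γ →ₗ[R] Γ where
  toFun y := y * x
  map_add' a b := add_mul a b x
  map_smul' r y := smul_mul_assoc r y x

variable (R Γ) in
/-- The coinduced module `Hom_R(Γ, N)`. -/
def CoInd (N : Type*) [AddCommGroup N] [Module R N] := Γ →ₗ[R] N

variable {M N X Y : Type*} [AddCommGroup M] [Module R M] [Module Γ M] [IsScalarTower R Γ M]
  [AddCommGroup N] [Module R N] [AddCommGroup X] [Module R X] [AddCommGroup Y] [Module R Y]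

instance : AddCommGroup (CoInd R Γ N) := inferInstanceAs (AddCommGroup (Γ →ₗ[R] N))

instance : FunLike (CoInd R Γ N) Γ N := inferInstanceAs (FunLike (Γ →ₗ[R] N) Γ N)

instance : Module Γ (CoInd R Γ N) where
  smul x f := LinearMap.comp (show Γ →ₗ[R] N from f) (rightMul x)
  one_smul f := LinearMap.ext fun y => congrArg f (mul_one y)
  mul_smul a b f := LinearMap.ext fun y => congrArg f (mul_assoc y a b).symm
  smul_zero a := LinearMap.zero_comp _
  smul_add a f g := LinearMap.add_comp _ _ _
  add_smul a b f := LinearMap.ext fun y => by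
    change (show Γ →ₗ[R] N from f) (y * (a + b)) = (show Γ →ₗ[R] N from f) (y * a) +
      (show Γ →ₗ[R] N from f) (y * b)
    rw [mul_add, map_add]
  zero_smul f := LinearMap.ext fun y => by
    change (show Γ →ₗ[R] N from f) (y * 0) = 0
    rw [mul_zero, map_zero]

/-- The ring `R` acts through `Γ`, that is by right multiplication in the argument and not on the
values. -/
instance : Module R (CoInd R Γ N) := Module.compHom _ (RingHom.smulOneHom : R →+* Γ)

namespace CoInd

theorem ext {f g : CoInd R Γ N} (h : ∀ y, f y = g y) : f = g := LinearMap.ext h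

theorem smul_apply (x : Γ) (f : CoInd R Γ N) (y : Γ) : (x • f) y = f (y * x) := rfl

theorem map_smul_apply (f : CoInd R Γ N) (r : R) (y : Γ) : f (r • y) = r • f y :=
  LinearMap.map_smul (show Γ →ₗ[R] N from f) r y

theorem restrict_smul (r : R) (f : CoInd R Γ N) : r • f = (r • (1 : Γ)) • f := rfl

instance : IsScalarTower R Γ (CoInd R Γ N) :=
  ⟨fun r x f => by rw [restrict_smul, smul_smul, smul_mul_assoc, one_mul]⟩

variable (R Γ N) in
/-- Evaluation at `1`. -/
def ev : CoInd R Γ N →ₗ[R] N where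
  toFun f := f 1
  map_add' _ _ := rfl
  map_smul' r f := by
    rw [restrict_smul, smul_apply, one_mul, map_smul_apply]; rfl

theorem ev_apply (f : CoInd R Γ N) : ev R Γ N f = f 1 := rfl

theorem ev_smul (x : Γ) (f : CoInd R Γ N) : ev R Γ N (x • f) = f x := by
  rw [ev_apply, smul_apply, one_mul]

/-- The adjunction between restriction and coinduction. -/
def hat (φ : M →ₗ[R] N) : M →ₗ[Γ] CoInd R Γ N where
  toFun m := φ ∘ₗ (LinearMap.toSpanSingleton Γ M m).restrictScalars R
  map_add' a b := LinearMap.ext fun y => by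
    change φ (y • (a + b)) = φ (y • a) + φ (y • b)
    rw [smul_add, map_add]
  map_smul' x m := LinearMap.ext fun y => by
    change φ (y • x • m) = φ ((y * x) • m)
    rw [mul_smul]

theorem hat_apply (φ : M →ₗ[R] N) (m : M) (y : Γ) : hat (Γ := Γ) φ m y = φ (y • m) := rfl

theorem ev_hat (φ : M →ₗ[R] N) (m : M) : ev R Γ N (hat φ m) = φ m := by
  rw [ev_apply, hat_apply, one_smul]

/-- Functoriality of coinduction. -/
def map (p : X →ₗ[R] Y) : CoInd R Γ X →ₗ[Γ] CoInd R Γ Y where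
  toFun f := LinearMap.comp p (show Γ →ₗ[R] X from f)
  map_add' _ _ := LinearMap.comp_add _ _ _
  map_smul' _ _ := rfl

theorem map_apply (p : X →ₗ[R] Y) (f : CoInd R Γ X) (y : Γ) : map p f y = p (f y) := rfl

end CoInd

variable {G : Type*} [Group G] [Fintype G] [MulSemiringAction G R] [SkewExt R Γ G]

theorem cc_uu [DecidableEq G] (g : G) : cc R Γ G (uu R Γ g) = if g = 1 then 1 else 0 := by
  split_ifs with h
  · rw [h, map_one, SkewExt.c_one]
  · exact SkewExt.c_u g h

/-- The coefficient at `1` is also linear for right multiplication by `R`; this is what makes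
`CoInd.ι` linear. -/
theorem cc_mul_smul_one (y : Γ) (r : R) :
    cc R Γ G (y * (r • 1)) = cc R Γ G y * r := by
  classical
  have h := SkewExt.sum_c (R := R) (G := G) y
  have key : ∀ (g : G) (a : R), cc R Γ G ((a • uu R Γ g) * (r • 1)) = cc R Γ G (a • uu R Γ g) * r := by
    intro g a
    rw [smul_mul_assoc, SkewExt.u_mul_smul_one, map_smul, map_smul, map_smul, cc_uu]
    split_ifs with hg
    · simp [hg]
    · simp
  rw [← h, Finset.sum_mul, map_sum, map_sum, Finset.sum_mul]
  exact Finset.sum_congr rfl fun g _ => key g _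

namespace CoInd

variable (R Γ N) in
/-- The embedding of a module into its coinduced module, which generates it. -/
def ι (G : Type*) [Group G] [Fintype G] [MulSemiringAction G R] [SkewExt R Γ G] :
    N →ₗ[R] CoInd R Γ N where
  toFun n := (cc R Γ G).smulRight n
  map_add' a b := LinearMap.ext fun y => smul_add (cc R Γ G y) a b
  map_smul' r n := CoInd.ext fun y => by
    change cc R Γ G y • r • n = cc R Γ G (y * (r • 1)) • n
    rw [cc_mul_smul_one, mul_smul]

theorem ι_apply (n : N) (y : Γ) : ι R Γ N G n y = cc R Γ G y • n := rfl

theorem ev_ι (n : N) : ev R Γ N (ι R Γ N G n) = n := by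
  rw [ev_apply, ι_apply, SkewExt.c_one, one_smul]

theorem ι_injective : Function.Injective (ι R Γ N G) := fun a b h => by
  rw [← ev_ι (R := R) (Γ := Γ) (G := G) a, h, ev_ι]

theorem apply_eq_sum (f : CoInd R Γ N) (y : Γ) :
    f y = ∑ g : G, cc R Γ G (y * uu R Γ g⁻¹) • f (uu R Γ g) := by
  conv_lhs => rw [← SkewExt.sum_c (R := R) (G := G) y]
  change (show Γ →ₗ[R] N from f) _ = _
  rw [map_sum]
  exact Finset.sum_congr rfl fun g _ => map_smul_apply f _ _

theorem sum_apply {κ : Type*} (s : Finset κ) (f : κ → CoInd R Γ N) (y : Γ) :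
    (∑ i ∈ s, f i) y = ∑ i ∈ s, f i y :=
  LinearMap.sum_apply s (fun i => (show Γ →ₗ[R] N from f i)) y

/-- A coinduced module is the sum of the translates of the copy of `N` given by `CoInd.ι`, so
coinduction also plays the role of induction. -/
theorem eq_sum (f : CoInd R Γ N) :
    f = ∑ g : G, uu R Γ g⁻¹ • ι R Γ N G (f (uu R Γ g)) := by
  apply ext
  intro y
  rw [sum_apply, apply_eq_sum (G := G)]
  rfl

theorem span_ι : Submodule.span Γ (LinearMap.range (ι R Γ N G) : Set (CoInd R Γ N)) = ⊤ := by
  rw [eq_top_iff]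
  rintro f -
  rw [eq_sum (G := G) f]
  exact Submodule.sum_mem _ fun g _ => Submodule.smul_mem _ _
    (Submodule.subset_span (LinearMap.mem_range_self _ _))

theorem finite (G : Type*) [Group G] [Fintype G] [MulSemiringAction G R] [SkewExt R Γ G]
    [Module.Finite R N] : Module.Finite Γ (CoInd R Γ N) := by
  classical
  obtain ⟨s, hs⟩ := (Module.Finite.fg_top : (⊤ : Submodule R N).FG)
  refine ⟨⟨s.image (ι R Γ N G), ?_⟩⟩
  rw [eq_top_iff, ← span_ι (G := G), Submodule.span_le]
  rintro _ ⟨n, rfl⟩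
  have hle : (⊤ : Submodule R N) ≤ ((Submodule.span Γ (s.image (ι R Γ N G) : Set (CoInd R Γ N))).restrictScalars
      R).comap (ι R Γ N G) := by
    rw [← hs, Submodule.span_le]
    intro x hx
    exact Submodule.subset_span (by simpa using ⟨x, hx, rfl⟩)
  exact hle (x := n) Submodule.mem_top

theorem map_surjective (G : Type*) [Group G] [Fintype G] [MulSemiringAction G R] [SkewExt R Γ G]
    (p : X →ₗ[R] Y) (hp : Function.Surjective p) :
    Function.Surjective (map (Γ := Γ) p) := by
  intro F
  choose x hx using fun g : G => hp (F (uu R Γ g))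
  refine ⟨∑ g : G, uu R Γ g⁻¹ • ι R Γ X G (x g), ext fun y => ?_⟩
  rw [map_apply, sum_apply, map_sum, apply_eq_sum (G := G) F]
  refine Finset.sum_congr rfl fun g _ => ?_
  rw [smul_apply, ι_apply, map_smul, hx]

end CoInd

variable [Module Γ X] [IsScalarTower R Γ X] [Module Γ Y] [IsScalarTower R Γ Y]

/-- The sum of the conjugates of a map under the group. -/
def avg (G : Type*) [Group G] [Fintype G] [MulSemiringAction G R] [SkewExt R Γ G]
    (φ : M →ₗ[R] X) : M →ₗ[Γ] X :=
  linearOfStable (G := G) (R := R)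
    { toFun := fun m => ∑ g : G, uu R Γ g • φ (uu R Γ g⁻¹ • m)
      map_add' := fun a b => by
        rw [← Finset.sum_add_distrib]
        refine Finset.sum_congr rfl fun g _ => ?_
        rw [smul_add, map_add φ, smul_add]
      map_smul' := fun r m => by
        change _ = r • ∑ g : G, uu R Γ g • φ (uu R Γ g⁻¹ • m)
        rw [Finset.smul_sum]
        refine Finset.sum_congr rfl fun g _ => ?_
        rw [uu_smul_smul g⁻¹ r m, LinearMap.map_smul φ, uu_smul_smul g, smul_inv_smul] }
    (fun h m => by
      change ∑ g : G, uu R Γ g • φ (uu R Γ g⁻¹ • uu R Γ h • m) =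
        uu R Γ h • ∑ g : G, uu R Γ g • φ (uu R Γ g⁻¹ • m)
      rw [Finset.smul_sum]
      refine (Fintype.sum_equiv (Equiv.mulLeft h) _ _ fun g => ?_).symm
      rw [Equiv.coe_mulLeft, mul_inv_rev, map_mul, map_mul, mul_smul, mul_smul (uu R Γ g⁻¹),
        uu_inv_smul_uu (R := R) h m])

theorem avg_apply (φ : M →ₗ[R] X) (m : M) :
    avg (Γ := Γ) G φ m = ∑ g : G, uu R Γ g • φ (uu R Γ g⁻¹ • m) := rfl

theorem avg_restrictScalars (φ : M →ₗ[Γ] X) (m : M) :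
    avg (Γ := Γ) G (φ.restrictScalars R) m = (Fintype.card G : ℕ) • φ m := by
  rw [avg_apply, Finset.sum_congr rfl (g := fun _ => φ m) fun g _ => by
    rw [LinearMap.restrictScalars_apply, map_smul, uu_smul_uu_inv], Finset.sum_const,
    Finset.card_univ]

theorem comp_avg (p : X →ₗ[Γ] Y) (φ : M →ₗ[R] X) (m : M) :
    p (avg (Γ := Γ) G φ m) = avg (Γ := Γ) G (p.restrictScalars R ∘ₗ φ) m := by
  rw [avg_apply, avg_apply, map_sum]
  exact Finset.sum_congr rfl fun g _ => by rw [map_smul]; rfl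

theorem avg_comp (f : X →ₗ[Γ] M) (φ : M →ₗ[R] Y) (x : X) :
    avg (Γ := Γ) G φ (f x) = avg (Γ := Γ) G (φ ∘ₗ f.restrictScalars R) x := by
  rw [avg_apply, avg_apply]
  exact Finset.sum_congr rfl fun g _ => by
    rw [LinearMap.comp_apply, LinearMap.restrictScalars_apply, map_smul f]

/-- The extension of a map to the coinduced module, which is also induced. -/
def ind (G : Type*) [Group G] [Fintype G] [MulSemiringAction G R] [SkewExt R Γ G]
    (φ : N →ₗ[R] X) : CoInd R Γ N →ₗ[Γ] X := avg G (φ ∘ₗ CoInd.ev R Γ N)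

theorem ind_ι (φ : N →ₗ[R] X) (n : N) : ind (Γ := Γ) G φ (CoInd.ι R Γ N G n) = φ n := by
  classical
  rw [ind, avg_apply, Finset.sum_eq_single 1]
  · rw [inv_one, map_one, one_smul, one_smul, LinearMap.comp_apply, CoInd.ev_ι]
  · intro g _ hg
    rw [LinearMap.comp_apply, CoInd.ev_smul, CoInd.ι_apply, cc_uu, if_neg (by simpa using hg),
      zero_smul, map_zero, smul_zero]
  · simp

/-- The copy of `N` generates the coinduced module, so no nonzero map vanishes on it. -/
theorem hom_coind_ne_zero (f : CoInd R Γ N →ₗ[Γ] X) (hf : f ≠ 0) :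
    f.restrictScalars R ∘ₗ CoInd.ι R Γ N G ≠ 0 := by
  intro h0
  refine hf (LinearMap.ker_eq_top.mp (eq_top_iff.mpr ?_))
  rw [← CoInd.span_ι (R := R) (Γ := Γ) (N := N) (G := G), Submodule.span_le]
  rintro _ ⟨n, rfl⟩
  exact LinearMap.congr_fun h0 n

variable (G) in
theorem ind_surjective (U : Submodule R X) (h : Submodule.span Γ (U : Set X) = ⊤) :
    Function.Surjective (ind (Γ := Γ) G U.subtype) := by
  rw [← LinearMap.range_eq_top, eq_top_iff, ← h, Submodule.span_le]
  intro x hx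
  exact ⟨CoInd.ι R Γ U G ⟨x, hx⟩, ind_ι _ _⟩

end CoInduction

/-! ### Maschke's theorem and the comparison of radicals. -/

section Maschke

set_option linter.unusedSectionVars false

variable {k : Type*} [Field k] {R Γ G : Type*} [Ring R] [Ring Γ] [Algebra k Γ] [Module R Γ]
  [IsScalarTower R Γ Γ] [Group G] [Fintype G] [MulSemiringAction G R] [SkewExt R Γ G]
  {M X Y : Type*} [AddCommGroup M] [Module R M] [Module Γ M] [IsScalarTower R Γ M]
  [AddCommGroup X] [Module R X] [Module Γ X] [IsScalarTower R Γ X]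
  [AddCommGroup Y] [Module R Y] [Module Γ Y] [IsScalarTower R Γ Y]

/-- Multiplication by a scalar as a linear map. -/
def scalarMul (Γ : Type*) [Ring Γ] [Algebra k Γ] (M : Type*) [AddCommGroup M] [Module Γ M]
    (z : k) : M →ₗ[Γ] M where
  toFun m := algebraMap k Γ z • m
  map_add' := smul_add _
  map_smul' x m := by rw [RingHom.id_apply, smul_smul, smul_smul, Algebra.commutes]

theorem scalarMul_card (hG : (Fintype.card G : k) ≠ 0) (m : M) :
    scalarMul Γ M ((Fintype.card G : k)⁻¹) ((Fintype.card G : ℕ) • m) = m := by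
  change algebraMap k Γ ((Fintype.card G : k)⁻¹) • (Fintype.card G : ℕ) • m = m
  rw [← Nat.cast_smul_eq_nsmul Γ, smul_smul, ← map_natCast (algebraMap k Γ), ← map_mul,
    inv_mul_cancel₀ hG, map_one, one_smul]

/-- An `R`-linear lift becomes `Γ`-linear after averaging over `G` and dividing by `|G|`. -/
theorem exists_lift_of_restrict (hG : (Fintype.card G : k) ≠ 0) (p : X →ₗ[Γ] Y) (f : M →ₗ[Γ] Y)
    (h : M →ₗ[R] X) (hh : ∀ m, p (h m) = f m) : ∃ h' : M →ₗ[Γ] X, p ∘ₗ h' = f := by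
  refine ⟨scalarMul Γ X ((Fintype.card G : k)⁻¹) ∘ₗ avg G h, LinearMap.ext fun m => ?_⟩
  have : p.restrictScalars R ∘ₗ h = f.restrictScalars R := LinearMap.ext hh
  rw [LinearMap.comp_apply, LinearMap.comp_apply]
  change p (algebraMap k Γ _ • _) = _
  rw [map_smul, comp_avg, this, avg_restrictScalars]
  exact scalarMul_card hG (f m)

theorem isSemisimple_of_restrict (k : Type*) [Field k] (R : Type*) {Γ : Type*} (G : Type*)
    [Ring R] [Ring Γ] [Algebra k Γ] [Module R Γ]
    [IsScalarTower R Γ Γ] [Group G] [Fintype G] [MulSemiringAction G R] [SkewExt R Γ G]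
    {M : Type*} [AddCommGroup M] [Module R M] [Module Γ M] [IsScalarTower R Γ M]
    (hG : (Fintype.card G : k) ≠ 0) [IsSemisimpleModule R M] :
    IsSemisimpleModule Γ M := by
  refine { exists_isCompl := fun N => ?_ }
  obtain ⟨π, hπ⟩ := IsSemisimpleModule.extension_property (N.subtype.restrictScalars R)
    N.injective_subtype LinearMap.id
  let π' : M →ₗ[Γ] N := scalarMul Γ N ((Fintype.card G : k)⁻¹) ∘ₗ avg G π
  refine ⟨LinearMap.ker π', LinearMap.isCompl_of_proj (f := π') fun x => ?_⟩
  change scalarMul Γ N _ (avg G π (N.subtype x)) = x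
  rw [avg_comp, hπ]
  have := avg_restrictScalars (R := R) (G := G) (LinearMap.id : N →ₗ[Γ] N) x
  rw [show (LinearMap.id : N →ₗ[R] N) = (LinearMap.id : N →ₗ[Γ] N).restrictScalars R from rfl, this]
  exact scalarMul_card hG x

/-- The `R`-radical is `G`-stable and its quotient is semisimple over `R`, hence over `Γ` by
Maschke. In the other direction the quotient by the `Γ`-radical is semisimple over `R` by Clifford.
-/
theorem restrictScalars_jacobson (k : Type*) [Field k] (R : Type*) {Γ : Type*} (G : Type*)
    [Ring R] [IsArtinianRing R] [Ring Γ] [Algebra k Γ] [Module R Γ]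
    [IsScalarTower R Γ Γ] [Group G] [Fintype G] [MulSemiringAction G R] [SkewExt R Γ G]
    (M : Type*) [AddCommGroup M] [Module R M] [Module Γ M] [IsScalarTower R Γ M]
    (hG : (Fintype.card G : k) ≠ 0) [Module.Finite Γ M] :
    (Module.jacobson Γ M).restrictScalars R = Module.jacobson R M := by
  have := finite_restrict Γ G (R := R) M
  have := finite_skew (R := R) (Γ := Γ) G
  have : IsArtinian R M := inferInstance
  refine le_antisymm ?_ ?_
  · let J : Submodule Γ M := submoduleOfStable (Module.jacobson R M)
      (uu_smul_mem_of_translate_eq fun g : G => translate_jacobson Γ g)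
    have h1 : IsSemisimpleModule R (M ⧸ Module.jacobson R M) := by
      rw [IsArtinian.isSemisimpleModule_iff_jacobson]
      exact Module.jacobson_quotient_jacobson R M
    have h2 : IsSemisimpleModule R (M ⧸ J) :=
      IsSemisimpleModule.of_surjective ((Module.jacobson R M).liftQ (J.mkQ.restrictScalars R)
        fun x hx => (Submodule.Quotient.mk_eq_zero J).mpr hx) fun y => by
          obtain ⟨x, rfl⟩ := J.mkQ_surjective y
          exact ⟨Submodule.Quotient.mk x, rfl⟩
    have h3 : IsSemisimpleModule Γ (M ⧸ J) := isSemisimple_of_restrict k R G hG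
    intro x hx
    have : J.mkQ x = 0 := map_jacobson_eq_zero J.mkQ hx
    exact (Submodule.Quotient.mk_eq_zero J).mp this
  · have h0 : IsArtinian Γ M := isArtinian_of_tower R inferInstance
    have h1 : IsSemisimpleModule Γ (M ⧸ Module.jacobson Γ M) := by
      rw [IsArtinian.isSemisimpleModule_iff_jacobson]
      exact Module.jacobson_quotient_jacobson Γ M
    have h2 : IsSemisimpleModule R (M ⧸ Module.jacobson Γ M) := isSemisimple_restrict R Γ G
    intro x hx
    have := map_jacobson_eq_zero ((Module.jacobson Γ M).mkQ.restrictScalars R) hx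
    exact (Submodule.Quotient.mk_eq_zero _).mp this

end Maschke

/-! ### Twisted modules and conjugate simple modules. -/

section Twists

set_option linter.unusedSectionVars false

variable {R G : Type*} [Ring R] [Group G] [MulSemiringAction G R] {M N : Type*} [AddCommGroup M]
  [Module R M] [AddCommGroup N] [Module R N]

/-- A semilinear map as a linear map on the twisted module. -/
def twistLift (g : G) (φ : M →+ N) (h : ∀ (r : R) m, φ (r • m) = (g • r) • φ m) :
    Twist (A := R) g M →ₗ[R] N where
  toFun := φ
  map_add' := φ.map_add
  map_smul' r m := by
    change φ ((g⁻¹ • r) • (show M from m)) = r • φ m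
    rw [h, smul_inv_smul]

/-- Twisting is functorial. -/
def twistMap (g : G) (φ : M →ₗ[R] N) : Twist (A := R) g M →ₗ[R] Twist (A := R) g N where
  toFun := φ
  map_add' := φ.map_add
  map_smul' r m := φ.map_smul (g⁻¹ • r) m

/-- The identity map from `M` to its twist. -/
def toTwist (g : G) (m : M) : Twist (A := R) g M := m

/-- The submodule of `M` underlying a submodule of a twist of `M`. -/
def untwist (g : G) (U : Submodule R (Twist (A := R) g M)) : Submodule R M where
  carrier := {m | toTwist g m ∈ U}
  add_mem' ha hb := U.add_mem ha hb
  zero_mem' := U.zero_mem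
  smul_mem' r m hm := by
    have : (g • r) • toTwist (R := R) g m = toTwist g (r • m) := by
      change (g⁻¹ • g • r) • m = r • m
      rw [inv_smul_smul]
    change toTwist g (r • m) ∈ U
    exact this ▸ U.smul_mem (g • r) hm

theorem isTop_twistMap (g : G) {p : M →ₗ[R] N} (hp : IsTop p) : IsTop (twistMap g p) := by
  refine ⟨hp.surjective, fun U hU x hx => ?_⟩
  refine hp.le_ker (untwist g U) (fun he => hU ?_) (show toTwist g x ∈ U from hx)
  rw [eq_top_iff]
  rintro y -
  have : ∀ m : M, m ∈ untwist g U := fun m => he ▸ Submodule.mem_top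
  exact this y

theorem isSimpleModule_twist (g : G) [IsSimpleModule R M] :
    IsSimpleModule R (Twist (A := R) g M) := by
  obtain ⟨h1, h2⟩ := isSimpleModule_iff_toSpanSingleton_surjective.mp ‹IsSimpleModule R M›
  refine isSimpleModule_iff_toSpanSingleton_surjective.mpr ⟨h1, fun x hx y => ?_⟩
  obtain ⟨r, hr⟩ := h2 x hx y
  refine ⟨g • r, ?_⟩
  change (g⁻¹ • g • r) • (show M from x) = y
  rw [inv_smul_smul]
  exact hr

variable (G) in
/-- Two simple modules are conjugate if one is isomorphic to a twist of the other. -/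
def Conj (T T' : Sim R) : Prop := ∃ g : G, Nonempty (Twist (A := R) g T.Mod ≃ₗ[R] T'.Mod)

end Twists

/-! ### Clifford theory: constituents of restricted simple modules. -/

section Over

set_option linter.unusedSectionVars false

variable {k : Type w} [Field k] {R : Type u} [Ring R] [Algebra k R] [Module.Finite k R]
  {Γ : Type v} [Ring Γ] [Algebra k Γ] [Module.Finite k Γ] [Module R Γ] [IsScalarTower R Γ Γ]
  {M N : Type*} [AddCommGroup M] [Module R M] [Module Γ M] [IsScalarTower R Γ M]
  [AddCommGroup N] [Module R N]

theorem fac_of_isTop {P : Type*} [AddCommGroup P] [Module R P] {T : Sim R} {p : P →ₗ[R] T.Mod}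
    (hp : IsTop p) (f : P →ₗ[R] N) (hf : f ≠ 0) : Fac k T N := by
  have : Nontrivial (LinearMap.range f) := by
    rw [Submodule.nontrivial_iff_ne_bot]
    exact fun h => hf (LinearMap.range_eq_bot.mp h)
  obtain ⟨q, -, hq⟩ := hp.exists_of_surjective f.rangeRestrict f.surjective_rangeRestrict
  exact (fac_of_surjective_simple q hq.ne_zero).of_submodule

variable (k) in
/-- `T` is a constituent of the restriction of the simple module `S`. -/
def Over (S : Sim Γ) (T : Sim R) : Prop := Fac k T S.Mod

theorem Fac.restrict {S : Sim Γ} {T : Sim R} (h : Fac k S M) (hST : Over k S T) : Fac k T M := by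
  obtain ⟨f, hf⟩ := h
  have : Nontrivial (LinearMap.range f) := by
    rw [Submodule.nontrivial_iff_ne_bot]
    exact fun h => hf (LinearMap.range_eq_bot.mp h)
  obtain ⟨q, -, hq⟩ := (coverMap_isTop k S).exists_of_surjective f.rangeRestrict
    f.surjective_rangeRestrict
  have h1 : Fac k T (LinearMap.range f) :=
    Fac.of_surjective (M := LinearMap.range f) hST (q.restrictScalars R) hq.surjective
  exact h1.of_injective ((LinearMap.range f).subtype.restrictScalars R) (Submodule.injective_subtype _)

variable {G : Type*} [Group G] [Fintype G] [MulSemiringAction G R] [SkewExt R Γ G]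

theorem over_of_ne_zero {S : Sim Γ} {T : Sim R} (f : T.Mod →ₗ[R] S.Mod) (hf : f ≠ 0) :
    Over k S T := fac_of_injective_simple f hf

theorem isSemisimple_sim (k : Type w) [Field k] (R : Type u) [Ring R] [Algebra k R]
    [Module.Finite k R] {Γ : Type v} [Ring Γ] [Module R Γ] [IsScalarTower R Γ Γ]
    (G : Type*) [Group G] [Fintype G] [MulSemiringAction G R] [SkewExt R Γ G] (S : Sim Γ) :
    IsSemisimpleModule R S.Mod := by
  have := IsArtinianRing.of_finite k R
  exact isSemisimple_of_isSimple R G (Γ := Γ)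

theorem Over.exists_hom (G : Type*) [Group G] [Fintype G] [MulSemiringAction G R] [SkewExt R Γ G]
    {S : Sim Γ} {T : Sim R} (h : Over k S T) : ∃ f : T.Mod →ₗ[R] S.Mod, f ≠ 0 :=
  have := isSemisimple_sim k R G S
  Fac.exists_hom h

theorem Over.exists_hom_to (G : Type*) [Group G] [Fintype G] [MulSemiringAction G R]
    [SkewExt R Γ G] {S : Sim Γ} {T : Sim R} (h : Over k S T) : ∃ f : S.Mod →ₗ[R] T.Mod, f ≠ 0 :=
  have := isSemisimple_sim k R G S
  Fac.exists_hom_to h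

/-- The unit `u_g` carries a copy of `T` in `S` to a copy of `gT`. -/
theorem Over.conj {S : Sim Γ} {T T' : Sim R} (h : Over k S T) (hT : Conj G T T') :
    Over k S T' := by
  obtain ⟨f, hf⟩ := h.exists_hom G
  obtain ⟨g, ⟨e⟩⟩ := hT
  let F : Twist (A := R) g T.Mod →ₗ[R] S.Mod :=
    twistLift g ((DistribSMul.toAddMonoidHom S.Mod (uu R Γ g)).comp f.toAddMonoidHom) fun r m => by
      change uu R Γ g • f (r • m) = (g • r) • uu R Γ g • f m
      rw [map_smul, uu_smul_smul]
  refine over_of_ne_zero (F ∘ₗ e.symm.toLinearMap) fun h0 => hf (LinearMap.ext fun x => ?_)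
  have h1 : uu R Γ g • f x = 0 := by
    have h2 := LinearMap.congr_fun h0 (e (toTwist g x))
    rw [LinearMap.comp_apply, LinearEquiv.coe_coe, e.symm_apply_apply] at h2
    exact h2
  have h3 := uu_inv_smul_uu (R := R) (Γ := Γ) g (f x)
  rw [h1, smul_zero] at h3
  exact h3.symm

/-- A nonzero map from `P_T` to the coinduced module is nonzero at some `u_g`; evaluation there is
linear on the twist of `P_T` by `g`, whose top is `gT`. -/
theorem Fac.coind {T : Sim R} (h : Fac k T (CoInd R Γ N)) :
    ∃ T0, Conj G T T0 ∧ Fac k T0 N := by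
  obtain ⟨f, hf⟩ := h
  obtain ⟨g, p, hgp⟩ : ∃ (g : G) (p : cover k T), f p (uu R Γ g) ≠ 0 := by
    by_contra! hc
    refine hf (LinearMap.ext fun p => CoInd.ext fun y => ?_)
    rw [CoInd.apply_eq_sum (G := G)]
    exact Finset.sum_eq_zero fun g _ => by rw [hc, smul_zero]
  let ψ : Twist (A := R) g (cover k T) →ₗ[R] N :=
    twistLift g ⟨⟨fun p => f p (uu R Γ g), by rw [map_zero]; rfl⟩, fun a b => by
      change f (a + b) _ = _; rw [map_add]; rfl⟩ fun r m => by
      change f (r • m) (uu R Γ g) = (g • r) • f m (uu R Γ g)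
      rw [map_smul, CoInd.restrict_smul, CoInd.smul_apply, SkewExt.u_mul_smul_one,
        CoInd.map_smul_apply]
  have := isSimpleModule_twist (R := R) (M := T.Mod) g
  obtain ⟨T0, ⟨e⟩⟩ := Sim.exists_equiv (A := R) (Twist (A := R) g T.Mod)
  exact ⟨T0, ⟨g, ⟨e⟩⟩, fac_of_isTop ((isTop_twistMap g (coverMap_isTop k T)).comp_equiv e) ψ
    fun h0 => hgp (LinearMap.congr_fun h0 p)⟩

/-- The composition factors of a module are conjugate to those of any submodule generating it over
the skew group ring. -/
theorem Fac.of_span_eq_top {T : Sim R} (h : Fac k T M) (U : Submodule R M)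
    (hU : Submodule.span Γ (U : Set M) = ⊤) : ∃ T0, Conj G T T0 ∧ Fac k T0 U :=
  Fac.coind (Γ := Γ) (h.of_surjective ((ind (Γ := Γ) G U.subtype).restrictScalars R)
    (ind_surjective G U hU))

/-- A copy of `T'` in the simple module `S` generates it over `Γ`, so every constituent is conjugate
to `T'`. -/
theorem Over.conj_of_over {S : Sim Γ} {T T' : Sim R} (h : Over k S T) (h' : Over k S T') :
    Conj G T T' := by
  obtain ⟨f, hf⟩ := h'.exists_hom G
  have hU : Submodule.span Γ (LinearMap.range f : Set S.Mod) = ⊤ := by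
    refine (eq_bot_or_eq_top _).resolve_left fun hb => hf (LinearMap.ext fun x => ?_)
    have : f x ∈ Submodule.span Γ (LinearMap.range f : Set S.Mod) :=
      Submodule.subset_span (LinearMap.mem_range_self f x)
    rw [hb] at this
    exact this
  obtain ⟨T0, h1, h2⟩ := Fac.of_span_eq_top (G := G) (k := k) h _ hU
  rwa [h2.of_range.eq_of_simple] at h1

variable (k Γ) in
theorem exists_over (G : Type*) [Group G] [Fintype G] [MulSemiringAction G R] [SkewExt R Γ G]
    (T : Sim R) : ∃ S : Sim Γ, Over k S T := by
  have := CoInd.finite (R := R) (Γ := Γ) (N := T.Mod) G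
  have := IsSimpleModule.nontrivial R T.Mod
  have : Nontrivial (CoInd R Γ T.Mod) := (CoInd.ι_injective (G := G)).nontrivial
  obtain ⟨S, q, hq⟩ := exists_ne_zero_simple_quotient (R := Γ) (M := CoInd R Γ T.Mod)
  refine ⟨S, over_of_ne_zero _ (hom_coind_ne_zero (G := G) q ?_)⟩
  rintro rfl
  have := IsSimpleModule.nontrivial Γ S.Mod
  obtain ⟨y, hy⟩ := exists_ne (0 : S.Mod)
  obtain ⟨x, rfl⟩ := hq y
  exact hy rfl

variable (k R) in
theorem exists_under (S : Sim Γ) : ∃ T : Sim R, Over k S T :=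
  have := IsSimpleModule.nontrivial Γ S.Mod
  exists_fac k S.Mod

/-- A map from `P_T` to `M` extends to the coinduced module. A simple quotient `S` of the image is a
factor of `M`, and the composite from `P_T` to `S` is nonzero. -/
theorem Fac.exists_over (G : Type*) [Group G] [Fintype G] [MulSemiringAction G R] [SkewExt R Γ G]
    {T : Sim R} (h : Fac k T M) : ∃ S : Sim Γ, Fac k S M ∧ Over k S T := by
  obtain ⟨f, hf⟩ := h
  let F := ind (Γ := Γ) G f
  have hF : F ≠ 0 := fun h0 => hf (LinearMap.ext fun x => by
    rw [← ind_ι (Γ := Γ) (G := G) f x]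
    exact LinearMap.congr_fun h0 _)
  have : Nontrivial (LinearMap.range F) := by
    rw [Submodule.nontrivial_iff_ne_bot]
    exact fun h => hF (LinearMap.range_eq_bot.mp h)
  have := CoInd.finite (R := R) (Γ := Γ) (N := cover k T) G
  obtain ⟨S, q, hq⟩ := exists_ne_zero_simple_quotient (R := Γ) (M := LinearMap.range F)
  have hq0 : q ∘ₗ F.rangeRestrict ≠ 0 := by
    intro h0
    have := IsSimpleModule.nontrivial Γ S.Mod
    obtain ⟨y, hy⟩ := exists_ne (0 : S.Mod)
    obtain ⟨x, rfl⟩ := (hq.comp F.surjective_rangeRestrict) y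
    exact hy (LinearMap.congr_fun h0 x)
  refine ⟨S, (fac_of_surjective_simple q ?_).of_submodule, _, hom_coind_ne_zero (G := G) _ hq0⟩
  rintro rfl
  exact hq0 (LinearMap.zero_comp _)

/-- Symmetry, transitivity and reflexivity of conjugation are read off from a simple `Γ`-module
lying over `T`, whose constituents form an orbit; no twists have to be composed. -/
theorem Conj.symm (k : Type w) [Field k] {R : Type u} [Ring R] [Algebra k R]
    [Module.Finite k R] (Γ : Type v) [Ring Γ] [Algebra k Γ] [Module.Finite k Γ] [Module R Γ]
    [IsScalarTower R Γ Γ] {G : Type*} [Group G] [Fintype G] [MulSemiringAction G R]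
    [SkewExt R Γ G] {T T' : Sim R} (h : Conj G T T') : Conj G T' T := by
  obtain ⟨S, hS⟩ := exists_over k Γ G T
  exact (hS.conj h).conj_of_over hS

theorem Conj.trans (k : Type w) [Field k] {R : Type u} [Ring R] [Algebra k R]
    [Module.Finite k R] (Γ : Type v) [Ring Γ] [Algebra k Γ] [Module.Finite k Γ] [Module R Γ]
    [IsScalarTower R Γ Γ] {G : Type*} [Group G] [Fintype G] [MulSemiringAction G R]
    [SkewExt R Γ G] {T T' T'' : Sim R} (h : Conj G T T') (h' : Conj G T' T'') : Conj G T T'' := by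
  obtain ⟨S, hS⟩ := exists_over k Γ G T
  exact hS.conj_of_over ((hS.conj h).conj h')

theorem Conj.refl (k : Type w) [Field k] {R : Type u} [Ring R] [Algebra k R]
    [Module.Finite k R] (Γ : Type v) [Ring Γ] [Algebra k Γ] [Module.Finite k Γ] [Module R Γ]
    [IsScalarTower R Γ Γ] (G : Type*) [Group G] [Fintype G] [MulSemiringAction G R]
    [SkewExt R Γ G] (T : Sim R) : Conj G T T := by
  obtain ⟨S, hS⟩ := exists_over k Γ G T
  exact hS.conj_of_over hS

end Over

/-! ### Relatively projective modules and their decomposition. -/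

section RelStd

variable {k : Type w} [Field k] {R : Type u} [Ring R] [Algebra k R] [Module.Finite k R]

/-- `M` is projective relative to the modules with composition factors in `C`, to which it belongs,
and its simple quotients lie in `O`. -/
structure RelStd.{ω', w', u', m'} (k : Type w') [Field k] {R : Type u'} [Ring R] [Algebra k R]
    [Module.Finite k R] (O C : Set (Sim R)) (M : Type m') [AddCommGroup M] [Module R M] :
    Prop where
  fac : ∀ T, Fac k T M → T ∈ C
  top : ∀ (T : Sim R) (f : M →ₗ[R] T.Mod), f ≠ 0 → T ∈ O
  lift_mkQ : ∀ (X : Type ω') [AddCommGroup X] [Module R X] (K : Submodule R X),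
    (∀ T, Fac k T X → T ∈ C) → ∀ f : M →ₗ[R] X ⧸ K, ∃ h : M →ₗ[R] X, K.mkQ ∘ₗ h = f

universe ω m

variable {O C : Set (Sim R)} {M : Type m} [AddCommGroup M] [Module R M]

/-- The definition tests only quotients `X ⧸ K`; here the target may be any epimorphic image of `X`,
in any universe. -/
theorem RelStd.lift (hM : RelStd.{ω} k O C M) {X : Type ω} [AddCommGroup X] [Module R X]
    (hX : ∀ T, Fac k T X → T ∈ C) {Y : Type*} [AddCommGroup Y] [Module R Y] (p : X →ₗ[R] Y)
    (hp : Function.Surjective p) (f : M →ₗ[R] Y) : ∃ h : M →ₗ[R] X, p ∘ₗ h = f := by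
  let e := p.quotKerEquivOfSurjective hp
  obtain ⟨h, hh⟩ := hM.lift_mkQ X (LinearMap.ker p) hX (e.symm.toLinearMap ∘ₗ f)
  refine ⟨h, LinearMap.ext fun x => ?_⟩
  have h1 := LinearMap.congr_fun hh x
  have h2 : e (Submodule.Quotient.mk (h x)) = f x := by
    rw [← e.apply_symm_apply (f x)]
    exact congrArg e h1
  rw [← h2]; rfl

theorem RelStd.retract (hM : RelStd.{ω} k O C M) {N : Type*} [AddCommGroup N] [Module R N]
    (i : N →ₗ[R] M) (r : M →ₗ[R] N) (h : r ∘ₗ i = LinearMap.id) : RelStd.{ω} k O C N := by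
  have hx : ∀ x, r (i x) = x := LinearMap.congr_fun h
  refine ⟨fun T hT => hM.fac T (hT.of_injective i (Function.LeftInverse.injective hx)),
    fun T f hf => hM.top T (f ∘ₗ r) fun h0 => hf ?_, fun X _ _ K hX f => ?_⟩
  · ext x
    rw [← hx x]; exact LinearMap.congr_fun h0 (i x)
  · obtain ⟨g, hg⟩ := hM.lift_mkQ X K hX (f ∘ₗ r)
    exact ⟨g ∘ₗ i, by rw [← LinearMap.comp_assoc, hg, LinearMap.comp_assoc, h, LinearMap.comp_id]⟩

theorem IsTop.ker_le_ker {N L : Type*} [AddCommGroup N] [Module R N] [AddCommGroup L] [Module R L]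
    [IsSimpleModule R L] {p : N →ₗ[R] L} (hp : IsTop p) {T : Type*} [AddCommGroup T] [Module R T]
    [IsSimpleModule R T] (f : N →ₗ[R] T) : LinearMap.ker p ≤ LinearMap.ker f := by
  by_cases hf : f = 0
  · rw [hf, LinearMap.ker_zero]; exact le_top
  · obtain ⟨e, rfl⟩ := hp.exists_equiv_of_ne_zero f hf
    intro x hx
    rw [LinearMap.mem_ker, LinearMap.comp_apply, LinearMap.mem_ker.mp hx, map_zero]

theorem exists_pi_top (k : Type w) [Field k] {R : Type u} [Ring R] [Algebra k R] [Module.Finite k R]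
    (M : Type*) [AddCommGroup M] [Module R M] [Module.Finite R M] :
    ∃ (n : ℕ) (T : Fin n → Sim R) (a : M →ₗ[R] ∀ i, (T i).Mod),
      Function.Surjective a ∧ LinearMap.ker a = Module.jacobson R M := by
  have := isArtinian_of_field k (R := R) M
  have : IsSemisimpleModule R (M ⧸ Module.jacobson R M) := by
    rw [IsArtinian.isSemisimpleModule_iff_jacobson]
    exact Module.jacobson_quotient_jacobson R M
  obtain ⟨n, S, e, hS⟩ := IsSemisimpleModule.exists_linearEquiv_fin_dfinsupp R
    (M ⧸ Module.jacobson R M)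
  choose T hT using fun i => Sim.exists_equiv (A := R) (S i)
  let E : (M ⧸ Module.jacobson R M) ≃ₗ[R] ∀ i, (T i).Mod :=
    e.trans ((DFinsupp.linearEquivFunOnFintype (R := R)).trans
      (LinearEquiv.piCongrRight fun i => (hT i).some))
  refine ⟨n, T, E.toLinearMap ∘ₗ Submodule.mkQ _, E.surjective.comp (Submodule.mkQ_surjective _), ?_⟩
  rw [LinearEquiv.ker_comp, Submodule.ker_mkQ]

/-- A relatively projective module is a direct sum of relatively projective modules with simple
top. -/
theorem RelStd.exists_equiv_pi {Δ : Sim R → Type u} [∀ T, AddCommGroup (Δ T)]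
    [∀ T, Module R (Δ T)] [∀ T, Module.Finite R (Δ T)] {q : ∀ T, Δ T →ₗ[R] T.Mod}
    (hq : ∀ T, IsTop (q T)) (hΔ : ∀ T ∈ O, RelStd.{m} k O C (Δ T))
    (hM : RelStd.{u} k O C M) [Module.Finite R M] :
    ∃ (n : ℕ) (T : Fin n → Sim R), (∀ i, T i ∈ O) ∧ Nonempty (M ≃ₗ[R] ∀ i, Δ (T i)) := by
  classical
  obtain ⟨n, T, a, ha, hker⟩ := exists_pi_top k (R := R) M
  have hTO : ∀ i, T i ∈ O := fun i => hM.top (T i) (LinearMap.proj i ∘ₗ a) fun h0 => by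
    have := IsSimpleModule.nontrivial R (T i).Mod
    obtain ⟨y, hy⟩ := exists_ne (0 : (T i).Mod)
    obtain ⟨x, hx⟩ := ha (Pi.single i y)
    apply hy
    have := LinearMap.congr_fun h0 x
    rw [LinearMap.comp_apply, hx, LinearMap.proj_apply, Pi.single_eq_same] at this
    exact this
  refine ⟨n, T, hTO, ?_⟩
  -- Each map from a `Δ (T i)` onto its summand of the top of `M` lifts to `M`. Together the lifts
  -- cover the top, hence all of `M`.
  choose f hf using fun i => (hΔ (T i) (hTO i)).lift hM.fac a ha
    (LinearMap.single R (fun i => (T i).Mod) i ∘ₗ q (T i))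
  let F : (∀ i, Δ (T i)) →ₗ[R] M := ∑ i, f i ∘ₗ LinearMap.proj i
  have hF : ∀ x, a (F x) = fun i => q (T i) (x i) := by
    intro x
    simp only [F, LinearMap.sum_apply, LinearMap.comp_apply, LinearMap.proj_apply, map_sum]
    have : ∀ i, a (f i (x i)) = Pi.single i (q (T i) (x i)) := fun i =>
      LinearMap.congr_fun (hf i) (x i)
    simp_rw [this]
    exact Finset.univ_sum_single (fun i => q (T i) (x i))
  have hFs : Function.Surjective F := by
    rw [← LinearMap.range_eq_top]
    refine eq_top_of_sup_jacobson _ ?_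
    rw [eq_top_iff]
    rintro m -
    choose x hx using fun i => (hq (T i)).surjective (a m i)
    have : m - F x ∈ Module.jacobson R M := by
      rw [← hker, LinearMap.mem_ker, map_sub, hF, sub_eq_zero]
      exact (funext hx).symm
    rw [← sub_add_cancel m (F x)]
    exact Submodule.add_mem _ (Submodule.mem_sup_right this)
      (Submodule.mem_sup_left (LinearMap.mem_range_self F x))
  -- Relative projectivity of `M` splits `F`, so a simple quotient of its kernel would extend to the
  -- whole direct sum along the projection `e` below.
  obtain ⟨s, hs⟩ := hM.lift (X := ∀ i, Δ (T i)) (fun T' hT' => by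
    obtain ⟨i, hi⟩ := hT'.pi
    exact (hΔ (T i) (hTO i)).fac _ hi) F hFs LinearMap.id
  have hs' : ∀ m, F (s m) = m := LinearMap.congr_fun hs
  refine ⟨(LinearEquiv.ofBijective F ⟨?_, hFs⟩).symm⟩
  rw [← LinearMap.ker_eq_bot]
  by_contra hne
  have : Nontrivial (LinearMap.ker F) := Submodule.nontrivial_iff_ne_bot.mpr hne
  have := finite_submodule_of_field k (LinearMap.ker F)
  obtain ⟨T', r, hr⟩ := exists_ne_zero_simple_quotient (R := R) (M := LinearMap.ker F)
  let e : (∀ i, Δ (T i)) →ₗ[R] LinearMap.ker F :=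
    (LinearMap.id - s ∘ₗ F).codRestrict _ fun x => by
      rw [LinearMap.mem_ker, LinearMap.sub_apply, map_sub, LinearMap.comp_apply, hs',
        LinearMap.id_apply, sub_self]
  -- A map from the direct sum to a simple module kills the kernels of all the `q (T i)`, and `ker
  -- F` lies in their product because `a ∘ F` is given by the `q (T i)`.
  have key : ∀ x ∈ LinearMap.ker F, r (e x) = 0 := by
    intro x hx
    have hx' : ∀ i, q (T i) (x i) = 0 := fun i => by
      have := hF x
      rw [LinearMap.mem_ker.mp hx, map_zero] at this
      exact (congrFun this i).symm
    rw [← Finset.univ_sum_single x, map_sum, map_sum]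
    exact Finset.sum_eq_zero fun i _ =>
      (hq (T i)).ker_le_ker (r ∘ₗ e ∘ₗ LinearMap.single R (fun i => Δ (T i)) i) (hx' i)
  have := IsSimpleModule.nontrivial R T'.Mod
  obtain ⟨y, hy⟩ := exists_ne (0 : T'.Mod)
  obtain ⟨x, rfl⟩ := hr y
  apply hy
  rw [← key x x.2]
  congr 1
  apply Subtype.ext
  change (x : ∀ i, Δ (T i)) = x - s (F x)
  rw [LinearMap.mem_ker.mp x.2, map_zero, sub_zero]

/-- The decomposition embeds `rad M` into the product of the radicals of the summands. -/
theorem RelStd.not_fac_jacobson {Δ : Sim R → Type u} [∀ T, AddCommGroup (Δ T)]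
    [∀ T, Module R (Δ T)] [∀ T, Module.Finite R (Δ T)] {q : ∀ T, Δ T →ₗ[R] T.Mod}
    (hq : ∀ T, IsTop (q T)) (hΔ : ∀ T ∈ O, RelStd.{m} k O C (Δ T))
    (hr : ∀ T ∈ O, ∀ T' ∈ O, ¬ Fac k T' (Module.jacobson R (Δ T)))
    (hM : RelStd.{u} k O C M) [Module.Finite R M] {T : Sim R} (hT : T ∈ O) :
    ¬ Fac k T (Module.jacobson R M) := by
  intro hf
  obtain ⟨n, T', hT', ⟨e⟩⟩ := hM.exists_equiv_pi hq hΔ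
  let E : Module.jacobson R M →ₗ[R] ∀ i, Module.jacobson R (Δ (T' i)) :=
    LinearMap.pi fun i => ((LinearMap.proj i ∘ₗ e.toLinearMap).restrict (p := Module.jacobson R M)
      fun x hx => Module.map_jacobson_le _ (Submodule.mem_map_of_mem hx))
  have hE : Function.Injective E := fun x y hxy => Subtype.ext (e.injective (funext fun i =>
    congrArg Subtype.val (congrFun hxy i)))
  obtain ⟨i, hi⟩ := (hf.of_injective E hE).pi
  exact hr _ (hT' i) _ hT hi

/-- Relatively projective modules are determined by their tops if these are simple. -/
theorem RelStd.equiv_of_isTop {L : Sim R} {D : Type u} [AddCommGroup D] [Module R D]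
    {q : D →ₗ[R] L.Mod} (hq : IsTop q) (hD : RelStd.{m} k O C D) (hM : RelStd.{u} k O C M)
    {p : M →ₗ[R] L.Mod} (hp : IsTop p) : Nonempty (M ≃ₗ[R] D) := by
  obtain ⟨f, hf⟩ := hM.lift hD.fac q hq.surjective p
  have hfs : Function.Surjective f := hq.surjective_of_comp_ne_zero f (hf ▸ hp.ne_zero)
  obtain ⟨s, hs⟩ := hD.lift hM.fac f hfs LinearMap.id
  have hss : Function.Surjective s := by
    refine hp.surjective_of_comp_ne_zero s ?_
    rw [← hf, LinearMap.comp_assoc, hs, LinearMap.comp_id]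
    exact hq.ne_zero
  have hsi : Function.Injective s := Function.LeftInverse.injective (LinearMap.congr_fun hs)
  exact ⟨(LinearEquiv.ofBijective s ⟨hsi, hss⟩).symm⟩

end RelStd

/-! ### Relative projectivity under restriction and coinduction. -/

section Transfer

set_option linter.unusedSectionVars false

variable {k : Type w} [Field k] {R : Type u} [Ring R] [Algebra k R] [Module.Finite k R]
  {Γ : Type v} [Ring Γ] [Algebra k Γ] [Module.Finite k Γ] [Module R Γ] [IsScalarTower R Γ Γ]
  {G : Type*} [Group G] [Fintype G] [MulSemiringAction G R] [SkewExt R Γ G]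

universe ω

variable {M : Type*} [AddCommGroup M] [Module R M] [Module Γ M] [IsScalarTower R Γ M]

variable (G) in
/-- `C` is stable under conjugation. -/
def ConjStable (C : Set (Sim R)) : Prop := ∀ T T', Conj G T T' → T ∈ C → T' ∈ C

variable (k Γ) in
/-- The simple modules over the skew group ring with a constituent in `C`. -/
def up (C : Set (Sim R)) : Set (Sim Γ) := {S | ∃ T ∈ C, Over k S T}

variable {O C : Set (Sim R)}

theorem mem_of_over_of_mem_up (hC : ConjStable G C) {S : Sim Γ} (hS : S ∈ up k Γ C) {T : Sim R}
    (h : Over k S T) : T ∈ C := by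
  obtain ⟨T0, hT0, h0⟩ := hS
  exact hC _ _ (h0.conj_of_over h) hT0

theorem forall_fac_restrict (hC : ConjStable G C) (h : ∀ S : Sim Γ, Fac k S M → S ∈ up k Γ C)
    (T : Sim R) (hT : Fac k T M) : T ∈ C := by
  obtain ⟨S, h1, h2⟩ := Fac.exists_over (Γ := Γ) G hT
  exact mem_of_over_of_mem_up hC (h S h1) h2

theorem forall_fac_of_restrict (h : ∀ T : Sim R, Fac k T M → T ∈ C) (S : Sim Γ)
    (hS : Fac k S M) : S ∈ up k Γ C := by
  obtain ⟨T, hT⟩ := exists_under k R S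
  exact ⟨T, h T (hS.restrict hT), hT⟩

theorem forall_fac_coind (hC : ConjStable G C) {X : Type*} [AddCommGroup X] [Module R X]
    (h : ∀ T : Sim R, Fac k T X → T ∈ C) (S : Sim Γ) (hS : Fac k S (CoInd R Γ X)) :
    S ∈ up k Γ C := by
  obtain ⟨T, hT⟩ := exists_under k R S
  obtain ⟨T0, h1, h2⟩ := Fac.coind (G := G) (hS.restrict hT)
  exact ⟨T, hC _ _ (h1.symm k Γ) (h _ h2), hT⟩

theorem ne_zero_of_surjective {R : Type*} [Ring R] {M : Type*} [AddCommGroup M] [Module R M]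
    {L : Type*} [AddCommGroup L] [Module R L] [IsSimpleModule R L] (f : M →ₗ[R] L)
    (hf : Function.Surjective f) : f ≠ 0 := by
  rintro rfl
  have := IsSimpleModule.nontrivial R L
  obtain ⟨y, hy⟩ := exists_ne (0 : L)
  obtain ⟨x, rfl⟩ := hf y
  exact hy rfl

theorem over_of_hom_coind {S : Sim Γ} {T : Sim R} (f : S.Mod →ₗ[Γ] CoInd R Γ T.Mod) (hf : f ≠ 0) :
    Over k S T := by
  refine fac_of_surjective_simple (CoInd.ev R Γ T.Mod ∘ₗ f.restrictScalars R) fun h0 => hf ?_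
  refine LinearMap.ext fun x => CoInd.ext fun y => ?_
  have := LinearMap.congr_fun h0 (y • x)
  rw [LinearMap.comp_apply, LinearMap.restrictScalars_apply, map_smul, CoInd.ev_smul] at this
  exact this

/-- Lifting follows from the adjunction with coinduction, which preserves epimorphisms. For the
simple quotients, a map `φ` to `T` kills the common radical of `M`, so its adjoint factors through
the `Γ`-top of `M`; a simple quotient of the image embeds in the coinduced module and hence lies
over `T`. -/
theorem RelStd.restrict (hG : (Fintype.card G : k) ≠ 0) (hO : ConjStable G O)
    (hC : ConjStable G C) [Module.Finite Γ M]
    (hM : RelStd.{max v ω} k (up k Γ O) (up k Γ C) M) : RelStd.{ω} k O C M := by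
  have hAR := IsArtinianRing.of_finite k R
  have hAΓ := IsArtinianRing.of_finite k Γ
  refine ⟨forall_fac_restrict hC hM.fac, fun T φ hφ => ?_, fun X _ _ K hX f => ?_⟩
  · set J := Module.jacobson Γ M
    have hJ : ∀ x ∈ J, φ x = 0 := fun x hx => by
      refine map_jacobson_eq_zero φ ?_
      rw [← restrictScalars_jacobson k R G M hG (Γ := Γ)]
      exact hx
    obtain ⟨Q, hQ⟩ := exists_factor J.mkQ J.mkQ_surjective (CoInd.hat (Γ := Γ) φ) fun x hx => by
      rw [Submodule.ker_mkQ] at hx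
      exact CoInd.ext fun y => hJ _ (J.smul_mem y hx)
    have hss : IsSemisimpleModule Γ (M ⧸ J) := by
      have := isArtinian_of_field k (R := Γ) M
      rw [IsArtinian.isSemisimpleModule_iff_jacobson]
      exact Module.jacobson_quotient_jacobson Γ M
    have hQ0 : Q ≠ 0 := by
      rintro rfl
      refine hφ (LinearMap.ext fun x => ?_)
      rw [← CoInd.ev_hat (Γ := Γ) φ x, ← hQ]; rfl
    have : Nontrivial (LinearMap.range Q) := by
      rw [Submodule.nontrivial_iff_ne_bot]
      exact fun h => hQ0 (LinearMap.range_eq_bot.mp h)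
    have hssr : IsSemisimpleModule Γ (LinearMap.range Q) := IsSemisimpleModule.range Q
    obtain ⟨S, r, hr⟩ := exists_ne_zero_simple_quotient (R := Γ) (M := LinearMap.range Q)
    have hS : S ∈ up k Γ O := by
      refine hM.top S (r ∘ₗ Q.rangeRestrict ∘ₗ J.mkQ) (ne_zero_of_surjective _ ?_)
      exact hr.comp (Q.surjective_rangeRestrict.comp J.mkQ_surjective)
    obtain ⟨i, hi⟩ := (fac_of_surjective_simple (k := k) r (ne_zero_of_surjective r hr)).exists_hom
    exact mem_of_over_of_mem_up hO hS (over_of_hom_coind ((LinearMap.range Q).subtype ∘ₗ i)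
      fun h0 => hi (LinearMap.ext fun x => Subtype.ext (LinearMap.congr_fun h0 x)))
  · obtain ⟨h, hh⟩ := hM.lift (X := CoInd R Γ X) (forall_fac_coind hC hX)
      (CoInd.map (Γ := Γ) K.mkQ) (CoInd.map_surjective G _ K.mkQ_surjective) (CoInd.hat f)
    refine ⟨CoInd.ev R Γ X ∘ₗ h.restrictScalars R, LinearMap.ext fun m => ?_⟩
    rw [← CoInd.ev_hat (Γ := Γ) f m, ← hh]; rfl

/-- Lift over `R`, then average. -/
theorem RelStd.of_restrict (hG : (Fintype.card G : k) ≠ 0) (hC : ConjStable G C)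
    (hM : RelStd.{ω} k O C M) : RelStd.{ω} k (up k Γ O) (up k Γ C) M := by
  refine ⟨forall_fac_of_restrict hM.fac, fun S f hf => ?_, fun X _ _ K hX f => ?_⟩
  · obtain ⟨T, hT⟩ := exists_under k R S
    obtain ⟨p, hp⟩ := hT.exists_hom_to G
    refine ⟨T, hM.top T (p ∘ₗ f.restrictScalars R) fun h0 => hp ?_, hT⟩
    refine LinearMap.ext fun s => ?_
    obtain ⟨x, rfl⟩ := LinearMap.surjective_of_ne_zero hf s
    exact LinearMap.congr_fun h0 x
  · let _ : Module R X := Module.compHom X (RingHom.smulOneHom : R →+* Γ)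
    have : IsScalarTower R Γ X := ⟨fun r y x => by
      change (r • y) • x = (r • (1 : Γ)) • y • x
      rw [smul_smul, smul_mul_assoc, one_mul]⟩
    obtain ⟨h, hh⟩ := hM.lift (X := X) (forall_fac_restrict hC hX) (K.mkQ.restrictScalars R)
      K.mkQ_surjective (f.restrictScalars R)
    exact exists_lift_of_restrict hG K.mkQ f h (LinearMap.congr_fun hh)

/-- Here coinduction serves as a left adjoint: lift on the copy of `N` given by `CoInd.ι` and extend
by `ind`. -/
theorem RelStd.coind (hC : ConjStable G C) {N : Type*} [AddCommGroup N] [Module R N]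
    (hN : RelStd.{ω} k O C N) : RelStd.{ω} k (up k Γ O) (up k Γ C) (CoInd R Γ N) := by
  refine ⟨forall_fac_coind hC hN.fac, fun S f hf => ?_, fun X _ _ K hX f => ?_⟩
  · have h1 := hom_coind_ne_zero (G := G) f hf
    have := isSemisimple_sim k R G S
    set φ := f.restrictScalars R ∘ₗ CoInd.ι R Γ N G
    have : Nontrivial (LinearMap.range φ) := by
      rw [Submodule.nontrivial_iff_ne_bot]
      exact fun h => h1 (LinearMap.range_eq_bot.mp h)
    obtain ⟨T, hT⟩ := exists_fac k (R := R) (LinearMap.range φ)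
    obtain ⟨p, hp⟩ := hT.exists_hom_to
    refine ⟨T, hN.top T (p ∘ₗ φ.rangeRestrict) fun h0 => hp ?_, hT.of_submodule⟩
    refine LinearMap.ext fun s => ?_
    obtain ⟨x, rfl⟩ := φ.surjective_rangeRestrict s
    exact LinearMap.congr_fun h0 x
  · let _ : Module R X := Module.compHom X (RingHom.smulOneHom : R →+* Γ)
    have : IsScalarTower R Γ X := ⟨fun r y x => by
      change (r • y) • x = (r • (1 : Γ)) • y • x
      rw [smul_smul, smul_mul_assoc, one_mul]⟩
    obtain ⟨h, hh⟩ := hN.lift (X := X) (forall_fac_restrict hC hX) (K.mkQ.restrictScalars R)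
      K.mkQ_surjective (f.restrictScalars R ∘ₗ CoInd.ι R Γ N G)
    refine ⟨ind G h, LinearMap.ext fun x => ?_⟩
    have hx : x ∈ Submodule.span Γ (LinearMap.range (CoInd.ι R Γ N G) : Set (CoInd R Γ N)) := by
      rw [CoInd.span_ι]; exact Submodule.mem_top
    refine LinearMap.eqOn_span (f := K.mkQ ∘ₗ ind G h) (g := f) ?_ hx
    rintro _ ⟨n, rfl⟩
    rw [LinearMap.comp_apply, ind_ι]
    exact LinearMap.congr_fun hh n

end Transfer

/-! ### Standard modules for an equivariant order. -/

section Equivariant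

set_option linter.unusedSectionVars false

variable {k : Type w} [Field k] {R : Type u} [Ring R] [Algebra k R] [Module.Finite k R]
  {Γ : Type v} [Ring Γ] [Algebra k Γ] [Module.Finite k Γ] [Module R Γ] [IsScalarTower R Γ Γ]
  {G : Type*} [Group G] [Fintype G] [MulSemiringAction G R] [SkewExt R Γ G]

universe ω

variable (G) in
/-- The conjugates of a simple module. -/
def Orb (L : Sim R) : Set (Sim R) := {T | Conj G L T}

variable (G) in
/-- The conjugates of a simple module and the simple modules below it. -/
def Down (le : Sim R → Sim R → Prop) (L : Sim R) : Set (Sim R) := {T | Conj G L T ∨ Lt le T L}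

variable {le : Sim R → Sim R → Prop}

theorem lt_iff_of_conj {G : Type v} [Group G] [MulSemiringAction G R] (h : IsEquivariant G le)
    {L L' N N' : Sim R} (h1 : Conj G L N)
    (h2 : Conj G L' N') : Lt le L L' ↔ Lt le N N' := by
  obtain ⟨g, hg⟩ := h1
  obtain ⟨g', hconj⟩ := h2
  exact h g g' _ _ _ _ hg hconj

/-- The strict relation is invariant under conjugation in both arguments. -/
def ConjInvariant (G : Type*) [Group G] [MulSemiringAction G R] (le : Sim R → Sim R → Prop) :
    Prop := ∀ ⦃L L' N N' : Sim R⦄, Conj G L N → Conj G L' N' → (Lt le L L' ↔ Lt le N N')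

/-- Equivariance allows different group elements on the two sides, so orbits are antichains: `L < T`
would give `L < L`. -/
theorem not_lt_of_conj (Γ : Type v) [Ring Γ] [Algebra k Γ] [Module.Finite k Γ] [Module R Γ]
    [IsScalarTower R Γ Γ] [SkewExt R Γ G] (hle : ConjInvariant G le) {L T : Sim R}
    (h : Conj G L T) : ¬ Lt le L T := fun hlt =>
  ((hle (Conj.refl k Γ G L) (h.symm k Γ)).mp hlt).2 rfl

theorem conjStable_orb (k : Type w) [Field k] [Algebra k R] [Module.Finite k R]
    (Γ : Type v) [Ring Γ] [Algebra k Γ] [Module.Finite k Γ] [Module R Γ]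
    [IsScalarTower R Γ Γ] [SkewExt R Γ G] (L : Sim R) : ConjStable G (Orb G L) :=
  fun _ _ h1 h2 => Conj.trans k Γ h2 h1

theorem conjStable_down (k : Type w) [Field k] [Algebra k R] [Module.Finite k R]
    (Γ : Type v) [Ring Γ] [Algebra k Γ] [Module.Finite k Γ] [Module R Γ]
    [IsScalarTower R Γ Γ] [SkewExt R Γ G] (hle : ConjInvariant G le) (L : Sim R) :
    ConjStable G (Down G le L) := fun _ _ h1 h2 => h2.imp (fun h => Conj.trans k Γ h h1)
  fun h => (hle h1 (Conj.refl k Γ G L)).mp h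

theorem orb_eq (k : Type w) [Field k] [Algebra k R] [Module.Finite k R]
    (Γ : Type v) [Ring Γ] [Algebra k Γ] [Module.Finite k Γ] [Module R Γ]
    [IsScalarTower R Γ Γ] [SkewExt R Γ G] {L L' : Sim R} (h : Conj G L L') :
    Orb G L = Orb G L' := by
  ext T
  exact ⟨fun hT => (h.symm k Γ).trans k Γ hT, fun hT => h.trans k Γ hT⟩

theorem down_eq (k : Type w) [Field k] [Algebra k R] [Module.Finite k R]
    (Γ : Type v) [Ring Γ] [Algebra k Γ] [Module.Finite k Γ] [Module R Γ]
    [IsScalarTower R Γ Γ] [SkewExt R Γ G] (hle : ConjInvariant G le) {L L' : Sim R}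
    (h : Conj G L L') : Down G le L = Down G le L' := by
  ext T
  exact ⟨Or.imp (fun hT => (h.symm k Γ).trans k Γ hT) (hle (Conj.refl k Γ G T) h).mp,
    Or.imp (fun hT => h.trans k Γ hT) (hle (Conj.refl k Γ G T) h).mpr⟩

theorem mem_down_of_le (Γ : Type v) [Ring Γ] [Algebra k Γ] [Module.Finite k Γ] [Module R Γ]
    [IsScalarTower R Γ Γ] [SkewExt R Γ G] {L T : Sim R} (h : le T L) : T ∈ Down G le L := by
  by_cases hT : T = L
  · exact Or.inl (hT ▸ Conj.refl k Γ G T)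
  · exact Or.inr ⟨h, hT⟩

/-- A map from `P_L` to a module with factors in `Down G le L` kills the covers of everything above
`L`, and these generate the kernel of the standard module. -/
theorem relStd_standard (Γ : Type v) [Ring Γ] [Algebra k Γ] [Module.Finite k Γ] [Module R Γ]
    [IsScalarTower R Γ Γ] [SkewExt R Γ G] (hle : ConjInvariant G le) (h : IsAdapted le)
    (L : Sim R) : RelStd.{ω} k (Orb G L) (Down G le L) (Standard k le L) := by
  obtain ⟨q, hq, hqt⟩ := exists_isTop_standard (k := k) h.partialOrder L
  refine ⟨fun T hT => mem_down_of_le (k := k) Γ (fac_standard_le hT), fun T f hf => ?_,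
    fun X _ _ K hX f => ?_⟩
  · obtain ⟨e, -⟩ := hqt.exists_equiv_of_ne_zero f hf
    rw [← Sim.eq_of_equiv ⟨e⟩]
    exact Conj.refl k Γ G L
  · obtain ⟨g, hg⟩ := cover_lift K.mkQ K.mkQ_surjective (f ∘ₗ (standardKernel k le L).mkQ)
    have hle' : standardKernel k le L ≤ LinearMap.ker g := by
      rw [h.standardKernel_eq]
      refine trace_le fun T hT φ => ?_
      rw [LinearMap.range_le_ker_iff]
      by_contra hne
      have hT' : Fac k T X := ⟨_, hne⟩
      rcases hX T hT' with h1 | h1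
      · exact not_lt_of_conj (k := k) Γ hle h1 hT
      · exact h1.not_le h.partialOrder hT.1
    refine ⟨(standardKernel k le L).liftQ g hle', ?_⟩
    ext x
    exact LinearMap.congr_fun hg x

/-- Since orbits are antichains, only `T = L` could occur. A map from `P_L` to the radical then
factors through the standard module and gives an endomorphism with image in the radical; being a
scalar, it is zero. -/
theorem not_fac_jacobson_standard (Γ : Type v) [Ring Γ] [Algebra k Γ] [Module.Finite k Γ]
    [Module R Γ] [IsScalarTower R Γ Γ] [SkewExt R Γ G] (hle : ConjInvariant G le)
    (h : IsQuasiHereditary k le) {L T : Sim R} (hT : Conj G L T) :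
    ¬ Fac k T (Module.jacobson R (Standard k le L)) := by
  intro hf
  have hpo := h.adapted.partialOrder
  have hTL : T = L := by
    by_contra hne
    exact not_lt_of_conj (k := k) Γ hle (hT.symm k Γ) ⟨fac_standard_le hf.of_submodule, hne⟩
  subst hTL
  obtain ⟨q, -, hq⟩ := exists_isTop_standard (k := k) hpo T
  obtain ⟨f, hf⟩ := hf
  set F := (Module.jacobson R (Standard k le T)).subtype ∘ₗ f
  obtain ⟨g, hg⟩ := exists_factor (standardKernel k le T).mkQ (Submodule.mkQ_surjective _) F (by
    rw [Submodule.ker_mkQ]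
    exact trace_le_ker (D := {L' | ¬ le L' T}) F fun T' hT' hfac => hT' (fac_standard_le hfac))
  obtain ⟨c, hc⟩ := (h.end_eq_scalars T).2 g
  have hq0 : q ∘ₗ g = 0 := by
    ext x
    have h1 := LinearMap.congr_fun hg x
    have h2 : F x ∈ LinearMap.ker q := by rw [← hq.jacobson_eq]; exact (f x).2
    rw [← h1] at h2
    exact h2
  have hc0 : c = 0 := by
    by_contra hne
    refine hq.ne_zero (LinearMap.ext fun x => ?_)
    have h1 := LinearMap.congr_fun hq0 (algebraMap k R c⁻¹ • x)
    rw [LinearMap.comp_apply, ← hc, map_smul, map_smul, Module.algebraMap_end_apply,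
      ← algebraMap_smul R c x, map_smul, smul_smul, ← map_mul, inv_mul_cancel₀ hne, map_one,
      one_smul] at h1
    exact h1
  apply hf
  ext x
  have h1 := LinearMap.congr_fun hg x
  rw [← hc, hc0, map_zero, LinearMap.zero_comp] at h1
  exact h1.symm

end Equivariant

/-! ### Largest quotients of covers with prescribed factors, and scalar endomorphisms. -/

section Rigid

variable {k : Type w} [Field k] {R : Type u} [Ring R] [Algebra k R] [Module.Finite k R]

universe ω

theorem relStd_cover_quotient {O C : Set (Sim R)} {L : Sim R} (hO : L ∈ O) (hC : L ∈ C) :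
    RelStd.{ω} k O C (cover k L ⧸ trace k Cᶜ L) := by
  obtain ⟨q, hq, hqt⟩ := exists_isTop_quotient
    (trace_le_ker_coverMap (k := k) (D := Cᶜ) (L := L) (fun h => h hC))
  refine ⟨fun T hT => ?_, fun T f hf => ?_, fun X _ _ K hX f => ?_⟩
  · by_contra hTC
    exact not_fac_quotient_trace (D := Cᶜ) hTC hT
  · obtain ⟨e, -⟩ := hqt.exists_equiv_of_ne_zero f hf
    rwa [← Sim.eq_of_equiv ⟨e⟩]
  · obtain ⟨g, hg⟩ := cover_lift K.mkQ K.mkQ_surjective (f ∘ₗ (trace k Cᶜ L).mkQ)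
    refine ⟨(trace k Cᶜ L).liftQ g (trace_le_ker g fun T hT hT' => hT (hX T hT')), ?_⟩
    ext x
    exact LinearMap.congr_fun hg x

/-- Schur's lemma for a module whose simple top is not a composition factor of its radical. -/
theorem bijective_algebraMap_end [IsAlgClosed k] {M : Type*} [AddCommGroup M] [Module R M]
    [Module k M] [IsScalarTower k R M] [Module.Finite R M] {S : Sim R} {p : M →ₗ[R] S.Mod}
    (hp : IsTop p) (hr : ¬ Fac k S (Module.jacobson R M)) :
    Function.Bijective (algebraMap k (Module.End R M)) := by
  have hS := IsSimpleModule.nontrivial R S.Mod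
  have hM : Nontrivial M := hp.surjective.nontrivial
  refine ⟨(algebraMap k (Module.End R M)).injective, fun f => ?_⟩
  obtain ⟨f', hf'⟩ := exists_factor p hp.surjective (p ∘ₗ f) fun x hx => by
    rw [← hp.jacobson_eq] at hx
    rw [LinearMap.mem_ker, LinearMap.comp_apply, ← LinearMap.mem_ker, ← hp.jacobson_eq]
    exact Module.map_jacobson_le f (Submodule.mem_map_of_mem hx)
  obtain ⟨c, hc⟩ := (IsSimpleModule.algebraMap_end_bijective_of_isAlgClosed (A := R)
    (V := S.Mod) k).2 f'
  refine ⟨c, ?_⟩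
  by_contra hne
  let g : M →ₗ[R] M := f - algebraMap k (Module.End R M) c
  have hg0 : g ≠ 0 := fun h => hne (sub_eq_zero.mp h).symm
  have hpg : ∀ x, g x ∈ Module.jacobson R M := fun x => by
    have h1 := LinearMap.congr_fun hf' x
    rw [← hc, LinearMap.comp_apply, Module.algebraMap_end_apply, LinearMap.comp_apply,
      ← algebraMap_smul R c (p x), ← map_smul] at h1
    rw [hp.jacobson_eq, LinearMap.mem_ker, LinearMap.sub_apply, map_sub, ← h1,
      Module.algebraMap_end_apply, algebraMap_smul, sub_self]
  refine hr (fac_of_isTop hp (g.codRestrict _ hpg) fun h0 => hg0 (LinearMap.ext fun x => ?_))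
  exact congrArg Subtype.val (LinearMap.congr_fun h0 x)

end Rigid

/-! ### The induced order is adapted. -/

section OverOrder

set_option linter.unusedSectionVars false

variable {k : Type w} [Field k] {R : Type u} [Ring R] [Algebra k R] [Module.Finite k R]
  {Γ : Type v} [Ring Γ] [Algebra k Γ] [Module.Finite k Γ] [Module R Γ] [IsScalarTower R Γ Γ]
  {G : Type*} [Group G] [Fintype G] [MulSemiringAction G R] [SkewExt R Γ G]
  {le : Sim R → Sim R → Prop}

universe ω

variable (k Γ) in
/-- The order on the simple modules of the skew group ring: `S < S'` if all constituents of the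
restriction of `S` are smaller than those of `S'`. -/
def overLE (le : Sim R → Sim R → Prop) (S S' : Sim Γ) : Prop :=
  S = S' ∨ ∀ T T' : Sim R, Over k S T → Over k S' T' → Lt le T T'

theorem lt_overLE {S S' : Sim Γ} :
    Lt (overLE k Γ le) S S' ↔ ∀ T T' : Sim R, Over k S T → Over k S' T' → Lt le T T' := by
  refine ⟨fun h => h.1.resolve_left h.2, fun h => ⟨Or.inr h, ?_⟩⟩
  rintro rfl
  obtain ⟨T, hT⟩ := exists_under k R S
  exact (h T T hT hT).2 rfl

theorem isPartialOrder_overLE (h : IsPartialOrder (Sim R) le) :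
    IsPartialOrder (Sim Γ) (overLE k Γ le) where
  refl S := Or.inl rfl
  trans S S' S'' h1 h2 := by
    rcases h1 with rfl | h1
    · exact h2
    rcases h2 with rfl | h2
    · exact Or.inr h1
    refine Or.inr fun T T'' hT hT'' => ?_
    obtain ⟨T', hT'⟩ := exists_under k R S'
    exact (h1 T T' hT hT').trans h (h2 T' T'' hT' hT'')
  antisymm S S' h1 h2 := by
    rcases h1 with h1 | h1
    · exact h1
    rcases h2 with h2 | h2
    · exact h2.symm
    obtain ⟨T, hT⟩ := exists_under k R S
    obtain ⟨T', hT'⟩ := exists_under k R S'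
    exact absurd (h2 T' T hT' hT).1 ((h1 T T' hT hT').not_le h)

/-- All constituents of a simple `Γ`-module are conjugate, so by invariance one comparable pair
implies all comparisons. -/
theorem lt_overLE_of_lt (hle : ConjInvariant G le) {S S' : Sim Γ} {T T' : Sim R}
    (hT : Over k S T) (hT' : Over k S' T') (h : Lt le T T') : Lt (overLE k Γ le) S S' :=
  lt_overLE.mpr fun _ _ h1 h2 => (hle (hT.conj_of_over h1) (hT'.conj_of_over h2)).mp h

theorem lt_of_lt_overLE {S S' : Sim Γ} {T T' : Sim R} (h : Lt (overLE k Γ le) S S')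
    (hT : Over k S T) (hT' : Over k S' T') : Lt le T T' := lt_overLE.mp h T T' hT hT'

/-- Restricted to `R`, the module is a direct sum of standard modules of one orbit, whose radicals
contain no member of that orbit; the two radicals of `M` agree. -/
theorem RelStd.not_fac_jacobson_skew (hG : (Fintype.card G : k) ≠ 0) (hle : ConjInvariant G le)
    (h : IsQuasiHereditary k le) {T : Sim R} {M : Type*} [AddCommGroup M] [Module R M] [Module Γ M]
    [IsScalarTower R Γ M] [Module.Finite Γ M]
    (hM : RelStd.{max u v} k (up k Γ (Orb G T)) (up k Γ (Down G le T)) M)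
    {S : Sim Γ} (hS : S ∈ up k Γ (Orb G T)) : ¬ Fac k S (Module.jacobson Γ M) := by
  have hO := conjStable_orb (G := G) k Γ T
  have hC := conjStable_down (G := G) k Γ hle T
  have hM' : RelStd.{u} k (Orb G T) (Down G le T) M := RelStd.restrict hG hO hC hM
  have := finite_restrict Γ G M (R := R)
  choose q _ hq using fun L => exists_isTop_standard (k := k) h.adapted.partialOrder L
  obtain ⟨T', hT', hST⟩ := hS
  intro hf
  have := IsArtinianRing.of_finite k R
  have h0 : Fac k T' (Module.jacobson Γ M) := hf.restrict hST
  have h1 : Fac k T' ((Module.jacobson Γ M).restrictScalars R) := h0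
  rw [restrictScalars_jacobson k R G M hG] at h1
  refine RelStd.not_fac_jacobson hq (fun L hL => ?_) (fun L hL L' hL' => ?_) hM' hT' h1
  · have h2 := relStd_standard (k := k) Γ hle h.adapted L
    rwa [← orb_eq k Γ hL, ← down_eq k Γ hle hL] at h2
  · exact not_fac_jacobson_standard Γ hle h ((hL.symm k Γ).trans k Γ hL')

theorem mem_up_orb {S : Sim Γ} {T : Sim R} (h : Over k S T) : S ∈ up k Γ (Orb G T) :=
  ⟨T, Conj.refl k Γ G T, h⟩

theorem mem_up_down {S : Sim Γ} {T : Sim R} (h : Over k S T) : S ∈ up k Γ (Down G le T) :=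
  ⟨T, Or.inl (Conj.refl k Γ G T), h⟩

theorem not_fac_jacobson_cover_quotient (hG : (Fintype.card G : k) ≠ 0) (hle : ConjInvariant G le)
    (h : IsQuasiHereditary k le) {S S' : Sim Γ} {T : Sim R} (hT : Over k S T) (hT' : Over k S' T) :
    ¬ Fac k S' (Module.jacobson Γ (cover k S ⧸ trace k (up k Γ (Down G le T))ᶜ S)) :=
  RelStd.not_fac_jacobson_skew hG hle h
    (relStd_cover_quotient (mem_up_orb hT) (mem_up_down hT)) (mem_up_orb hT')

/-- The two descriptions differ only in the simple modules `S' ≠ S` lying over the same orbit as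
`S`. These are not below `S`, but they do not occur in the radical of the quotient on the right, so
factoring them out changes nothing. -/
theorem standardKernel_overLE (hG : (Fintype.card G : k) ≠ 0) (hle : ConjInvariant G le)
    (h : IsQuasiHereditary k le) {S : Sim Γ} {T : Sim R} (hT : Over k S T) :
    standardKernel k (overLE k Γ le) S = trace k (up k Γ (Down G le T))ᶜ S := by
  refine le_antisymm (trace_le (D := {S' | ¬ overLE k Γ le S' S}) fun S' hS' φ => ?_)
    (trace_le fun S' hS' φ => range_le_trace (D := {S' | ¬ overLE k Γ le S' S}) ?_ φ)
  · by_contra hne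
    set K := trace k (up k Γ (Down G le T))ᶜ S
    have hfac : Fac k S' (cover k S ⧸ K) := by
      refine ⟨K.mkQ ∘ₗ φ, fun h0 => hne ?_⟩
      rwa [← LinearMap.range_le_ker_iff, Submodule.ker_mkQ] at h0
    have hmem : S' ∈ up k Γ (Down G le T) := by
      by_contra hn
      exact not_fac_quotient_trace (D := (up k Γ (Down G le T))ᶜ) hn hfac
    obtain ⟨T', hT', hST'⟩ := hmem
    rcases hT' with hT' | hT'
    · obtain ⟨q, -, hq⟩ := exists_isTop_quotient (trace_le_ker_coverMap (k := k)
        (D := (up k Γ (Down G le T))ᶜ) (L := S) fun hn => hn (mem_up_down hT))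
      rcases hfac.of_ker q with h1 | h1
      · rw [← hq.jacobson_eq] at h1
        exact not_fac_jacobson_cover_quotient hG hle h hT (hST'.conj (hT'.symm k Γ)) h1
      · exact hS' (Or.inl h1.eq_of_simple)
    · exact hS' (lt_overLE_of_lt hle hST' hT hT').1
  · intro hle'
    apply hS'
    by_cases he : S' = S
    · exact he ▸ mem_up_down hT
    · obtain ⟨T', hT'⟩ := exists_under k R S'
      exact ⟨T', Or.inr (lt_of_lt_overLE ⟨hle', he⟩ hT' hT), hT'⟩

theorem relStd_standard_overLE (hG : (Fintype.card G : k) ≠ 0) (hle : ConjInvariant G le)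
    (h : IsQuasiHereditary k le) {S : Sim Γ} {T : Sim R} (hT : Over k S T) :
    RelStd.{ω} k (up k Γ (Orb G T)) (up k Γ (Down G le T)) (Standard k (overLE k Γ le) S) := by
  have key : ∀ K, K = trace k (up k Γ (Down G le T))ᶜ S →
      RelStd.{ω} k (up k Γ (Orb G T)) (up k Γ (Down G le T)) (cover k S ⧸ K) := by
    rintro _ rfl
    exact relStd_cover_quotient (mem_up_orb hT) (mem_up_down hT)
  exact key _ (standardKernel_overLE hG hle h hT)

/-- A cover `P_T` of a constituent of the top maps to `M` with image generating `M` over `Γ`. That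
image is a quotient of `P_T` with the same factors as `M` up to conjugacy, so adaptedness over `R`
applies to it; any factor of the image lies under a factor of `M`. -/
theorem isAdapted_overLE (hG : (Fintype.card G : k) ≠ 0) (hle : ConjInvariant G le)
    (h : IsQuasiHereditary k le) : IsAdapted (overLE k Γ le) := by
  have hpo := h.adapted.partialOrder
  refine ⟨isPartialOrder_overLE hpo, ?_⟩
  rintro M _ _ _ S S' ⟨e⟩ ⟨e'⟩ hn1 hn2
  suffices ∃ S'', Fac k S'' M ∧ Lt (overLE k Γ le) S S'' ∧ Lt (overLE k Γ le) S' S'' by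
    obtain ⟨S'', h1, h2⟩ := this
    exact ⟨S'', fac_iff.mpr h1, h2⟩
  have hSS' : S' ≠ S := fun he => hn1 (Or.inl he.symm)
  let _ : Module R M := Module.compHom M (RingHom.smulOneHom : R →+* Γ)
  have : IsScalarTower R Γ M := ⟨fun r y x => by
    change (r • y) • x = (r • (1 : Γ)) • y • x
    rw [smul_smul, smul_mul_assoc, one_mul]⟩
  obtain ⟨p, hp⟩ := exists_isTop_of_top_equiv e
  have hfS' : Fac k S' M := (fac_self (k := k) S').of_injective
    ((socle Γ M).subtype ∘ₗ e'.symm.toLinearMap)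
    ((Submodule.injective_subtype _).comp e'.symm.injective)
  obtain ⟨T, hT⟩ := exists_under k R S
  obtain ⟨T', hT'⟩ := exists_under k R S'
  obtain ⟨a, ha⟩ := hT.exists_hom G
  obtain ⟨φ, hφ⟩ := cover_lift (p.restrictScalars R) hp.surjective (a ∘ₗ coverMap k T)
  have hspan : Submodule.span Γ (LinearMap.range φ : Set M) = ⊤ := by
    by_contra hne
    refine ha (LinearMap.ext fun t => ?_)
    obtain ⟨c, rfl⟩ := (coverMap_isTop k T).surjective t
    have h1 : φ c ∈ LinearMap.ker p :=
      hp.le_ker _ hne (Submodule.subset_span (LinearMap.mem_range_self φ c))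
    rw [← LinearMap.comp_apply, ← hφ]
    exact h1
  have hN : ∀ {T1 : Sim R}, Fac k T1 M →
      ∃ T0, Conj G T1 T0 ∧ Fac k T0 (cover k T ⧸ LinearMap.ker φ) := fun hT1 => by
    obtain ⟨T0, h1, h2⟩ := Fac.of_span_eq_top (G := G) hT1 _ hspan
    exact ⟨T0, h1, h2.equiv φ.quotKerEquivRange.symm⟩
  have hup : ∀ {T1 : Sim R}, Fac k T1 (cover k T ⧸ LinearMap.ker φ) →
      ∃ S1, Fac k S1 M ∧ Over k S1 T1 := fun hT1 =>
    Fac.exists_over (Γ := Γ) G (hT1.equiv φ.quotKerEquivRange).of_submodule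
  obtain ⟨T0, hc, hT0⟩ := hN (hfS'.restrict hT')
  have hST0 : Over k S' T0 := hT'.conj hc
  -- If `S` and `S'` lie over the same orbit, comparing `T` with `T0` yields nothing and a different
  -- factor of `M` is needed.
  by_cases hconj : Conj G T T0
  · have hST : Over k S' T := hST0.conj (hconj.symm k Γ)
    -- Otherwise `M` would be a quotient of the cover of `S` modulo its trace, and `S'` would occur
    -- in the radical of that quotient.
    obtain ⟨S1, hS1, hS1n⟩ : ∃ S1, Fac k S1 M ∧ S1 ∉ up k Γ (Down G le T) := by
      by_contra! hall
      obtain ⟨f, hf⟩ := cover_lift p hp.surjective (coverMap k S)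
      have hfs : Function.Surjective f := hp.surjective_of_comp_ne_zero f
        (hf ▸ (coverMap_isTop k S).ne_zero)
      let K := trace k (up k Γ (Down G le T))ᶜ S
      have hK : K ≤ LinearMap.ker f := trace_le_ker f fun S1 hS1 hS1' => hS1 (hall S1 hS1')
      let g : (cover k S ⧸ K) →ₗ[Γ] M := K.liftQ f hK
      have hgs : Function.Surjective g := fun m => by
        obtain ⟨x, rfl⟩ := hfs m
        exact ⟨K.mkQ x, rfl⟩
      have hpg : IsTop (p ∘ₗ g) := by
        obtain ⟨q, hq, hqt⟩ := exists_isTop_quotient (trace_le_ker_coverMap (k := k)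
          (D := (up k Γ (Down G le T))ᶜ) (L := S) fun hn => hn (mem_up_down hT))
        have : p ∘ₗ g = q := by
          ext x
          exact (LinearMap.congr_fun hf x).trans (LinearMap.congr_fun hq x).symm
        rwa [this]
      rcases hfS'.of_ker p with h1 | h1
      · refine not_fac_jacobson_cover_quotient hG hle h hT hST ?_
        rw [hpg.jacobson_eq]
        refine h1.of_surjective (g.restrict (p := LinearMap.ker (p ∘ₗ g)) (q := LinearMap.ker p)
          fun x hx => hx) ?_
        rintro ⟨m, hm⟩
        obtain ⟨x, rfl⟩ := hgs m
        exact ⟨⟨x, hm⟩, rfl⟩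
      · exact hSS' h1.eq_of_simple
    obtain ⟨T1, hT1⟩ := exists_under k R S1
    obtain ⟨T2, hc2, hT2⟩ := hN (hS1.restrict hT1)
    have hST2 : Over k S1 T2 := hT1.conj hc2
    obtain ⟨T3, hT3, hlt, -⟩ := h.adapted.exists_fac_gt (LinearMap.ker φ) hT2 fun hle' =>
      hS1n ⟨T2, mem_down_of_le (k := k) Γ hle', hST2⟩
    obtain ⟨S3, hS3, hST3⟩ := hup hT3
    exact ⟨S3, hS3, lt_overLE_of_lt hle hT hST3 hlt, lt_overLE_of_lt hle hST hST3 hlt⟩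
  · obtain ⟨T1, hT1, hlt, hle1⟩ := h.adapted.exists_fac_gt (LinearMap.ker φ) hT0 fun hle' =>
      hn2 (lt_overLE_of_lt hle hST0 hT ⟨hle', fun he => hconj (he ▸ Conj.refl k Γ G T0)⟩).1
    obtain ⟨S1, hS1, hST1⟩ := hup hT1
    refine ⟨S1, hS1, lt_overLE_of_lt hle hT hST1 hlt, lt_overLE_of_lt hle hST0 hST1 ⟨hle1, ?_⟩⟩
    rintro rfl
    exact hn1 (lt_overLE_of_lt hle hT hST0 hlt).1

theorem bijective_algebraMap_end_standard [IsAlgClosed k] (hG : (Fintype.card G : k) ≠ 0)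
    (hle : ConjInvariant G le) (h : IsQuasiHereditary k le) (S : Sim Γ) :
    Function.Bijective (algebraMap k (Module.End Γ (Standard k (overLE k Γ le) S))) := by
  obtain ⟨T, hT⟩ := exists_under k R S
  obtain ⟨q, -, hq⟩ := exists_isTop_standard (k := k)
    (isPartialOrder_overLE (k := k) (Γ := Γ) h.adapted.partialOrder) S
  exact bijective_algebraMap_end hq (RelStd.not_fac_jacobson_skew hG hle h
    (relStd_standard_overLE hG hle h hT) (mem_up_orb hT))

end OverOrder

/-! ### Building standard filtrations step by step. -/

section Filtration

variable {k : Type w} [Field k] {R : Type u} [Ring R] [Algebra k R] [Module.Finite k R]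

/-- `U` has a finite filtration by standard modules. -/
def StdFiltered (k : Type w) [Field k] {R : Type u} [Ring R] [Algebra k R] [Module.Finite k R]
    (le : Sim R → Sim R → Prop) {M : Type*} [AddCommGroup M] [Module R M] (U : Submodule R M) :
    Prop :=
  ∃ (n : ℕ) (F : ℕ → Submodule R M), F 0 = ⊥ ∧ F n = U ∧ ∀ i < n, F i ≤ F (i + 1) ∧
    ∃ L : Sim R, Nonempty ((F (i + 1) ⧸ (F i).submoduleOf (F (i + 1))) ≃ₗ[R] Standard k le L)

variable {le : Sim R → Sim R → Prop} {M : Type*} [AddCommGroup M] [Module R M]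

theorem stdFiltered_bot : StdFiltered k le (⊥ : Submodule R M) :=
  ⟨0, fun _ => ⊥, rfl, rfl, fun _ h => absurd h (Nat.not_lt_zero _)⟩

theorem StdFiltered.step {U V : Submodule R M} (h : StdFiltered k le U) (hUV : U ≤ V) {L : Sim R}
    (f : V →ₗ[R] Standard k le L) (hf : Function.Surjective f)
    (hker : LinearMap.ker f = U.submoduleOf V) : StdFiltered k le V := by
  obtain ⟨n, F, h0, hn, hF⟩ := h
  let P : Submodule R M → Submodule R M → Prop := fun U V => U ≤ V ∧
    ∃ L : Sim R, Nonempty ((V ⧸ U.submoduleOf V) ≃ₗ[R] Standard k le L)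
  let F' : ℕ → Submodule R M := fun i => if i ≤ n then F i else V
  have h1 : ∀ i ≤ n, F' i = F i := fun i hi => if_pos hi
  have h2 : F' (n + 1) = V := if_neg (Nat.not_succ_le_self n)
  refine ⟨n + 1, F', by rw [h1 0 (Nat.zero_le _), h0], h2, fun i hi => ?_⟩
  change P (F' i) (F' (i + 1))
  rcases Nat.lt_succ_iff_lt_or_eq.mp hi with hi' | rfl
  · rw [h1 i hi'.le, h1 (i + 1) hi']
    exact hF i hi'
  · rw [h1 i le_rfl, h2, hn]
    exact ⟨hUV, L, ⟨(Submodule.quotEquivOfEq _ _ hker.symm).trans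
      (f.quotKerEquivOfSurjective hf)⟩⟩

theorem StdFiltered.pi {U V : Submodule R M} (h : StdFiltered k le U) (hUV : U ≤ V) {n : ℕ}
    {T : Fin n → Sim R} (f : V →ₗ[R] ∀ i, Standard k le (T i)) (hf : Function.Surjective f)
    (hker : LinearMap.ker f = U.submoduleOf V) : StdFiltered k le V := by
  -- `W j` consists of the elements whose coordinates from `j` on vanish, so `W 0` is the kernel of
  -- `f`, `W n` is everything, and each step adds one coordinate.
  let W : ℕ → Submodule R V := fun j => ⨅ (i : Fin n) (_ : j ≤ i), LinearMap.ker (LinearMap.proj i ∘ₗ f)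
  have hW : ∀ j (x : V), x ∈ W j ↔ ∀ i : Fin n, j ≤ i → f x i = 0 := fun j x => by
    simp only [W, Submodule.mem_iInf, LinearMap.mem_ker]; rfl
  have key : ∀ j ≤ n, StdFiltered k le ((W j).map V.subtype) := by
    intro j hj
    induction j with
    | zero =>
      convert h
      ext x
      constructor
      · rintro ⟨y, hy, rfl⟩
        have : y ∈ LinearMap.ker f := funext fun i => (hW 0 y).mp hy i (Nat.zero_le _)
        rw [hker] at this
        exact this
      · intro hx
        refine ⟨⟨x, hUV hx⟩, (hW _ _).mpr fun i _ => ?_, rfl⟩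
        have : (⟨x, hUV hx⟩ : V) ∈ LinearMap.ker f := hker ▸ hx
        exact congrFun this i
    | succ j ih =>
      let jj : Fin n := ⟨j, hj⟩
      have hle : W j ≤ W (j + 1) := fun x hx => (hW _ _).mpr fun i hi =>
        (hW _ _).mp hx i ((Nat.le_succ j).trans hi)
      let e := Submodule.equivMapOfInjective V.subtype V.injective_subtype (W (j + 1))
      let f' := LinearMap.proj jj ∘ₗ f ∘ₗ (W (j + 1)).subtype
      have hf' : Function.Surjective f' := fun y => by
        obtain ⟨x, hx⟩ := hf (Pi.single jj y)
        refine ⟨⟨x, (hW _ _).mpr fun i hi => ?_⟩, ?_⟩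
        · rw [hx, Pi.single_eq_of_ne]
          rintro rfl
          exact absurd hi (by simp [jj])
        · change f x jj = y
          rw [hx, Pi.single_eq_same]
      refine (ih (Nat.le_of_succ_le hj)).step (Submodule.map_mono hle)
        (f' ∘ₗ e.symm.toLinearMap) (hf'.comp e.symm.surjective) ?_ (L := T jj)
      ext x
      obtain ⟨y, rfl⟩ := e.surjective x
      rw [LinearMap.mem_ker, LinearMap.comp_apply, LinearEquiv.coe_coe, e.symm_apply_apply]
      change f y jj = 0 ↔ ((y : V) : M) ∈ (W j).map V.subtype
      rw [Submodule.mem_map]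
      constructor
      · refine fun h0 => ⟨y, (hW _ _).mpr fun i hi => ?_, rfl⟩
        rcases hi.eq_or_lt with hi | hi
        · have : jj = i := Fin.ext hi
          rwa [← this]
        · exact (hW _ _).mp y.2 i hi
      · rintro ⟨z, hz, hzy⟩
        rw [← V.injective_subtype hzy]
        exact (hW _ _).mp hz jj le_rfl
  have h1 := key n le_rfl
  have h2 : W n = ⊤ := by
    rw [eq_top_iff]
    exact fun x _ => (hW _ _).mpr fun i hi => absurd i.2 (not_lt.mpr hi)
  rwa [h2, Submodule.map_top, Submodule.range_subtype] at h1

end Filtration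

/-! ### The skew group algebra is quasi-hereditary. -/

section SkewQuasiHereditary

set_option linter.unusedSectionVars false

variable {k : Type w} [Field k] {R : Type u} [Ring R] [Algebra k R] [Module.Finite k R]
  {Γ : Type v} [Ring Γ] [Algebra k Γ] [Module.Finite k Γ] [Module R Γ] [IsScalarTower R Γ Γ]
  {G : Type*} [Group G] [Fintype G] [MulSemiringAction G R] [SkewExt R Γ G]
  {le : Sim R → Sim R → Prop}

variable (R Γ G) in
/-- The coefficient form `x ↦ (y ↦ c (y x))` identifies the skew group ring with the module
coinduced from the coefficient ring. -/
def coeffForm : Γ →ₗ[Γ] CoInd R Γ R := CoInd.hat (cc R Γ G)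

theorem coeffForm_smul_one (r : R) : coeffForm R Γ G (r • 1) = CoInd.ι R Γ R G r :=
  CoInd.ext fun y => cc_mul_smul_one y r

theorem coeffForm_surjective : Function.Surjective (coeffForm R Γ G) := by
  rw [← LinearMap.range_eq_top, eq_top_iff, ← CoInd.span_ι (G := G), Submodule.span_le]
  rintro _ ⟨r, rfl⟩
  exact ⟨r • 1, coeffForm_smul_one r⟩

/-- The map extending `r ↦ r • 1` to the coinduced module is a left inverse; by linearity it is
enough to check this at `1`. -/
theorem coeffForm_injective : Function.Injective (coeffForm R Γ G) := by
  let φ : R →ₗ[R] Γ := LinearMap.toSpanSingleton R Γ 1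
  have h : ind (Γ := Γ) G φ ∘ₗ coeffForm R Γ G = LinearMap.id := by
    refine LinearMap.ext_ring ?_
    have h1 := coeffForm_smul_one (G := G) (Γ := Γ) (1 : R)
    rw [one_smul] at h1
    rw [LinearMap.comp_apply, h1, ind_ι]
    exact one_smul R _
  exact Function.LeftInverse.injective (g := ind (Γ := Γ) G φ) (LinearMap.congr_fun h)

variable (Γ G) in
/-- The left ideal of the skew group ring generated by a left ideal of the coefficient ring. -/
def extendIdeal (F : Submodule R R) : Submodule Γ Γ where
  carrier := {x | ∀ y, cc R Γ G (y * x) ∈ F}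
  add_mem' ha hb y := by rw [mul_add, map_add]; exact F.add_mem (ha y) (hb y)
  zero_mem' y := by rw [mul_zero, map_zero]; exact F.zero_mem
  smul_mem' z x hx y := by rw [smul_eq_mul, ← mul_assoc]; exact hx _

theorem extendIdeal_bot : extendIdeal Γ G (⊥ : Submodule R R) = ⊥ := by
  rw [eq_bot_iff]
  intro x hx
  refine coeffForm_injective (G := G) (R := R) ?_
  rw [map_zero]
  exact CoInd.ext hx

theorem extendIdeal_top : extendIdeal Γ G (⊤ : Submodule R R) = ⊤ :=
  eq_top_iff.mpr fun _ _ _ => Submodule.mem_top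

/-- Under the coefficient form `extendIdeal` corresponds to coinduction of left ideals, so its
successive quotients are coinduced from those of the original chain. -/
theorem exists_extendIdeal_coind {F F' : Submodule R R} {Q : Type*} [AddCommGroup Q] [Module R Q]
    (π : F' →ₗ[R] Q) (hπ : Function.Surjective π) (hker : LinearMap.ker π = F.submoduleOf F') :
    ∃ f : extendIdeal Γ G F' →ₗ[Γ] CoInd R Γ Q, Function.Surjective f ∧
      LinearMap.ker f = (extendIdeal Γ G F).submoduleOf (extendIdeal Γ G F') := by
  have h1 : ∀ x : extendIdeal Γ G F', cc R Γ G x ∈ F' := fun x => by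
    have := x.2 1
    rwa [one_mul] at this
  let ψ : extendIdeal Γ G F' →ₗ[R] F' :=
    (cc R Γ G ∘ₗ (extendIdeal Γ G F').subtype.restrictScalars R).codRestrict F' h1
  have hψ : ∀ (x : extendIdeal Γ G F') (y : Γ),
      CoInd.hat (Γ := Γ) (π ∘ₗ ψ) x y = π ⟨cc R Γ G (y * x), x.2 y⟩ := fun x y => rfl
  refine ⟨CoInd.hat (π ∘ₗ ψ), fun c => ?_, ?_⟩
  · obtain ⟨d, rfl⟩ := CoInd.map_surjective G π hπ c
    obtain ⟨x, hx⟩ := coeffForm_surjective (G := G) (CoInd.map (Γ := Γ) F'.subtype d)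
    have hx' : ∀ y, cc R Γ G (y * x) = d y := fun y => DFunLike.congr_fun hx y
    refine ⟨⟨x, fun y => by rw [hx']; exact (d y).2⟩, CoInd.ext fun y => ?_⟩
    rw [hψ, CoInd.map_apply]
    exact congrArg π (Subtype.ext (hx' y))
  · ext x
    have h2 : ∀ y, π ⟨cc R Γ G (y * x), x.2 y⟩ = 0 ↔ cc R Γ G (y * x) ∈ F := fun y => by
      rw [← LinearMap.mem_ker, hker]; rfl
    rw [LinearMap.mem_ker]
    constructor
    · intro h y
      exact (h2 y).mp (by rw [← hψ, h]; rfl)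
    · intro h
      refine CoInd.ext fun y => ?_
      rw [hψ]
      exact (h2 y).mpr (h y)

theorem extendIdeal_mono {F F' : Submodule R R} (h : F ≤ F') :
    extendIdeal Γ G F ≤ extendIdeal Γ G F' := fun _ hx y => h (hx y)

/-- Each layer of the extended chain is coinduced from a standard module, hence relatively
projective and a finite direct sum of standard modules over `Γ`. -/
theorem hasStandardFiltration_overLE (hG : (Fintype.card G : k) ≠ 0) (hle : ConjInvariant G le)
    (h : IsQuasiHereditary k le) : HasStandardFiltration k (overLE k Γ le) Γ := by
  obtain ⟨n, F, h0, hn, hF⟩ := h.filtration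
  have key : ∀ j ≤ n, StdFiltered k (overLE k Γ le) (extendIdeal Γ G (F j)) := by
    intro j hj
    induction j with
    | zero => rw [h0, extendIdeal_bot]; exact stdFiltered_bot
    | succ j ih =>
      obtain ⟨hle', L, ⟨e⟩⟩ := hF j hj
      obtain ⟨f, hf, hker⟩ := exists_extendIdeal_coind (Γ := Γ) (G := G) (F := F j)
        (e.toLinearMap ∘ₗ Submodule.mkQ _) (e.surjective.comp (Submodule.mkQ_surjective _))
        (by rw [LinearEquiv.ker_comp, Submodule.ker_mkQ])
      have hC := RelStd.coind (Γ := Γ) (conjStable_down k Γ hle L)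
        (relStd_standard.{u, v, w, v} (k := k) Γ hle h.adapted L)
      choose q _ hq using fun S : Sim Γ => exists_isTop_standard (k := k)
        (isPartialOrder_overLE (k := k) (Γ := Γ) h.adapted.partialOrder) S
      have := CoInd.finite (R := R) (Γ := Γ) (N := Standard k le L) G
      obtain ⟨m, T, -, ⟨E⟩⟩ := hC.exists_equiv_pi hq (fun S hS => by
        obtain ⟨T, hT, hST⟩ := hS
        have h2 := relStd_standard_overLE (k := k) hG hle h hST
        rwa [← orb_eq k Γ hT, ← down_eq k Γ hle hT] at h2)
      refine (ih (Nat.le_of_succ_le hj)).pi (extendIdeal_mono hle') (E.toLinearMap ∘ₗ f)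
        (E.surjective.comp hf) ?_
      rw [LinearEquiv.ker_comp, hker]
  have h1 := key n le_rfl
  rwa [hn, extendIdeal_top] at h1

theorem isQuasiHereditary_overLE [IsAlgClosed k] (hG : (Fintype.card G : k) ≠ 0)
    (hle : ConjInvariant G le) (h : IsQuasiHereditary k le) :
    IsQuasiHereditary k (overLE k Γ le) :=
  have ha := isAdapted_overLE (k := k) (Γ := Γ) hG hle h
  ⟨ha, hasStandardFiltration_overLE hG hle h, ha.subsingleton_ext,
    bijective_algebraMap_end_standard hG hle h⟩

end SkewQuasiHereditary

/-! ### Acyclic relations transported along an incidence relation. -/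

section Incidence

variable {X Y : Type*} {ρ : X → X → Prop} {σ : Y → Y → Prop} {le : Y → Y → Prop} {I : X → Y → Prop}

theorem exists_lt_of_transGen (hle : IsPartialOrder Y le) (hσ : ∀ y y', σ y y' → Lt le y y')
    (h : ∀ x x' y, ρ x x' → I x y → ∃ y', I x' y' ∧ σ y y') {x x' : X} {y : Y}
    (hx : Relation.TransGen ρ x x') (hy : I x y) : ∃ y', I x' y' ∧ Lt le y y' := by
  induction hx with
  | single hr =>
    obtain ⟨y', h1, h2⟩ := h _ _ _ hr hy
    exact ⟨y', h1, hσ _ _ h2⟩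
  | tail _ hr ih =>
    obtain ⟨y', h1, h2⟩ := ih
    obtain ⟨y'', h3, h4⟩ := h _ _ _ hr h1
    exact ⟨y'', h3, h2.trans hle (hσ _ _ h4)⟩

/-- A cycle at `x` would replace a maximal `y` incident with `x` by a strictly larger one. -/
theorem not_transGen_self [Finite Y] (hle : IsPartialOrder Y le)
    (hσ : ∀ y y', σ y y' → Lt le y y') (hI : ∀ x, ∃ y, I x y)
    (h : ∀ x x' y, ρ x x' → I x y → ∃ y', I x' y' ∧ σ y y') (x : X) :
    ¬ Relation.TransGen ρ x x := by
  intro hx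
  obtain ⟨y, hy, hmin⟩ := (wellFounded_gt_of_finite hle).has_min {y | I x y} (hI x)
  obtain ⟨y', h1, h2⟩ := exists_lt_of_transGen hle hσ h hx hy
  exact hmin y' h1 h2

theorem isPartialOrder_reflTransGen [Finite Y] (hle : IsPartialOrder Y le)
    (hσ : ∀ y y', σ y y' → Lt le y y') (hI : ∀ x, ∃ y, I x y)
    (h : ∀ x x' y, ρ x x' → I x y → ∃ y', I x' y' ∧ σ y y') :
    IsPartialOrder X (Relation.ReflTransGen ρ) where
  refl _ := Relation.ReflTransGen.refl
  trans _ _ _ := Relation.ReflTransGen.trans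
  antisymm x x' h1 h2 := by
    rcases Relation.reflTransGen_iff_eq_or_transGen.mp h1 with h1 | h1
    · exact h1.symm
    rcases Relation.reflTransGen_iff_eq_or_transGen.mp h2 with h2 | h2
    · exact h2
    exact absurd (h1.trans h2) (not_transGen_self hle hσ hI h x)

theorem lt_reflTransGen [Finite Y] (hle : IsPartialOrder Y le)
    (hσ : ∀ y y', σ y y' → Lt le y y') (hI : ∀ x, ∃ y, I x y)
    (h : ∀ x x' y, ρ x x' → I x y → ∃ y', I x' y' ∧ σ y y') {x x' : X} (hx : ρ x x') :
    Lt (Relation.ReflTransGen ρ) x x' := by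
  refine ⟨.single hx, ?_⟩
  rintro rfl
  exact not_transGen_self hle hσ hI h x (.single hx)

end Incidence

/-! ### Radicals of projective covers over `R` and over `Γ`; transfer of directedness. -/

section Radicals

set_option linter.unusedSectionVars false

variable {k : Type w} [Field k] {R : Type u} [Ring R] [Algebra k R] [Module.Finite k R]
  {Γ : Type v} [Ring Γ] [Algebra k Γ] [Module.Finite k Γ] [Module R Γ] [IsScalarTower R Γ Γ]
  {G : Type*} [Group G] [Fintype G] [MulSemiringAction G R] [SkewExt R Γ G]

/-- A lift of the projective cover of a constituent of the simple top of `M` generates `M`. -/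
theorem span_range_eq_top {M : Type*} [AddCommGroup M] [Module R M] [Module Γ M]
    [IsScalarTower R Γ M] {S : Sim Γ} {p : M →ₗ[Γ] S.Mod} (hp : IsTop p) {T : Sim R}
    {φ : cover k T →ₗ[R] M} (hφ : p.restrictScalars R ∘ₗ φ ≠ 0) :
    Submodule.span Γ (LinearMap.range φ : Set M) = ⊤ := by
  by_contra hne
  refine hφ (LinearMap.ext fun t => ?_)
  exact hp.le_ker _ hne (Submodule.subset_span (LinearMap.mem_range_self φ t))

/-- `rad P_S` is generated over `Γ` by the image of `rad P_T`: the quotient by this submodule is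
generated by an image of `T`, hence semisimple over `R` and then over `Γ`. So the factors of `rad
P_S` have constituents among those of `rad P_T`, up to conjugacy. -/
theorem exists_inRad_of_over (hG : (Fintype.card G : k) ≠ 0) {S S' : Sim Γ} {T : Sim R}
    (h : InRad k S S') (hT : Over k S T) : ∃ T', Over k S' T' ∧ InRad k T T' := by
  have := IsArtinianRing.of_finite k R
  obtain ⟨a, ha⟩ := hT.exists_hom G
  have hp := coverMap_isTop k S
  have hpT := coverMap_isTop k T
  obtain ⟨φ, hφ⟩ := cover_lift ((coverMap k S).restrictScalars R) hp.surjective (a ∘ₗ coverMap k T)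
  have hφ0 : (coverMap k S).restrictScalars R ∘ₗ φ ≠ 0 := by
    rw [hφ]
    refine fun h0 => ha (LinearMap.ext fun t => ?_)
    obtain ⟨c, rfl⟩ := hpT.surjective t
    exact LinearMap.congr_fun h0 c
  have hspan := span_range_eq_top hp hφ0
  let U : Submodule R (cover k S) := (LinearMap.ker (coverMap k T)).map φ
  let W : Submodule Γ (cover k S) := Submodule.span Γ (U : Set (cover k S))
  have hU : ∀ x ∈ U, x ∈ LinearMap.ker (coverMap k S) := by
    rintro _ ⟨t, ht, rfl⟩
    have := LinearMap.congr_fun hφ t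
    rw [LinearMap.comp_apply, LinearMap.comp_apply, LinearMap.mem_ker.mp ht, map_zero] at this
    exact this
  have hW : W = LinearMap.ker (coverMap k S) := by
    refine le_antisymm (Submodule.span_le.mpr hU) fun x hx => ?_
    rw [← hp.jacobson_eq] at hx
    let N : Submodule R (cover k S ⧸ W) := LinearMap.range (W.mkQ.restrictScalars R ∘ₗ φ)
    obtain ⟨f, hf⟩ := exists_factor (coverMap k T) hpT.surjective (W.mkQ.restrictScalars R ∘ₗ φ)
      fun t ht => (Submodule.Quotient.mk_eq_zero W).mpr
        (Submodule.subset_span (Submodule.mem_map_of_mem ht))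
    have hN : N = LinearMap.range f := by
      change LinearMap.range _ = _
      rw [← hf, LinearMap.range_comp_of_range_eq_top _ (LinearMap.range_eq_top.mpr hpT.surjective)]
    have : IsSemisimpleModule R N := by rw [hN]; exact IsSemisimpleModule.range f
    have h1 : Submodule.span Γ (N : Set (cover k S ⧸ W)) = ⊤ := by
      have h2 : (N : Set (cover k S ⧸ W)) = W.mkQ '' (LinearMap.range φ : Set (cover k S)) := by
        change Set.range _ = _ '' Set.range _
        rw [← Set.range_comp]; rfl
      rw [h2, Submodule.span_image, hspan, Submodule.map_top, Submodule.range_mkQ]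
    have := isSemisimple_of_span_eq_top (Γ := Γ) G N h1
    have := isSemisimple_of_restrict k R G (Γ := Γ) (M := cover k S ⧸ W) hG
    exact (Submodule.Quotient.mk_eq_zero W).mp (map_jacobson_eq_zero W.mkQ hx)
  obtain ⟨T1, hT1⟩ := exists_under k R S'
  have h1 : Fac k S' W := by
    rw [hW, ← hp.jacobson_eq]; exact h
  let U' : Submodule R W := U.comap (W.subtype.restrictScalars R)
  have hUW : ∀ x ∈ U, x ∈ W := fun x hx => Submodule.subset_span hx
  have hU' : Submodule.span Γ (U' : Set W) = ⊤ := by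
    apply Submodule.map_injective_of_injective W.injective_subtype
    rw [Submodule.map_span, Submodule.map_top, Submodule.range_subtype]
    change Submodule.span Γ _ = Submodule.span Γ _
    congr 1
    ext x
    exact ⟨by rintro ⟨y, hy, rfl⟩; exact hy, fun hx => ⟨⟨x, hUW x hx⟩, hx, rfl⟩⟩
  obtain ⟨T0, hc, hT0⟩ := Fac.of_span_eq_top (G := G) (h1.restrict hT1) U' hU'
  refine ⟨T0, hT1.conj hc, ?_⟩
  have h3 : Fac k T0 U := hT0.of_injective
    (((W.subtype.restrictScalars R) ∘ₗ U'.subtype).codRestrict U fun x => x.2)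
    (fun x y hxy => by
      have h3 : ((x : W) : cover k S) = ((y : W) : cover k S) :=
        congrArg (fun z : U => (z : cover k S)) hxy
      exact Subtype.ext (Subtype.ext h3))
  rw [InRad, hpT.jacobson_eq]
  refine h3.of_surjective (φ.restrict (p := LinearMap.ker (coverMap k T)) (q := U)
    fun x hx => Submodule.mem_map_of_mem hx) ?_
  rintro ⟨_, x, hx, rfl⟩
  exact ⟨⟨x, hx⟩, rfl⟩

/-- `P_T` is a direct summand of `P_S` over `R`, and the inclusion respects radicals because the
radicals over `R` and `Γ` agree. -/
theorem exists_inRad_of_under (hG : (Fintype.card G : k) ≠ 0) {S : Sim Γ} {T T' : Sim R}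
    (h : InRad k T T') (hT : Over k S T) : ∃ S', Over k S' T' ∧ InRad k S S' := by
  have := IsArtinianRing.of_finite k R
  obtain ⟨b, hb⟩ := hT.exists_hom_to G
  have hp := coverMap_isTop k S
  have hpT := coverMap_isTop k T
  set p := (coverMap k S).restrictScalars R
  -- `P_S` is only known to be projective over `Γ`, so the lift of `P_S → S → T` to `P_T` is made
  -- after coinduction and evaluated at `1`.
  obtain ⟨f, hf⟩ := cover_lift (CoInd.map (Γ := Γ) (coverMap k T))
    (CoInd.map_surjective G _ hpT.surjective) (CoInd.hat (b ∘ₗ p))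
  let ψ := CoInd.ev R Γ (cover k T) ∘ₗ f.restrictScalars R
  have hψ : coverMap k T ∘ₗ ψ = b ∘ₗ p := by
    refine LinearMap.ext fun x => ?_
    rw [← CoInd.ev_hat (Γ := Γ) (b ∘ₗ p) x, ← hf]; rfl
  have hψs : Function.Surjective ψ := hpT.surjective_of_comp_ne_zero ψ (by
    rw [hψ]
    refine fun h0 => hb (LinearMap.ext fun s => ?_)
    obtain ⟨c, rfl⟩ := hp.surjective s
    exact LinearMap.congr_fun h0 c)
  obtain ⟨s, hs⟩ := cover_lift ψ hψs LinearMap.id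
  have hsi : Function.Injective s :=
    Function.LeftInverse.injective (g := ψ) (LinearMap.congr_fun hs)
  let K := LinearMap.ker (coverMap k S)
  have hK : ∀ x ∈ LinearMap.ker (coverMap k T), s x ∈ K.restrictScalars R := fun x hx => by
    rw [← hpT.jacobson_eq] at hx
    change s x ∈ (LinearMap.ker (coverMap k S)).restrictScalars R
    rw [← hp.jacobson_eq, restrictScalars_jacobson k R G _ hG]
    exact Module.map_jacobson_le s (Submodule.mem_map_of_mem hx)
  have h1 : Fac k T' (K.restrictScalars R) := by
    rw [InRad, hpT.jacobson_eq] at h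
    exact Fac.of_injective (M := LinearMap.ker (coverMap k T)) h
      (s.restrict hK) fun x y hxy => Subtype.ext (hsi (congrArg Subtype.val hxy))
  have h2 : Fac k T' K := h1
  obtain ⟨S', h3, h4⟩ := h2.exists_over (Γ := Γ) G
  refine ⟨S', h4, ?_⟩
  rw [InRad, hp.jacobson_eq]
  exact h3

/-- A skew group algebra over a directed algebra is directed for some order. -/
theorem exists_isDirected_skew (hG : (Fintype.card G : k) ≠ 0) {le : Sim R → Sim R → Prop}
    (h : IsDirectedAlgebra k le) : ∃ le' : Sim Γ → Sim Γ → Prop, IsDirectedAlgebra k le' := by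
  have := finite_sim k R
  have h1 : ∀ S S' : Sim Γ, ∀ T : Sim R, InRad k S S' → Over k S T →
    ∃ T', Over k S' T' ∧ InRad k T T' := fun _ _ _ => exists_inRad_of_over hG
  have hlt := fun T T' => h.lt_of_inRad (L := T) (T := T')
  exact ⟨_, isDirectedAlgebra_of_inRad
    (isPartialOrder_reflTransGen h.adapted.partialOrder hlt (exists_under k R) h1)
    fun _ _ => lt_reflTransGen h.adapted.partialOrder hlt (exists_under k R) h1⟩

theorem exists_isDirected_of_skew (hG : (Fintype.card G : k) ≠ 0) {le : Sim Γ → Sim Γ → Prop}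
    (h : IsDirectedAlgebra k le) : ∃ le' : Sim R → Sim R → Prop, IsDirectedAlgebra k le' := by
  have := finite_sim k Γ
  have h1 : ∀ T T' : Sim R, ∀ S : Sim Γ, InRad k T T' → Over k S T →
    ∃ S', Over k S' T' ∧ InRad k S S' := fun _ _ _ => exists_inRad_of_under hG
  have hlt := fun S S' => h.lt_of_inRad (L := S) (T := S')
  exact ⟨_, isDirectedAlgebra_of_inRad
    (isPartialOrder_reflTransGen h.adapted.partialOrder hlt (exists_over k Γ G) h1)
    fun _ _ => lt_reflTransGen h.adapted.partialOrder hlt (exists_over k Γ G) h1⟩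

end Radicals

/-! ### Decomposition of semisimple modules. -/

section Semisimple

variable {k : Type w} [Field k] {R : Type u} [Ring R] [Algebra k R] [Module.Finite k R]

theorem exists_equiv_pi_sim (k : Type w) [Field k] {R : Type u} [Ring R] [Algebra k R]
    [Module.Finite k R] (M : Type*) [AddCommGroup M] [Module R M] [Module.Finite R M]
    [IsSemisimpleModule R M] :
    ∃ (n : ℕ) (T : Fin n → Sim R), Nonempty (M ≃ₗ[R] ∀ i, (T i).Mod) := by
  obtain ⟨n, T, a, ha, hker⟩ := exists_pi_top k (R := R) M
  rw [IsSemisimpleModule.jacobson_eq_bot, LinearMap.ker_eq_bot] at hker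
  exact ⟨n, T, ⟨LinearEquiv.ofBijective a ⟨hker, ha⟩⟩⟩

theorem exists_hom_sim_ne_zero {R : Type*} [Ring R] {X : Type*} [AddCommGroup X] [Module R X]
    [IsSemisimpleModule R X] {x : X} (hx : x ≠ 0) :
    ∃ (T : Sim R) (q : X →ₗ[R] T.Mod), q x ≠ 0 := by
  let N := Submodule.span R {x}
  have : Nontrivial N := Submodule.nontrivial_iff_ne_bot.mpr
    fun h => hx (Submodule.span_singleton_eq_bot.mp h)
  obtain ⟨T, p, hp⟩ := exists_ne_zero_simple_quotient (R := R) (M := N)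
  obtain ⟨q, hq⟩ := IsSemisimpleModule.extension_property N.subtype N.injective_subtype p
  refine ⟨T, q, fun h0 => ne_zero_of_surjective p hp (LinearMap.ext fun y => ?_)⟩
  obtain ⟨c, hc⟩ := Submodule.mem_span_singleton.mp y.2
  rw [← hq, LinearMap.comp_apply, Submodule.subtype_apply, ← hc, map_smul, h0, smul_zero]
  rfl

theorem isSemisimpleModule_prod {R : Type*} [Ring R] {X Y : Type*} [AddCommGroup X] [Module R X]
    [AddCommGroup Y] [Module R Y] [IsSemisimpleModule R X] [IsSemisimpleModule R Y] :
    IsSemisimpleModule R (X × Y) := by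
  have h1 := IsSemisimpleModule.range (LinearMap.inl R X Y)
  have h2 := IsSemisimpleModule.range (LinearMap.inr R X Y)
  have h3 := IsSemisimpleModule.sup h1 h2
  rw [LinearMap.sup_range_inl_inr] at h3
  exact IsSemisimpleModule.congr (Submodule.topEquiv (R := R) (M := X × Y)).symm

end Semisimple

/-! ### Induction from a subalgebra, and the tops of induced modules. -/

section Induction

set_option linter.unusedSectionVars false

variable {k : Type w} [Field k] {A : Type u} [Ring A] [Algebra k A]

universe ω m

/-- The map `η : V → I` is universal among `B`-linear maps from `V` to `A`-modules. -/
structure IsInd.{ω', u', w', v', m'} {k : Type w'} [Field k] {A : Type u'} [Ring A] [Algebra k A]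
    (B : Subalgebra k A) {V : Type v'} {I : Type m'} [AddCommGroup V] [Module B V]
    [AddCommGroup I] [Module A I] (η : V →ₗ[B] I) : Prop where
  span : Submodule.span A (LinearMap.range η : Set I) = ⊤
  lift : ∀ (X : Type ω') [AddCommGroup X] [Module A X] (f : V →ₗ[B] X),
    ∃ F : I →ₗ[A] X, ∀ v, F (η v) = f v

variable {B : Subalgebra k A} {V I : Type*} [AddCommGroup V] [Module B V]
  [AddCommGroup I] [Module A I]

theorem IsInd.hom_ext {η : V →ₗ[B] I} (h : IsInd.{ω} B η) {X : Type*} [AddCommGroup X]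
    [Module A X] {F F' : I →ₗ[A] X} (hF : ∀ v, F (η v) = F' (η v)) : F = F' := by
  refine LinearMap.ext fun x => LinearMap.eqOn_span (s := (LinearMap.range η : Set I)) ?_
    (h.span ▸ Submodule.mem_top : x ∈ _)
  rintro _ ⟨v, rfl⟩
  exact hF v

/-- The universal map into the induced module. -/
def Induced.η (B : Subalgebra k A) (V : Type*) [AddCommGroup V] [Module k V] [Module B V]
    [IsScalarTower k B V] : V →ₗ[B] Induced B V where
  toFun v := Submodule.Quotient.mk (1 ⊗ₜ v)
  map_add' x y := by rw [TensorProduct.tmul_add, Submodule.Quotient.mk_add]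
  map_smul' b v := by
    change _ = (b : A) • (Submodule.Quotient.mk (1 ⊗ₜ v) : Induced B V)
    rw [← Submodule.Quotient.mk_smul, TensorProduct.smul_tmul', eq_comm, Submodule.Quotient.eq]
    exact Submodule.subset_span ⟨1, b, v, by rw [one_mul, smul_eq_mul, mul_one]⟩

theorem isInd_induced (B : Subalgebra k A) (V : Type*) [AddCommGroup V] [Module k V] [Module B V]
    [IsScalarTower k B V] : IsInd.{ω} B (Induced.η B V) := by
  refine ⟨?_, fun X _ _ f => ?_⟩
  · rw [eq_top_iff]
    rintro x -
    obtain ⟨t, rfl⟩ := Submodule.Quotient.mk_surjective _ x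
    induction t using TensorProduct.induction_on with
    | zero => exact Submodule.zero_mem _
    | add x y hx hy => rw [Submodule.Quotient.mk_add]; exact Submodule.add_mem _ hx hy
    | tmul a v =>
      have h1 : (Submodule.Quotient.mk (a ⊗ₜ v) : Induced B V) = a • Induced.η B V v := by
        change _ = a • (Submodule.Quotient.mk (1 ⊗ₜ v) : Induced B V)
        rw [← Submodule.Quotient.mk_smul, TensorProduct.smul_tmul', smul_eq_mul, mul_one]
      rw [h1]
      exact Submodule.smul_mem _ _ (Submodule.subset_span (LinearMap.mem_range_self _ v))
  · let _ : Module k X := Module.compHom X (algebraMap k A)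
    have : IsScalarTower k A X := ⟨fun c a x => by
      change (c • a) • x = algebraMap k A c • a • x
      rw [smul_smul, Algebra.smul_def]⟩
    have : SMulCommClass A k X := IsScalarTower.to_smulCommClass'
    let g : A →ₗ[A] V →ₗ[k] X := LinearMap.toSpanSingleton A (V →ₗ[k] X) (f.restrictScalars k)
    let F : A ⊗[k] V →ₗ[A] X := TensorProduct.AlgebraTensorModule.lift g
    have hF : ∀ a v, F (a ⊗ₜ v) = a • f v := fun a v => rfl
    refine ⟨Submodule.liftQ _ F (Submodule.span_le.mpr ?_), fun v => ?_⟩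
    · rintro _ ⟨a, b, v, rfl⟩
      change F _ = 0
      rw [map_sub, hF, hF, map_smul, mul_smul, sub_eq_zero]
      rfl
    · exact (hF 1 v).trans (one_smul A _)

/-- The map `ε : V → T` is universal among `B`-linear maps from `V` to semisimple
`A`-modules. -/
structure IsTopInd.{ω', u', w', v', m'} {k : Type w'} [Field k] {A : Type u'} [Ring A] [Algebra k A]
    (B : Subalgebra k A) {V : Type v'} {T : Type m'} [AddCommGroup V] [Module B V]
    [AddCommGroup T] [Module A T] (ε : V →ₗ[B] T) : Prop where
  ne_zero : ε ≠ 0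
  lift : ∀ (X : Type ω') [AddCommGroup X] [Module A X] [IsSemisimpleModule A X] (f : V →ₗ[B] X),
    ∃ F : T →ₗ[A] X, ∀ v, F (ε v) = f v

/-- A map from `I` to a semisimple module kills the radical of `I`, which is the kernel of `p`. -/
theorem IsInd.isTopInd {η : V →ₗ[B] I} (h : IsInd.{ω} B η) {T : Type*} [AddCommGroup T]
    [Module A T] [IsSimpleModule A T] {p : I →ₗ[A] T} (hp : IsTop p) :
    IsTopInd.{ω} B (p.restrictScalars B ∘ₗ η) := by
  refine ⟨fun h0 => hp.ne_zero (h.hom_ext (LinearMap.congr_fun h0)), fun X _ _ _ f => ?_⟩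
  obtain ⟨F, hF⟩ := h.lift X f
  obtain ⟨F', hF'⟩ := exists_factor p hp.surjective F fun x hx => by
    rw [← hp.jacobson_eq] at hx
    exact map_jacobson_eq_zero F hx
  exact ⟨F', fun v => by rw [← hF, ← hF']; rfl⟩

theorem IsTopInd.eq_of_hom {V : Type*} [AddCommGroup V] [Module B V] {T T' : Sim A}
    {ε : V →ₗ[B] T.Mod} (h : IsTopInd.{u} B ε) (f : V →ₗ[B] T'.Mod) (hf : f ≠ 0) : T' = T := by
  obtain ⟨F, hF⟩ := h.lift _ f
  refine (Sim.nonzero_hom_eq F ?_).symm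
  rintro rfl
  exact hf (LinearMap.ext fun v => (hF v).symm)

/-- A submodule that is semisimple over `B` and generates a semisimple `A`-module is its
`B`-socle. -/
def Star.{ω', u', w'} {k : Type w'} [Field k] {A : Type u'} [Ring A] [Algebra k A]
    (B : Subalgebra k A) : Prop :=
  ∀ (X : Type ω') [AddCommGroup X] [Module A X] [Module.Finite A X] [IsSemisimpleModule A X]
    (V W : Submodule B X), IsSemisimpleModule B V → IsSemisimpleModule B W →
    Submodule.span A (V : Set X) = ⊤ → W ≤ V

variable [Module.Finite k A]

theorem finite_over_subalgebra (B : Subalgebra k A) (X : Type*) [AddCommGroup X] [Module A X]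
    [Module.Finite A X] : Module.Finite B X :=
  have : Module.Finite B A := Module.Finite.of_restrictScalars_finite k B A
  Module.Finite.trans A X

/-- Writing `V` as a sum of simple modules `L a`, universality gives an epimorphism from the sum of
the `i (L a)` onto `X`. A map from `L'` to `X` extends to `i L'` and lifts through it. By
injectivity of `i` and Schur's lemma each component of the lift is zero or a scalar, so the map
takes values in `V`. -/
theorem star_of_isTopInd [IsAlgClosed k] {i : Sim B → Sim A} (hi : Function.Injective i)
    {ε : ∀ L : Sim B, L.Mod →ₗ[B] (i L).Mod} (hε : ∀ L, IsTopInd.{ω} B (ε L)) : Star.{ω} B := by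
  intro X _ _ _ _ V W hV hW hspan
  have hXB := finite_over_subalgebra B X
  have hVf := finite_submodule_of_field k V
  have hWf := finite_submodule_of_field k W
  obtain ⟨n, L, ⟨e⟩⟩ := exists_equiv_pi_sim k (R := B) V
  let s : ∀ a, (L a).Mod →ₗ[B] V := fun a =>
    e.symm.toLinearMap ∘ₗ LinearMap.single B (fun a => (L a).Mod) a
  have hs : ∀ v : V, ∑ a, s a (e v a) = v := fun v => by
    apply e.injective
    rw [map_sum]
    simp only [s, LinearMap.comp_apply, LinearEquiv.coe_coe, e.apply_symm_apply]
    exact Finset.univ_sum_single (e v)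
  choose H hH using fun a => (hε (L a)).lift X (V.subtype ∘ₗ s a)
  let F : (∀ a, (i (L a)).Mod) →ₗ[A] X := ∑ a, H a ∘ₗ LinearMap.proj a
  have hFa : ∀ x, F x = ∑ a, H a (x a) := fun x => by
    simp only [F, LinearMap.sum_apply]; rfl
  have hF : Function.Surjective F := by
    rw [← LinearMap.range_eq_top, eq_top_iff, ← hspan, Submodule.span_le]
    intro v hv
    refine ⟨fun a => ε (L a) (e ⟨v, hv⟩ a), ?_⟩
    rw [hFa]
    simp only [hH]
    have := congrArg V.subtype (hs ⟨v, hv⟩)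
    rw [map_sum] at this
    exact this
  have key : ∀ (L' : Sim B) (h : L'.Mod →ₗ[B] X) (l : L'.Mod), h l ∈ V := by
    intro L' h l
    obtain ⟨H', hH'⟩ := (hε L').lift X h
    obtain ⟨K, hK⟩ := IsSemisimpleModule.lifting_property F hF H'
    rw [← hH', ← hK, LinearMap.comp_apply, hFa]
    refine V.sum_mem fun a _ => ?_
    let g : (i L').Mod →ₗ[A] (i (L a)).Mod := LinearMap.proj a ∘ₗ K
    change H a (g (ε L' l)) ∈ V
    by_cases hg : g = 0
    · rw [hg, LinearMap.zero_apply, map_zero]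
      exact V.zero_mem
    · have hL : L' = L a := hi (Sim.nonzero_hom_eq g hg)
      clear_value g
      subst hL
      obtain ⟨c, rfl⟩ := (IsSimpleModule.algebraMap_end_bijective_of_isAlgClosed (A := A)
        (V := (i (L a)).Mod) k).2 g
      have h1 : algebraMap k (Module.End A (i (L a)).Mod) c (ε (L a) l)
          = ε (L a) (algebraMap k B c • l) := by
        rw [map_smul, Module.algebraMap_end_apply, ← algebraMap_smul A c]
        rfl
      rw [h1, hH]
      exact (s a _).2
  obtain ⟨m, N, ⟨e'⟩⟩ := exists_equiv_pi_sim k (R := B) W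
  intro x hx
  have h2 : ∑ a, e'.symm (Pi.single a (e' ⟨x, hx⟩ a)) = ⟨x, hx⟩ := by
    rw [← map_sum, Finset.univ_sum_single, e'.symm_apply_apply]
  have h3 := congrArg W.subtype h2
  rw [map_sum] at h3
  change _ = x at h3
  rw [← h3]
  exact V.sum_mem fun a _ => key (N a) (W.subtype ∘ₗ e'.symm.toLinearMap ∘ₗ
    LinearMap.single B (fun a => (N a).Mod) a) _

/-- Both images are semisimple and generate the simple module `T`, so each contains the other. -/
theorem Star.eq_of_hom (h : Star.{u} B) {L L' : Sim B} {T : Sim A} (f : L.Mod →ₗ[B] T.Mod)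
    (f' : L'.Mod →ₗ[B] T.Mod) (hf : f ≠ 0) (hf' : f' ≠ 0) : L = L' := by
  have hspan : ∀ {L : Sim B} (f : L.Mod →ₗ[B] T.Mod), f ≠ 0 →
      Submodule.span A (LinearMap.range f : Set T.Mod) = ⊤ := fun f hf =>
    (eq_bot_or_eq_top _).resolve_left fun hb => hf (LinearMap.ext fun x => by
      have := Submodule.subset_span (R := A) (LinearMap.mem_range_self f x)
      rw [hb] at this
      exact this)
  have h1 : LinearMap.range f = LinearMap.range f' :=
    le_antisymm (h _ _ _ (IsSemisimpleModule.range f') (IsSemisimpleModule.range f) (hspan f' hf'))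
      (h _ _ _ (IsSemisimpleModule.range f) (IsSemisimpleModule.range f') (hspan f hf))
  have e1 := LinearEquiv.ofInjective f (LinearMap.injective_of_ne_zero hf)
  have e2 := LinearEquiv.ofInjective f' (LinearMap.injective_of_ne_zero hf')
  exact Sim.eq_of_equiv ⟨e1.trans ((LinearEquiv.ofEq _ _ h1).trans e2.symm)⟩

/-- Given a second maximal submodule, `I` maps onto `T × T'` and the diagonal image of `L`
generates. By `Star` it contains the image of `L` in the first factor alone, but its elements with
zero second coordinate are zero because `L → T'` is injective. -/
theorem Star.isTop (h : Star.{u} B) {L : Sim B} {I : Type*} [AddCommGroup I] [Module A I]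
    [Module.Finite A I] {η : L.Mod →ₗ[B] I} (hη : IsInd.{u} B η) {T : Sim A} (p : I →ₗ[A] T.Mod)
    (hp : Function.Surjective p) : IsTop p := by
  refine ⟨hp, fun N hN => ?_⟩
  by_contra hle
  have : Nontrivial (I ⧸ N) := Submodule.Quotient.nontrivial_iff.mpr hN
  obtain ⟨T', q, hq⟩ := exists_ne_zero_simple_quotient (R := A) (M := I ⧸ N)
  let p' := q ∘ₗ N.mkQ
  have hp' : Function.Surjective p' := hq.comp N.mkQ_surjective
  have hsup : LinearMap.ker p ⊔ LinearMap.ker p' = ⊤ := by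
    have h1 : IsCoatom (LinearMap.ker p) := by
      rw [← isSimpleModule_iff_isCoatom]
      exact IsSimpleModule.congr (p.quotKerEquivOfSurjective hp)
    by_contra hne
    have h2 := (h1.le_iff.mp (le_sup_left : _ ≤ LinearMap.ker p ⊔ LinearMap.ker p')).resolve_left hne
    refine hle fun x hx => ?_
    rw [← h2]
    refine Submodule.mem_sup_right ?_
    change q (N.mkQ x) = 0
    have h3 : N.mkQ x = 0 := (Submodule.Quotient.mk_eq_zero N).mpr hx
    rw [h3, map_zero]
  have hr : LinearMap.range (p.prod p') = ⊤ := by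
    rw [LinearMap.range_prod_eq hsup, LinearMap.range_eq_top.mpr hp, LinearMap.range_eq_top.mpr hp',
      Submodule.prod_top]
  have hss : IsSemisimpleModule A (T.Mod × T'.Mod) := isSemisimpleModule_prod
  let f : L.Mod →ₗ[B] T.Mod × T'.Mod := (p.prod p').restrictScalars B ∘ₗ η
  let f' : L.Mod →ₗ[B] T.Mod × T'.Mod :=
    LinearMap.inl B T.Mod T'.Mod ∘ₗ p.restrictScalars B ∘ₗ η
  have hspan : Submodule.span A (LinearMap.range f : Set (T.Mod × T'.Mod)) = ⊤ := by
    have h2 : (LinearMap.range f : Set (T.Mod × T'.Mod))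
        = (p.prod p') '' (LinearMap.range η : Set I) := by
      change Set.range _ = _ '' Set.range _
      rw [← Set.range_comp]; rfl
    rw [h2, Submodule.span_image, hη.span, Submodule.map_top, hr]
  have hle' : LinearMap.range f' ≤ LinearMap.range f :=
    h _ _ _ (IsSemisimpleModule.range f) (IsSemisimpleModule.range f') hspan
  have hne' : p'.restrictScalars B ∘ₗ η ≠ 0 := fun h0 =>
    ne_zero_of_surjective p' hp' (hη.hom_ext (LinearMap.congr_fun h0))
  refine ne_zero_of_surjective p hp (hη.hom_ext fun l => ?_)
  obtain ⟨l', hl'⟩ := hle' (LinearMap.mem_range_self f' l)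
  have h3 : p (η l') = p (η l) := congrArg Prod.fst hl'
  have h4 : p' (η l') = 0 := congrArg Prod.snd hl'
  have h5 : l' = 0 := (LinearMap.injective_of_ne_zero hne') (by rw [map_zero]; exact h4)
  rw [← h3, h5, map_zero, map_zero]; rfl

/-- The matching sends `L` to the top of its induced module. It is injective because two simple
submodules of one `T` are isomorphic, and surjective because every `T` contains a simple `B`-module.
-/
theorem Star.exists_equiv (h : Star.{u} B) {Δ : Sim A → Type*} [∀ T, AddCommGroup (Δ T)]
    [∀ T, Module A (Δ T)] (hne : ∀ L : Sim B, Nontrivial (Induced B L.Mod))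
    (htop : ∀ (L : Sim B) (T : Sim A) (p : Induced B L.Mod →ₗ[A] T.Mod), IsTop p →
      Nonempty (Induced B L.Mod ≃ₗ[A] Δ T)) :
    ∃ i : Sim B ≃ Sim A, ∀ L : Sim B, Nonempty (Induced B L.Mod ≃ₗ[A] Δ (i L)) := by
  have hη := fun L : Sim B => isInd_induced B L.Mod
  have hex := fun L : Sim B => exists_ne_zero_simple_quotient (R := A) (M := Induced B L.Mod)
  choose i p hp using hex
  have hpt := fun L => h.isTop (hη L) (p L) (hp L)
  have hε := fun L => (hη L).isTopInd (hpt L)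
  have hbij : Function.Bijective i := by
    constructor
    · intro L L' hLL
      have h1 := (hε L').ne_zero
      have h2 := (hε L).ne_zero
      revert h1
      generalize (p L').restrictScalars B ∘ₗ Induced.η B L'.Mod = f
      revert f
      rw [← hLL]
      exact fun f hf => h.eq_of_hom _ f h2 hf
    · intro T
      have := IsArtinianRing.of_finite k B
      have := IsSimpleModule.nontrivial A T.Mod
      obtain ⟨N, hN⟩ := exists_simple_submodule (R := B) (M := T.Mod)
      obtain ⟨L, ⟨e⟩⟩ := Sim.exists_equiv (A := B) N
      refine ⟨L, ((hε L).eq_of_hom (N.subtype ∘ₗ e.symm.toLinearMap) fun h0 => ?_).symm⟩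
      have := IsSimpleModule.nontrivial B N
      obtain ⟨y, hy⟩ := exists_ne (0 : N)
      have := LinearMap.congr_fun h0 (e y)
      rw [LinearMap.comp_apply, LinearEquiv.coe_coe, e.symm_apply_apply] at this
      exact hy (Subtype.ext this)
  exact ⟨Equiv.ofBijective i hbij, fun L => htop L (i L) (p L) (hpt L)⟩

theorem exists_isTopInd {le : Sim A → Sim A → Prop} (hle : IsPartialOrder (Sim A) le) {L : Sim B}
    {T : Sim A} (e : Induced B L.Mod ≃ₗ[A] Standard k le T) :
    ∃ ε : L.Mod →ₗ[B] T.Mod, IsTopInd.{ω} B ε := by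
  obtain ⟨q, -, hq⟩ := exists_isTop_standard (k := k) hle T
  exact ⟨_, (isInd_induced B L.Mod).isTopInd (hq.of_equiv e)⟩

end Induction

/-! ### Finite sums of relatively projective modules. -/

section RelStdPi

variable {k : Type w} [Field k] {R : Type u} [Ring R] [Algebra k R] [Module.Finite k R]

universe ω

theorem RelStd.pi {O C : Set (Sim R)} {n : ℕ} {M : Fin n → Type*} [∀ a, AddCommGroup (M a)]
    [∀ a, Module R (M a)] (hM : ∀ a, RelStd.{ω} k O C (M a)) : RelStd.{ω} k O C (∀ a, M a) := by
  refine ⟨fun T hT => ?_, fun T f hf => ?_, fun X _ _ K hX f => ?_⟩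
  · obtain ⟨a, ha⟩ := hT.pi
    exact (hM a).fac T ha
  · obtain ⟨a, ha⟩ : ∃ a, f ∘ₗ LinearMap.single R M a ≠ 0 := by
      by_contra! hall
      exact hf (LinearMap.pi_ext' fun a => by rw [hall, LinearMap.zero_comp])
    exact (hM a).top T _ ha
  · choose h hh using fun a => (hM a).lift_mkQ X K hX (f ∘ₗ LinearMap.single R M a)
    refine ⟨∑ a, h a ∘ₗ LinearMap.proj a, LinearMap.pi_ext' fun a => ?_⟩
    rw [← hh a, LinearMap.comp_assoc]
    congr 1
    ext x
    rw [LinearMap.comp_apply, LinearMap.sum_apply, Finset.sum_eq_single a]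
    · rw [LinearMap.comp_apply, LinearMap.proj_apply, LinearMap.single_apply, Pi.single_eq_same]
    · intro b _ hb
      rw [LinearMap.comp_apply, LinearMap.proj_apply, LinearMap.single_apply,
        Pi.single_eq_of_ne hb, map_zero]
    · exact fun h0 => absurd (Finset.mem_univ a) h0

end RelStdPi

/-! ### A skew group ring with the skew group ring of a stable subalgebra. -/

section Pairs

set_option linter.unusedSectionVars false

universe ω

variable {k : Type w} [Field k] {A : Type u} [Ring A] [Algebra k A] [Module.Finite k A]
  {Γ : Type v} [Ring Γ] [Algebra k Γ] [Module.Finite k Γ] [Module A Γ] [IsScalarTower A Γ Γ]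
  {G : Type*} [Group G] [Fintype G] [MulSemiringAction G A] [SkewExt A Γ G]
  {B : Subalgebra k A} {D : Subalgebra k Γ} [MulSemiringAction G B] [Module B D]
  [IsScalarTower B D D] [SkewExt B D G]

/-- The subalgebra `D` of the skew group ring is the skew group ring of the subalgebra `B`. -/
class SkewPair {k : Type*} [Field k] {A : Type*} [Ring A] [Algebra k A]
    {Γ : Type*} [Ring Γ] [Algebra k Γ] [Module A Γ]
    (G : Type*) [Group G] [Fintype G] [MulSemiringAction G A] [SkewExt A Γ G]
    (B : Subalgebra k A) (D : Subalgebra k Γ) [MulSemiringAction G B] [Module B D]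
    [SkewExt B D G] : Prop where
  coe_smul : ∀ (b : B) (x : D), ((b • x : D) : Γ) = (b : A) • (x : Γ)
  coe_u : ∀ g : G, (uu B D g : Γ) = uu A Γ g
  coe_c : ∀ x : D, (cc B D G x : A) = cc A Γ G (x : Γ)
  coe_act : ∀ (g : G) (b : B), ((g • b : B) : A) = g • (b : A)

variable [hP : SkewPair G B D]

variable {X : Type*} [AddCommGroup X] [Module A X] [Module Γ X] [IsScalarTower A Γ X]

theorem SkewPair.isScalarTower (G : Type*) [Group G] [Fintype G] [MulSemiringAction G A]
    [SkewExt A Γ G] (B : Subalgebra k A) (D : Subalgebra k Γ) [MulSemiringAction G B] [Module B D]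
    [SkewExt B D G] [hP : SkewPair G B D] (X : Type*) [AddCommGroup X] [Module A X] [Module Γ X]
    [IsScalarTower A Γ X] : IsScalarTower B D X :=
  ⟨fun b d x => by
    change ((b • d : D) : Γ) • x = (b : A) • (d : Γ) • x
    rw [hP.coe_smul, smul_assoc]⟩

theorem SkewPair.u_smul (g : G) (x : X) : uu B D g • x = uu A Γ g • x := by
  change ((uu B D g : D) : Γ) • x = _
  rw [hP.coe_u]

variable {V : Type*} [AddCommGroup V] [Module B V] [Module D V] [IsScalarTower B D V]

variable (G) in
/-- The map `s ↦ (y ↦ ∑ c (y u_g⁻¹) f (u_g s))` into the coinduced module. -/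
def coindLift {Y : Type*} [AddCommGroup Y] [Module A Y] (f : V →ₗ[B] Y) : V →ₗ[D] CoInd A Γ Y :=
  have := SkewPair.isScalarTower G B D (CoInd A Γ Y)
  have hc : ∀ (g : G) (y : Γ) (a : A), cc A Γ G (a • y * uu A Γ g⁻¹)
      = a * cc A Γ G (y * uu A Γ g⁻¹) := fun g y a => by
    rw [smul_mul_assoc, map_smul, smul_eq_mul]
  linearOfStable (R := B) (Γ := D) (G := G)
    { toFun := fun v => show Γ →ₗ[A] Y from
        { toFun := fun y => ∑ g : G, cc A Γ G (y * uu A Γ g⁻¹) • f (uu B D g • v)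
          map_add' := fun y z => by
            simp only [add_mul, map_add, add_smul, Finset.sum_add_distrib]
          map_smul' := fun a y => by
            simp only [hc, RingHom.id_apply, Finset.smul_sum, mul_smul] }
      map_add' := fun v v' => CoInd.ext fun y => by
        change (∑ g : G, (_ : Y)) = (∑ g : G, (_ : Y)) + (∑ g : G, (_ : Y))
        simp only [smul_add, map_add, Finset.sum_add_distrib]
      map_smul' := fun b v => CoInd.ext fun y => by
        change (∑ g : G, _) = (∑ g : G, cc A Γ G (y * ((b : A) • (1 : Γ)) * _) • _)
        refine Finset.sum_congr rfl fun g _ => ?_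
        have h1 : ((b : A) • (1 : Γ)) * uu A Γ g⁻¹ = uu A Γ g⁻¹ * ((g • (b : A)) • (1 : Γ)) := by
          rw [SkewExt.u_mul_smul_one, inv_smul_smul, smul_mul_assoc, one_mul]
        rw [mul_assoc, h1, ← mul_assoc, cc_mul_smul_one, uu_smul_smul, map_smul, mul_smul,
          ← hP.coe_act]
        rfl }
    fun h v => CoInd.ext fun y => by
      rw [SkewPair.u_smul]
      change (∑ g : G, _) = (∑ g : G, cc A Γ G (y * uu A Γ h * _) • _)
      refine Fintype.sum_equiv (Equiv.mulRight h) _ _ fun g => ?_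
      have h1 : y * uu A Γ h * uu A Γ (g * h)⁻¹ = y * uu A Γ g⁻¹ := by
        rw [mul_assoc, ← map_mul, mul_inv_rev, mul_inv_cancel_left]
      have h2 : uu B D (g * h) • v = uu B D g • uu B D h • v := by rw [map_mul, mul_smul]
      rw [Equiv.coe_mulRight, h1, h2]

theorem ev_coindLift {Y : Type*} [AddCommGroup Y] [Module A Y] (f : V →ₗ[B] Y) (v : V) :
    CoInd.ev A Γ Y (coindLift G (D := D) f v) = f v := by
  classical
  change (∑ g : G, cc A Γ G (1 * uu A Γ g⁻¹) • f (uu B D g • v)) = f v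
  rw [Finset.sum_eq_single 1]
  · rw [one_mul, cc_uu, inv_one, if_pos rfl, one_smul, map_one, one_smul]
  · intro g _ hg
    rw [one_mul, cc_uu, if_neg (by rwa [inv_eq_one]), zero_smul]
  · exact fun h0 => absurd (Finset.mem_univ _) h0

/-- The units `u_g` lie in `D`, so the `A`-span of a `D`-stable set is already stable under `Γ`. -/
theorem SkewPair.span_eq_top (G : Type*) [Group G] [Fintype G] [MulSemiringAction G A]
    [SkewExt A Γ G] [MulSemiringAction G B] [SkewExt B D G] [hP : SkewPair G B D] (U : Set X)
    (hU : ∀ (d : D), ∀ x ∈ U, d • x ∈ U) (h : Submodule.span Γ U = ⊤) :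
    Submodule.span A U = ⊤ := by
  have hst : ∀ g : G, ∀ m ∈ Submodule.span A U, uu A Γ g • m ∈ Submodule.span A U := by
    intro g m hm
    induction hm using Submodule.span_induction with
    | mem x hx =>
      rw [← SkewPair.u_smul (B := B) (D := D)]
      exact Submodule.subset_span (hU _ x hx)
    | zero => rw [smul_zero]; exact Submodule.zero_mem _
    | add x y _ _ hx hy => rw [smul_add]; exact Submodule.add_mem _ hx hy
    | smul a x _ hx => rw [uu_smul_smul]; exact Submodule.smul_mem _ _ hx
  have h1 : Submodule.span Γ U ≤ submoduleOfStable _ hst :=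
    Submodule.span_le.mpr fun x hx => Submodule.subset_span hx
  rw [h] at h1
  exact eq_top_iff.mpr fun x _ => h1 Submodule.mem_top

/-- The restriction of an induced module is induced from the restriction. -/
theorem IsInd.restrict (G : Type*) [Group G] [Fintype G] [MulSemiringAction G A]
    [SkewExt A Γ G] [MulSemiringAction G B] [SkewExt B D G] [SkewPair G B D]
    {η : V →ₗ[D] X} {η' : V →ₗ[B] X} (h : IsInd.{max v ω} D η)
    (hη : ∀ v, η' v = η v) : IsInd.{ω} B η' := by
  have := SkewPair.isScalarTower G B D X
  refine ⟨?_, fun Y _ _ f => ?_⟩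
  · have h1 : (LinearMap.range η' : Set X) = LinearMap.range η := by
      ext x; exact exists_congr fun v => by rw [hη]
    rw [h1]
    exact SkewPair.span_eq_top (D := D) (B := B) G _
      (fun d x hx => (LinearMap.range η).smul_mem d hx) h.span
  · obtain ⟨F, hF⟩ := h.lift (CoInd A Γ Y) (coindLift G f)
    refine ⟨CoInd.ev A Γ Y ∘ₗ F.restrictScalars A, fun v => ?_⟩
    rw [hη, LinearMap.comp_apply, LinearMap.restrictScalars_apply, hF, ev_coindLift]

theorem Star.skew (G : Type*) [Group G] [Fintype G] [MulSemiringAction G A]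
    [SkewExt A Γ G] [MulSemiringAction G B] [SkewExt B D G] [SkewPair G B D]
    (h : Star.{ω} B) : Star.{ω} D := by
  intro X _ _ _ _ V W hV hW hspan
  have := IsArtinianRing.of_finite k A
  have := IsArtinianRing.of_finite k B
  let _ : Module A X := Module.compHom X (RingHom.smulOneHom : A →+* Γ)
  have : IsScalarTower A Γ X := ⟨fun r y x => by
    change (r • y) • x = (r • (1 : Γ)) • y • x
    rw [smul_smul, smul_mul_assoc, one_mul]⟩
  have := SkewPair.isScalarTower G B D X
  have := finite_restrict Γ G X (R := A)
  have := isSemisimple_restrict (M := X) A Γ G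
  have h1 : IsSemisimpleModule B (V.restrictScalars B) := isSemisimple_restrict (M := V) B D G
  have h2 : IsSemisimpleModule B (W.restrictScalars B) := isSemisimple_restrict (M := W) B D G
  exact h X (V.restrictScalars B) (W.restrictScalars B) h1 h2
    (SkewPair.span_eq_top (D := D) (B := B) G _ (fun d x hx => V.smul_mem d hx) hspan)

/-- Apply `Star` over `D` to the coinduced module and the `D`-submodules generated by the copies of
`V` and `W`; these are semisimple by Clifford and Maschke. Evaluation at `1` brings the inclusion
back to `X`. -/
theorem Star.of_skew (hG : (Fintype.card G : k) ≠ 0) (h : Star.{max v ω} D) : Star.{ω} B := by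
  intro X _ _ _ _ V W hV hW hspan
  let Y := CoInd A Γ X
  have := SkewPair.isScalarTower G B D Y
  let ι := CoInd.ι A Γ X G
  have hspanι : Submodule.span Γ (LinearMap.range ι : Set Y) = ⊤ := CoInd.span_ι
  have : Module.Finite Γ Y := CoInd.finite G
  have : IsSemisimpleModule A (LinearMap.range ι) := IsSemisimpleModule.range ι
  have : IsSemisimpleModule A Y := isSemisimple_of_span_eq_top (Γ := Γ) G _ hspanι
  have : IsSemisimpleModule Γ Y := isSemisimple_of_restrict k A G hG
  let up' : Submodule B X → Submodule D Y := fun U => Submodule.span D (U.map (ι.restrictScalars B))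
  have hss : ∀ U : Submodule B X, IsSemisimpleModule B U → IsSemisimpleModule D (up' U) := by
    intro U hU
    let N : Submodule B (up' U) := (U.map (ι.restrictScalars B)).comap
      ((up' U).subtype.restrictScalars B)
    have hmem : ∀ x ∈ U, ι x ∈ up' U := fun x hx =>
      Submodule.subset_span (Submodule.mem_map_of_mem (f := ι.restrictScalars B) hx)
    let f : U →ₗ[B] up' U :=
      { toFun := fun x => ⟨ι x, hmem x x.2⟩
        map_add' := fun x y => Subtype.ext (map_add ι _ _)
        map_smul' := fun b x => Subtype.ext (map_smul (ι.restrictScalars B) b (x : X)) }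
    have hN : IsSemisimpleModule B (LinearMap.range f) := IsSemisimpleModule.range f
    have hsp : Submodule.span D (LinearMap.range f : Set (up' U)) = ⊤ := by
      apply Submodule.map_injective_of_injective (up' U).injective_subtype
      rw [Submodule.map_span, Submodule.map_top, Submodule.range_subtype]
      change Submodule.span D _ = Submodule.span D _
      congr 1
      ext x
      constructor
      · rintro ⟨_, ⟨y, rfl⟩, rfl⟩
        exact ⟨y, y.2, rfl⟩
      · rintro ⟨y, hy, rfl⟩
        exact ⟨_, ⟨⟨y, hy⟩, rfl⟩, rfl⟩
    have := isSemisimple_of_span_eq_top (Γ := D) G _ hsp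
    exact isSemisimple_of_restrict k B G hG
  have htop : Submodule.span Γ (up' V : Set Y) = ⊤ := by
    rw [eq_top_iff, ← hspanι, Submodule.span_le]
    rintro _ ⟨x, rfl⟩
    have hx : x ∈ Submodule.span A (V : Set X) := hspan ▸ Submodule.mem_top
    induction hx using Submodule.span_induction with
    | mem x hx =>
      exact Submodule.subset_span (Submodule.subset_span
        (Submodule.mem_map_of_mem (f := ι.restrictScalars B) hx))
    | zero => rw [map_zero]; exact Submodule.zero_mem _
    | add x y _ _ hx hy => rw [map_add]; exact Submodule.add_mem _ hx hy
    | smul a x _ hx =>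
      rw [map_smul, CoInd.restrict_smul]
      exact Submodule.smul_mem _ _ hx
  have hle := h Y (up' V) (up' W) (hss V hV) (hss W hW) htop
  intro x hx
  have h1 : ι x ∈ up' V := hle (Submodule.subset_span
    (Submodule.mem_map_of_mem (f := ι.restrictScalars B) hx))
  -- Coefficients of elements of `D` lie in `B`; quantifying over all `d` makes the claim stable
  -- under the action of `D`.
  have h2 : ∀ y ∈ up' V, ∀ d : D, y (d : Γ) ∈ V := by
    intro y hy
    induction hy using Submodule.span_induction with
    | mem y hy =>
      obtain ⟨z, hz, rfl⟩ := hy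
      intro d
      change cc A Γ G (d : Γ) • z ∈ V
      rw [← hP.coe_c]
      exact V.smul_mem _ hz
    | zero => exact fun _ => V.zero_mem
    | add y z _ _ hy hz => exact fun d => V.add_mem (hy d) (hz d)
    | smul e y _ hy => exact fun d => hy (d * e)
  have h3 := h2 _ h1 1
  change CoInd.ev A Γ X (ι x) ∈ V at h3
  rwa [CoInd.ev_ι] at h3

end Pairs

/-! ### Modules induced from semisimple modules. -/

section InducedRelStd

set_option linter.unusedSectionVars false

universe ω m

variable {k : Type w} [Field k] {A : Type u} [Ring A] [Algebra k A] [Module.Finite k A]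
  {B : Subalgebra k A} {O C : Set (Sim A)}

theorem IsInd.of_equiv {V I J : Type*} [AddCommGroup V] [Module B V] [AddCommGroup I] [Module A I]
    [AddCommGroup J] [Module A J] {η : V →ₗ[B] I} (h : IsInd.{ω} B η) (e : I ≃ₗ[A] J) :
    IsInd.{ω} B (e.toLinearMap.restrictScalars B ∘ₗ η) := by
  refine ⟨?_, fun X _ _ f => ?_⟩
  · have h1 : (LinearMap.range (e.toLinearMap.restrictScalars B ∘ₗ η) : Set J)
        = e.toLinearMap '' (LinearMap.range η : Set I) := by
      change Set.range _ = _ '' Set.range _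
      rw [← Set.range_comp]; rfl
    rw [h1, Submodule.span_image, h.span, Submodule.map_top, LinearEquiv.range]
  · obtain ⟨F, hF⟩ := h.lift X f
    refine ⟨F ∘ₗ e.symm.toLinearMap, fun v => ?_⟩
    rw [← hF]
    exact congrArg F (e.symm_apply_apply _)

/-- The module induced from a semisimple module is a direct summand of a direct sum of modules
induced from simple modules. -/
theorem relStd_of_isInd {V : Type*} {I : Type m} [AddCommGroup V] [Module B V] [Module.Finite B V]
    [IsSemisimpleModule B V] [AddCommGroup I] [Module A I] {η : V →ₗ[B] I} (hη : IsInd.{u} B η)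
    {Δ : Sim B → Type u} [∀ L, AddCommGroup (Δ L)] [∀ L, Module A (Δ L)]
    (hi : ∀ L : Sim B, Nonempty (Induced B L.Mod ≃ₗ[A] Δ L))
    (hΔ : ∀ L : Sim B, Fac k L V → RelStd.{ω} k O C (Δ L)) : RelStd.{ω} k O C I := by
  obtain ⟨n, L, ⟨e⟩⟩ := exists_equiv_pi_sim k (R := B) V
  let s : ∀ a, (L a).Mod →ₗ[B] V := fun a =>
    e.symm.toLinearMap ∘ₗ LinearMap.single B (fun a => (L a).Mod) a
  have hs : ∀ v : V, ∑ a, s a (e v a) = v := fun v => by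
    apply e.injective
    rw [map_sum]
    simp only [s, LinearMap.comp_apply, LinearEquiv.coe_coe, e.apply_symm_apply]
    exact Finset.univ_sum_single (e v)
  have hfac : ∀ a, Fac k (L a) V := fun a => (fac_self (k := k) (L a)).of_injective (s a)
    (e.symm.injective.comp (Pi.single_injective (M := fun a => (L a).Mod) a))
  let ηL : ∀ a, (L a).Mod →ₗ[B] Δ (L a) := fun a =>
    (hi (L a)).some.toLinearMap.restrictScalars B ∘ₗ Induced.η B (L a).Mod
  have hηL : ∀ a, IsInd.{m} B (ηL a) := fun a => (isInd_induced B (L a).Mod).of_equiv _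
  obtain ⟨α, hα⟩ := hη.lift (∀ a, Δ (L a))
    (LinearMap.pi fun a => ηL a ∘ₗ LinearMap.proj a ∘ₗ e.toLinearMap)
  choose F hF using fun a => (hηL a).lift I (η ∘ₗ s a)
  let β : (∀ a, Δ (L a)) →ₗ[A] I := ∑ a, F a ∘ₗ LinearMap.proj a
  refine (RelStd.pi fun a => hΔ (L a) (hfac a)).retract α β (hη.hom_ext fun v => ?_)
  rw [LinearMap.comp_apply, hα, LinearMap.id_apply]
  simp only [β, LinearMap.sum_apply]
  change ∑ a, F a (ηL a (e v a)) = η v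
  simp only [hF]
  conv_rhs => rw [← hs v, map_sum]
  rfl

end InducedRelStd

/-! ### Transfer of the matching of simple modules. -/

section BorelTransfer

set_option linter.unusedSectionVars false

universe ω

variable {k : Type w} [Field k] {A : Type u} [Ring A] [Algebra k A] [Module.Finite k A]
  {Γ : Type v} [Ring Γ] [Algebra k Γ] [Module.Finite k Γ] [Module A Γ] [IsScalarTower A Γ Γ]
  {G : Type*} [Group G] [Fintype G] [MulSemiringAction G A] [SkewExt A Γ G]
  {B : Subalgebra k A} {D : Subalgebra k Γ} [MulSemiringAction G B] [Module B D]
  [IsScalarTower B D D] [SkewExt B D G] [hP : SkewPair G B D]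
  {le : Sim A → Sim A → Prop} {i : Sim B → Sim A} {j : Sim D → Sim Γ}

/-- Bijections matching the simple modules of exact Borel subalgebras are compatible with
restriction. -/
theorem Over.compat (G : Type*) [Group G] [Fintype G] [MulSemiringAction G A]
    [SkewExt A Γ G] [MulSemiringAction G B] [SkewExt B D G] [SkewPair G B D]
    (hpo : IsPartialOrder (Sim A) le)
    (hi : ∀ L : Sim B, Nonempty (Induced B L.Mod ≃ₗ[A] Standard k le (i L)))
    (hj : ∀ S : Sim D, Nonempty (Induced D S.Mod ≃ₗ[Γ] Standard k (overLE k Γ le) (j S)))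
    {S : Sim D} {L : Sim B} (h : Over k S L) : Over k (j S) (i L) := by
  obtain ⟨ε, hε⟩ := exists_isTopInd.{u, w, u} hpo (hi L).some
  obtain ⟨ε', hε'⟩ := exists_isTopInd.{v, w, v} (isPartialOrder_overLE hpo) (hj S).some
  have := SkewPair.isScalarTower G B D (j S).Mod
  have := isSemisimple_sim k A G (j S)
  obtain ⟨f, hf⟩ := h.exists_hom G
  obtain ⟨l, hl⟩ : ∃ l, f l ≠ 0 := by
    by_contra! hall
    exact hf (LinearMap.ext hall)
  have hl' : ε' (f l) ≠ 0 := fun h0 =>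
    hl (LinearMap.injective_of_ne_zero hε'.ne_zero (h0.trans (map_zero ε').symm))
  obtain ⟨T, q, hq⟩ := exists_hom_sim_ne_zero (R := A) hl'
  have hT : T = i L := hε.eq_of_hom (q.restrictScalars B ∘ₗ ε'.restrictScalars B ∘ₗ f)
    fun h0 => hq (LinearMap.congr_fun h0 l)
  rw [← hT]
  exact fac_of_surjective_simple q fun h0 => hq (by rw [h0]; rfl)

theorem isSemisimple_coind (k : Type*) [Field k] [Algebra k Γ] (G : Type*) [Group G] [Fintype G]
    [MulSemiringAction G A] [SkewExt A Γ G] (X : Type*) [AddCommGroup X] [Module A X]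
    [IsSemisimpleModule A X] : IsSemisimpleModule A (CoInd A Γ X) := by
  have : IsSemisimpleModule A (LinearMap.range (CoInd.ι A Γ X G)) := IsSemisimpleModule.range _
  exact isSemisimple_of_span_eq_top (Γ := Γ) G _ (CoInd.span_ι (G := G))

/-- `S` embeds over `D` in the module coinduced from `i L`, so `L'` maps nontrivially into that
module; its constituents are conjugate to `i L`, and universality identifies the one reached from
`L'` as `i L'`. -/
theorem conj_of_over_of_over (hpo : IsPartialOrder (Sim A) le)
    (hi : ∀ L : Sim B, Nonempty (Induced B L.Mod ≃ₗ[A] Standard k le (i L)))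
    {S : Sim D} {L L' : Sim B} (h : Over k S L) (h' : Over k S L') : Conj G (i L') (i L) := by
  obtain ⟨ε, hε⟩ := exists_isTopInd.{u, w, u} hpo (hi L).some
  obtain ⟨ε', hε'⟩ := exists_isTopInd.{u, w, max u v} hpo (hi L').some
  obtain ⟨ε'', hε''⟩ := exists_isTopInd.{u, w, u} hpo (hi L').some
  obtain ⟨p, hp⟩ := h.exists_hom_to G
  obtain ⟨f, hf⟩ := h'.exists_hom G
  let X := CoInd A Γ (i L).Mod
  have := SkewPair.isScalarTower G B D X
  have : IsSemisimpleModule A X := isSemisimple_coind k G _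
  let φ : S.Mod →ₗ[D] X := coindLift G (ε ∘ₗ p)
  have hφ : φ ≠ 0 := fun h0 => hp (LinearMap.ext fun s => by
    have h1 := ev_coindLift (G := G) (D := D) (Γ := Γ) (ε ∘ₗ p) s
    rw [show coindLift G (ε ∘ₗ p) s = φ s from rfl, h0, LinearMap.zero_apply, map_zero] at h1
    exact LinearMap.injective_of_ne_zero hε.ne_zero (h1.symm.trans (map_zero ε).symm))
  obtain ⟨l, hl⟩ : ∃ l, f l ≠ 0 := by
    by_contra! hall
    exact hf (LinearMap.ext hall)
  have hl' : φ (f l) ≠ 0 := fun h0 =>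
    hl (LinearMap.injective_of_ne_zero hφ (h0.trans (map_zero φ).symm))
  obtain ⟨T, q, hq⟩ := exists_hom_sim_ne_zero (R := A) hl'
  have hT : T = i L' := hε''.eq_of_hom (q.restrictScalars B ∘ₗ φ.restrictScalars B ∘ₗ f)
    fun h0 => hq (LinearMap.congr_fun h0 l)
  have h1 : Fac k (i L') X := by
    rw [← hT]
    exact fac_of_surjective_simple q fun h0 => hq (by rw [h0]; rfl)
  obtain ⟨T0, h2, h3⟩ := Fac.coind (G := G) h1
  rwa [h3.eq_of_simple] at h2

/-- Over `A` the module induced from `S` is induced from the restriction of `S` to `B`, hence a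
summand of a sum of standard modules of one orbit. So it is relatively projective over `Γ`, and
`Star` makes its top simple. -/
theorem exists_induced_skew_equiv [IsAlgClosed k] (hG : (Fintype.card G : k) ≠ 0)
    (hle : ConjInvariant G le) (hA : IsQuasiHereditary k le) (hinj : Function.Injective i)
    (hi : ∀ L : Sim B, Nonempty (Induced B L.Mod ≃ₗ[A] Standard k le (i L))) :
    ∃ j : Sim D ≃ Sim Γ,
      ∀ S : Sim D, Nonempty (Induced D S.Mod ≃ₗ[Γ] Standard k (overLE k Γ le) (j S)) := by
  have hpo := hA.adapted.partialOrder
  have hpo' := isPartialOrder_overLE (k := k) (Γ := Γ) hpo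
  choose ε hε using fun L => exists_isTopInd.{u, w, v} hpo (hi L).some
  have hstar : Star.{v} D := (star_of_isTopInd hinj hε).skew G
  have key : ∀ S : Sim D, ∃ T0 : Sim A, Nontrivial (Induced D S.Mod) ∧
      RelStd.{v} k (up k Γ (Orb G T0)) (up k Γ (Down G le T0)) (Induced D S.Mod) := by
    intro S
    let I := Induced D S.Mod
    let _ : Module A I := Module.compHom I (RingHom.smulOneHom : A →+* Γ)
    have : IsScalarTower A Γ I := ⟨fun r y x => by
      change (r • y) • x = (r • (1 : Γ)) • y • x
      rw [smul_smul, smul_mul_assoc, one_mul]⟩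
    have := SkewPair.isScalarTower G B D I
    let η : S.Mod →ₗ[D] I := Induced.η D S.Mod
    have hη : IsInd.{u} B (η.restrictScalars B) :=
      IsInd.restrict.{u, v, w, u} G (isInd_induced D S.Mod) fun _ => rfl
    have := isSemisimple_sim k B G S
    have := finite_restrict D G S.Mod (R := B)
    obtain ⟨L0, hL0⟩ := exists_under k B S
    refine ⟨i L0, ?_, ?_⟩
    · obtain ⟨p, hp⟩ := hL0.exists_hom_to G
      obtain ⟨s, hs⟩ : ∃ s, p s ≠ 0 := by
        by_contra! hall
        exact hp (LinearMap.ext hall)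
      obtain ⟨F, hF⟩ := hη.lift _ (ε L0 ∘ₗ p)
      refine ⟨η s, 0, fun h0 => hs ?_⟩
      have h1 := hF s
      rw [LinearMap.restrictScalars_apply, h0, map_zero] at h1
      exact LinearMap.injective_of_ne_zero (hε L0).ne_zero (h1.symm.trans (map_zero _).symm)
    · refine RelStd.of_restrict hG (conjStable_down k Γ hle _)
        (relStd_of_isInd hη (Δ := fun L => Standard k le (i L)) hi fun L hL => ?_)
      have hc : Conj G (i L0) (i L) := conj_of_over_of_over (D := D) (Γ := Γ) hpo hi hL hL0
      rw [orb_eq k Γ hc, down_eq k Γ hle hc]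
      exact relStd_standard Γ hle hA.adapted (i L)
  refine hstar.exists_equiv (fun S => (key S).choose_spec.1) fun S Q p hp => ?_
  obtain ⟨T0, -, hrel⟩ := key S
  obtain ⟨T, hT, hQT⟩ := hrel.top Q p hp.ne_zero
  have hQ : Over k Q T0 := hQT.conj (Conj.symm k Γ hT)
  obtain ⟨q, -, hq⟩ := exists_isTop_standard (k := k) hpo' Q
  exact RelStd.equiv_of_isTop hq (relStd_standard_overLE hG hle hA hQ) hrel hp

/-- `L` is a `B`-summand of some `S` over it, so `A ⊗_B L` is a retract of the restriction of a
standard `Γ`-module and is relatively projective over `A`; `Star` makes its top simple. -/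
theorem exists_induced_equiv_of_skew [IsAlgClosed k] (hG : (Fintype.card G : k) ≠ 0)
    (hle : ConjInvariant G le) (hA : IsQuasiHereditary k le) (hinj : Function.Injective j)
    (hj : ∀ S : Sim D, Nonempty (Induced D S.Mod ≃ₗ[Γ] Standard k (overLE k Γ le) (j S))) :
    ∃ i : Sim B ≃ Sim A,
      ∀ L : Sim B, Nonempty (Induced B L.Mod ≃ₗ[A] Standard k le (i L)) := by
  have hpo := hA.adapted.partialOrder
  have hpo' := isPartialOrder_overLE (k := k) (Γ := Γ) hpo
  choose ε hε using fun S => exists_isTopInd.{v, w, max u v} hpo' (hj S).some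
  have hstar : Star.{u} B := Star.of_skew (D := D) (Γ := Γ) hG (star_of_isTopInd hinj hε)
  have key : ∀ L : Sim B, ∃ T0 : Sim A, Nontrivial (Induced B L.Mod) ∧
      RelStd.{u} k (Orb G T0) (Down G le T0) (Induced B L.Mod) := by
    intro L
    obtain ⟨S, hS⟩ := exists_over k D G L
    obtain ⟨T0, hT0⟩ := exists_under k A (j S)
    let I := Standard k (overLE k Γ le) (j S)
    have := SkewPair.isScalarTower G B D I
    have := isSemisimple_sim k B G S
    let η : S.Mod →ₗ[D] I := (hj S).some.toLinearMap.restrictScalars D ∘ₗ Induced.η D S.Mod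
    have hη : IsInd.{max u v} D η := (isInd_induced D S.Mod).of_equiv _
    have hη' : IsInd.{u} B (η.restrictScalars B) :=
      IsInd.restrict.{u, v, w, u} G hη fun _ => rfl
    obtain ⟨q, -, hq⟩ := exists_isTop_standard (k := k) hpo' (j S)
    have hη0 : η ≠ 0 := fun h0 => (hη.isTopInd hq).ne_zero (by rw [h0, LinearMap.comp_zero])
    obtain ⟨f, hf⟩ := hS.exists_hom G
    have hfi := LinearMap.injective_of_ne_zero hf
    obtain ⟨r, hr⟩ := IsSemisimpleModule.extension_property f hfi LinearMap.id
    have hL : IsInd.{v} B (Induced.η B L.Mod) := isInd_induced B L.Mod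
    obtain ⟨F, hF⟩ := hL.lift I (η.restrictScalars B ∘ₗ f)
    obtain ⟨F', hF'⟩ := hη'.lift (Induced B L.Mod) (Induced.η B L.Mod ∘ₗ r)
    have hFF : F' ∘ₗ F = LinearMap.id := (isInd_induced.{u, w, u, u} B L.Mod).hom_ext fun l => by
      rw [LinearMap.comp_apply, hF]
      refine (hF' (f l)).trans ?_
      exact congrArg (Induced.η B L.Mod) (LinearMap.congr_fun hr l)
    refine ⟨T0, ?_, ?_⟩
    · obtain ⟨l, hl⟩ : ∃ l, f l ≠ 0 := by
        by_contra! hall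
        exact hf (LinearMap.ext hall)
      refine ⟨Induced.η B L.Mod l, 0, fun h0 => hl ?_⟩
      have h1 := hF l
      rw [h0, map_zero] at h1
      exact LinearMap.injective_of_ne_zero hη0 (h1.symm.trans (map_zero η).symm)
    · exact (RelStd.restrict (Γ := Γ) hG (conjStable_orb k Γ T0) (conjStable_down k Γ hle T0)
        (relStd_standard_overLE hG hle hA hT0)).retract F F' hFF
  refine hstar.exists_equiv (fun L => (key L).choose_spec.1) fun L T p hp => ?_
  obtain ⟨T0, -, hrel⟩ := key L
  have hT : Conj G T0 T := hrel.top T p hp.ne_zero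
  obtain ⟨q, -, hq⟩ := exists_isTop_standard (k := k) hpo T
  rw [orb_eq k Γ hT, down_eq k Γ hle hT] at hrel
  exact RelStd.equiv_of_isTop hq (relStd_standard Γ hle hA.adapted T) hrel hp

end BorelTransfer

/-! ### Right projectivity in terms of dual bases. -/

section DualBasis

variable {k : Type*} [Field k] {A : Type*} [Ring A] [Algebra k A]

/-- A dual basis exhibits the algebra as a projective right module over the subalgebra. -/
theorem isRightProjective_of_dualBasis {B : Subalgebra k A} {ι : Type*} [Fintype ι] (a : ι → A)
    (φ : ι → A →+ B) (hφ : ∀ i x (b : B), φ i (x * b) = φ i x * b)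
    (h : ∀ x, ∑ i, a i * φ i x = x) : IsRightProjective B := by
  classical
  let M := Res (RingHom.op B.val.toRingHom) A
  let s : M →ₗ[(↥B)ᵐᵒᵖ] (ι → (↥B)ᵐᵒᵖ) :=
    { toFun := fun x i => MulOpposite.op (φ i x)
      map_add' := fun x y => funext fun i => congrArg MulOpposite.op (map_add (φ i) x y)
      map_smul' := fun b x => funext fun i => congrArg MulOpposite.op (hφ i x b.unop) }
  let r : (ι → (↥B)ᵐᵒᵖ) →ₗ[(↥B)ᵐᵒᵖ] M :=
    { toFun := fun y => show A from ∑ i, a i * ((y i).unop : A)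
      map_add' := fun y z => by
        change ∑ i, _ = (∑ i, (_ : A)) + ∑ i, (_ : A)
        rw [← Finset.sum_add_distrib]
        exact Finset.sum_congr rfl fun i _ => mul_add _ _ _
      map_smul' := fun b y => by
        change ∑ i, _ = (∑ i, (_ : A)) * (b.unop : A)
        rw [Finset.sum_mul]
        exact Finset.sum_congr rfl fun i _ => (mul_assoc _ _ _).symm }
  exact Module.Projective.of_split s r (LinearMap.ext h)

/-- A finite family spanning `A` over `k` generates it over `B`; projectivity splits the resulting
epimorphism, and the coordinates of the splitting are the forms. -/
theorem IsRightProjective.exists_dualBasis [Module.Finite k A] {B : Subalgebra k A}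
    (h : IsRightProjective B) : ∃ (n : ℕ) (a : Fin n → A) (φ : Fin n → A →+ B),
      (∀ i x (b : B), φ i (x * b) = φ i x * b) ∧ ∀ x, ∑ i, a i * φ i x = x := by
  classical
  let M := Res (RingHom.op B.val.toRingHom) A
  have hM : Module.Projective (↥B)ᵐᵒᵖ M := h
  obtain ⟨n, a, ha⟩ := Module.Finite.exists_fin (R := k) (M := A)
  let r : (Fin n → (↥B)ᵐᵒᵖ) →ₗ[(↥B)ᵐᵒᵖ] M :=
    { toFun := fun y => show A from ∑ i, a i * ((y i).unop : A)
      map_add' := fun y z => by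
        change ∑ i, _ = (∑ i, (_ : A)) + ∑ i, (_ : A)
        rw [← Finset.sum_add_distrib]
        exact Finset.sum_congr rfl fun i _ => mul_add _ _ _
      map_smul' := fun b y => by
        change ∑ i, _ = (∑ i, (_ : A)) * (b.unop : A)
        rw [Finset.sum_mul]
        exact Finset.sum_congr rfl fun i _ => (mul_assoc _ _ _).symm }
  have hr : Function.Surjective r := fun x => by
    obtain ⟨c, hc⟩ := (Submodule.mem_span_range_iff_exists_fun k).mp
      (ha ▸ Submodule.mem_top : (show A from x) ∈ Submodule.span k (Set.range a))
    refine ⟨fun i => MulOpposite.op (algebraMap k B (c i)), Eq.trans ?_ hc⟩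
    change ∑ i, a i * ((algebraMap k B (c i) : B) : A) = ∑ i, c i • a i
    refine Finset.sum_congr rfl fun i _ => ?_
    rw [Algebra.smul_def, Algebra.commutes]
    rfl
  obtain ⟨s, hs⟩ := Module.projective_lifting_property r LinearMap.id hr
  refine ⟨n, a, fun i => ⟨⟨fun x => (s (show M from x) i).unop, ?_⟩, fun x y => ?_⟩,
    fun i x b => ?_, fun x => ?_⟩
  · have := map_zero s
    exact congrArg MulOpposite.unop (congrFun this i)
  · have := map_add s (show M from x) (show M from y)
    exact congrArg MulOpposite.unop (congrFun this i)
  · have := map_smul s (MulOpposite.op b) (show M from x)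
    exact congrArg MulOpposite.unop (congrFun this i)
  · exact LinearMap.congr_fun hs (show M from x)

end DualBasis

/-! ### Transfer of right projectivity. -/

section RightProjective

set_option linter.unusedSectionVars false

variable {k : Type w} [Field k] {A : Type u} [Ring A] [Algebra k A] [Module.Finite k A]
  {Γ : Type v} [Ring Γ] [Algebra k Γ] [Module.Finite k Γ] [Module A Γ] [IsScalarTower A Γ Γ]
  {B : Subalgebra k A} {D : Subalgebra k Γ} [Module B D] [IsScalarTower B D D]

/-- Expansion with the coefficients on the right of the units, as needed for right modules over `B`.
-/
theorem skew_eq_sum {R Γ : Type*} [Ring R] [Ring Γ] [Module R Γ] [IsScalarTower R Γ Γ]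
    {G : Type*} [Group G] [Fintype G] [MulSemiringAction G R] [SkewExt R Γ G] (d : Γ) :
    ∑ g : G, uu R Γ g⁻¹ * (cc R Γ G (uu R Γ g * d) • 1) = d := by
  apply coeffForm_injective (R := R) (G := G)
  conv_rhs => rw [CoInd.eq_sum (G := G) (coeffForm R Γ G d)]
  rw [map_sum]
  refine Finset.sum_congr rfl fun g _ => ?_
  rw [← smul_eq_mul, map_smul, coeffForm_smul_one]
  rfl

theorem IsRightProjective.skew (G : Type*) [Group G] [Fintype G] [MulSemiringAction G A]
    [SkewExt A Γ G] [MulSemiringAction G B] [SkewExt B D G] [hP : SkewPair G B D]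
    (h : IsRightProjective B) : IsRightProjective D := by
  obtain ⟨n, a, φ, hφ, ha⟩ := h.exists_dualBasis
  -- The forms on `A` are applied to each coefficient.
  let Φ : Fin n → Γ →+ D := fun i =>
    ⟨⟨fun x => ∑ g : G, φ i (cc A Γ G (x * uu A Γ g⁻¹)) • uu B D g, by
      simp only [zero_mul, map_zero, zero_smul, Finset.sum_const_zero]⟩, fun x y => by
      simp only [add_mul, map_add, add_smul, Finset.sum_add_distrib]⟩
  have hΦ : ∀ i x, Φ i x = ∑ g : G, φ i (cc A Γ G (x * uu A Γ g⁻¹)) • uu B D g := fun _ _ => rfl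
  refine isRightProjective_of_dualBasis (fun i => a i • (1 : Γ)) Φ (fun i x d => ?_) fun x => ?_
  · have key : ∀ (b : B) (h : G), Φ i (x * ((b • uu B D h : D) : Γ)) = Φ i x * (b • uu B D h) := by
      intro b h
      rw [hΦ, hΦ, Finset.sum_mul]
      refine (Fintype.sum_equiv (Equiv.mulRight h) _ _ fun g => ?_).symm
      have h1 : x * ((b • uu B D h : D) : Γ) * uu A Γ (g * h)⁻¹
          = x * uu A Γ g⁻¹ * ((g • (b : A)) • 1) := by
        rw [hP.coe_smul, hP.coe_u, mul_assoc, smul_mul_assoc, ← map_mul, mul_inv_rev,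
          mul_inv_cancel_left, mul_assoc, SkewExt.u_mul_smul_one, inv_smul_smul]
      have h2 : uu B D g * (b • uu B D h) = (g • b) • uu B D (g * h) := by
        rw [← one_mul (uu B D h), ← smul_mul_assoc, ← mul_assoc, SkewExt.u_mul_smul_one,
          smul_mul_assoc, ← map_mul]
      rw [Equiv.coe_mulRight, h1, cc_mul_smul_one, ← hP.coe_act, hφ, smul_mul_assoc, h2, mul_smul]
    have hd := SkewExt.sum_c (R := B) (G := G) d
    rw [← hd, Finset.mul_sum, AddSubmonoidClass.coe_finsetSum, Finset.mul_sum, map_sum]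
    exact Finset.sum_congr rfl fun g _ => key _ g
  · have h1 : ∀ i, a i • (1 : Γ) * (Φ i x : Γ)
        = ∑ g : G, (a i * φ i (cc A Γ G (x * uu A Γ g⁻¹))) • uu A Γ g := fun i => by
      rw [hΦ, smul_mul_assoc, one_mul, AddSubmonoidClass.coe_finsetSum, Finset.smul_sum]
      refine Finset.sum_congr rfl fun g _ => ?_
      rw [hP.coe_smul, hP.coe_u, mul_smul]
    simp only [h1]
    rw [Finset.sum_comm]
    conv_rhs => rw [← SkewExt.sum_c (R := A) (G := G) x]
    refine Finset.sum_congr rfl fun g _ => ?_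
    rw [← Finset.sum_smul, ha]

theorem IsRightProjective.of_skew (G : Type*) [Group G] [Fintype G] [MulSemiringAction G A]
    [SkewExt A Γ G] [MulSemiringAction G B] [SkewExt B D G] [hP : SkewPair G B D]
    (h : IsRightProjective D) : IsRightProjective B := by
  obtain ⟨n, a, φ, hφ, ha⟩ := h.exists_dualBasis
  have h1 : ∀ b : B, (((b • 1 : D)) : Γ) = (b : A) • (1 : Γ) := fun b => hP.coe_smul b 1
  let Ψ : Fin n × G → A →+ B := fun p =>
    ⟨⟨fun x => cc B D G (uu B D p.2 * φ p.1 (x • 1)), by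
      rw [zero_smul, map_zero, mul_zero, map_zero]⟩, fun x y => by
      change cc B D G (_ * φ p.1 ((x + y) • 1)) = _ + _
      rw [add_smul, map_add, mul_add, map_add]⟩
  have hΨ : ∀ p x, Ψ p x = cc B D G (uu B D p.2 * φ p.1 (x • 1)) := fun _ _ => rfl
  -- Expanding `φ i (x • 1)` in the units of `D` and taking the coefficient at `1` turns each pair
  -- of basis element and form into one pair for every `g`.
  refine isRightProjective_of_dualBasis (fun p => cc A Γ G (a p.1 * uu A Γ p.2⁻¹)) Ψ
    (fun p x b => ?_) fun x => ?_
  · have h2 : (x * (b : A)) • (1 : Γ) = (x • 1) * ((b • 1 : D) : Γ) := by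
      rw [h1, smul_mul_assoc, one_mul, mul_smul]
    rw [hΨ, hΨ, h2, hφ, ← mul_assoc, cc_mul_smul_one]
  · have h3 : ∀ i, ∑ g : G, cc A Γ G (a i * uu A Γ g⁻¹) * (Ψ (i, g) x : A)
        = cc A Γ G (a i * φ i (x • 1)) := fun i => by
      conv_rhs => rw [← skew_eq_sum (R := B) (G := G) (φ i (x • 1)),
        AddSubmonoidClass.coe_finsetSum, Finset.mul_sum, map_sum]
      refine Finset.sum_congr rfl fun g _ => ?_
      rw [MulMemClass.coe_mul, hP.coe_u, h1, ← mul_assoc, cc_mul_smul_one]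
      rfl
    rw [Fintype.sum_prod_type]
    simp only [h3]
    rw [← map_sum, ha, map_smul, SkewExt.c_one, smul_eq_mul, mul_one]

end RightProjective

/-! ### The concrete skew group algebra and its stable subalgebras. -/

section SkewInstances

variable {A : Type u} [Ring A] {G : Type v} [Group G] [MulSemiringAction G A]

theorem smul_eq_single_mul (a : A) (x : SkewMonoidAlgebra A G) :
    a • x = SkewMonoidAlgebra.single 1 a * x := by
  refine SkewMonoidAlgebra.ext fun g => ?_
  rw [SkewMonoidAlgebra.coeff_single_one_mul, SkewMonoidAlgebra.coeff_smul]
  rfl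

instance : IsScalarTower A (SkewMonoidAlgebra A G) (SkewMonoidAlgebra A G) :=
  ⟨fun a x y => by rw [smul_eq_mul, smul_eq_mul, smul_eq_single_mul, smul_eq_single_mul, mul_assoc]⟩

noncomputable instance [Fintype G] : SkewExt A (SkewMonoidAlgebra A G) G where
  u :=
    { toFun := fun g => SkewMonoidAlgebra.single g 1
      map_one' := rfl
      map_mul' := fun g h => by
        rw [SkewMonoidAlgebra.single_mul_single, smul_one, one_mul] }
  c :=
    { toFun := fun x => x.coeff 1
      map_add' := fun x y => by rw [SkewMonoidAlgebra.coeff_add]; rfl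
      map_smul' := fun a x => by rw [SkewMonoidAlgebra.coeff_smul]; rfl }
  u_mul_smul_one g r := by
    change SkewMonoidAlgebra.single g 1 * (r • (1 : SkewMonoidAlgebra A G))
      = (g • r) • SkewMonoidAlgebra.single g 1
    rw [smul_eq_single_mul, smul_eq_single_mul, mul_one, SkewMonoidAlgebra.single_mul_single,
      SkewMonoidAlgebra.single_mul_single, one_mul, mul_one, one_mul, one_smul, mul_one]
  sum_c x := by
    classical
    refine SkewMonoidAlgebra.ext fun h => ?_
    change (∑ g : G, (x * SkewMonoidAlgebra.single g⁻¹ 1).coeff 1 •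
      SkewMonoidAlgebra.single g (1 : A)).coeff h = x.coeff h
    rw [← SkewMonoidAlgebra.coeffAddEquiv_apply, map_sum, Finsupp.finsetSum_apply,
      Finset.sum_eq_single h]
    · simp
    · intro g _ hg
      simp [hg]
    · exact fun h0 => absurd (Finset.mem_univ _) h0
  c_one := by
    change (1 : SkewMonoidAlgebra A G).coeff 1 = 1
    rw [SkewMonoidAlgebra.coeff_one, Finsupp.single_eq_same]
  c_u g hg := by
    classical
    change (SkewMonoidAlgebra.single g (1 : A)).coeff 1 = 0
    rw [SkewMonoidAlgebra.coeff_single_apply, if_neg hg]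

variable {k : Type w} [Field k] [Algebra k A] [SMulCommClass G k A] {B : Subalgebra k A}

theorem smul_mem_of_map_eq (hB : ∀ g : G, B.map (MulSemiringAction.toAlgHom k A g) = B) (g : G)
    {b : A} (hb : b ∈ B) : g • b ∈ B := by
  have h : MulSemiringAction.toAlgHom k A g b ∈ B.map (MulSemiringAction.toAlgHom k A g) :=
    Subalgebra.mem_map.mpr ⟨_, hb, rfl⟩
  rwa [hB g] at h

/-- The action on a stable subalgebra. -/
@[reducible] def subAction (hB : ∀ g : G, B.map (MulSemiringAction.toAlgHom k A g) = B) :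
    MulSemiringAction G B where
  smul g b := ⟨g • (b : A), smul_mem_of_map_eq hB g b.2⟩
  one_smul b := Subtype.ext (one_smul G (b : A))
  mul_smul g h b := Subtype.ext (mul_smul g h (b : A))
  smul_zero g := Subtype.ext (smul_zero g)
  smul_add g a b := Subtype.ext (smul_add g (a : A) b)
  smul_one g := Subtype.ext (smul_one g)
  smul_mul g a b := Subtype.ext (smul_mul' g (a : A) b)

variable (hB : ∀ g : G, B.map (MulSemiringAction.toAlgHom k A g) = B)

noncomputable instance : Module B (skewSubalgebra B hB) where
  smul b x := ⟨(b : A) • (x : SkewMonoidAlgebra A G), fun g => by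
    rw [SkewMonoidAlgebra.coeff_smul]
    exact B.mul_mem b.2 (x.2 g)⟩
  one_smul x := Subtype.ext (one_smul A (x : SkewMonoidAlgebra A G))
  mul_smul a b x := Subtype.ext (mul_smul (a : A) (b : A) (x : SkewMonoidAlgebra A G))
  smul_zero b := Subtype.ext (smul_zero (b : A))
  smul_add b x y := Subtype.ext (smul_add (b : A) (x : SkewMonoidAlgebra A G) y)
  add_smul a b x := Subtype.ext (add_smul (a : A) (b : A) (x : SkewMonoidAlgebra A G))
  zero_smul x := Subtype.ext (zero_smul A (x : SkewMonoidAlgebra A G))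

instance : IsScalarTower B (skewSubalgebra B hB) (skewSubalgebra B hB) :=
  ⟨fun b x y => Subtype.ext (smul_mul_assoc (b : A) (x : SkewMonoidAlgebra A G) y)⟩

theorem single_one_mem (g : G) :
    (SkewMonoidAlgebra.single g 1 : SkewMonoidAlgebra A G) ∈ skewSubalgebra B hB := fun h => by
  classical
  rw [SkewMonoidAlgebra.coeff_single_apply]
  split_ifs
  · exact B.one_mem
  · exact B.zero_mem

/-- The subalgebra `B * G` is the skew group algebra of `B`. -/
@[reducible] noncomputable def subSkewExt [Fintype G] :
    letI := subAction hB
    SkewExt B (skewSubalgebra B hB) G :=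
  letI := subAction hB
  { u :=
      { toFun := fun g => ⟨SkewMonoidAlgebra.single g 1, single_one_mem hB g⟩
        map_one' := rfl
        map_mul' := fun g h => Subtype.ext (map_mul (uu A (SkewMonoidAlgebra A G)) g h) }
    c :=
      { toFun := fun x => ⟨(x : SkewMonoidAlgebra A G).coeff 1, x.2 1⟩
        map_add' := fun x y => Subtype.ext (map_add (cc A (SkewMonoidAlgebra A G) G) _ _)
        map_smul' := fun b x => Subtype.ext (map_smul (cc A (SkewMonoidAlgebra A G) G) (b : A) _) }
    u_mul_smul_one := fun g b => Subtype.ext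
      (SkewExt.u_mul_smul_one (R := A) (Γ := SkewMonoidAlgebra A G) g (b : A))
    sum_c := fun x => Subtype.ext (by
      rw [AddSubmonoidClass.coe_finsetSum]
      exact SkewExt.sum_c (R := A) (G := G) (x : SkewMonoidAlgebra A G))
    c_one := Subtype.ext (SkewExt.c_one (R := A) (Γ := SkewMonoidAlgebra A G) (G := G))
    c_u := fun g hg => Subtype.ext
      (SkewExt.c_u (R := A) (Γ := SkewMonoidAlgebra A G) g hg) }

theorem skewPair_skewSubalgebra [Fintype G] :
    letI := subAction hB
    letI := subSkewExt hB
    SkewPair G B (skewSubalgebra B hB) :=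
  letI := subAction hB
  letI := subSkewExt hB
  { coe_smul := fun _ _ => rfl
    coe_u := fun _ => rfl
    coe_c := fun _ => rfl
    coe_act := fun _ _ => rfl }

variable [Module.Finite k A] [Fintype G]

/-- The restriction of a simple module is semisimple, so constituents and simple direct summands
agree. -/
theorem isSummand_iff_over {S : Sim (SkewMonoidAlgebra A G)} {L : Sim A} :
    IsSummand A L.Mod (Res (incl (A := A) (G := G)) S.Mod) ↔ Over k S L := by
  have hss := isSemisimple_sim k A G S
  let e : S.Mod ≃ₗ[A] Res (incl (A := A) (G := G)) S.Mod :=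
    { AddEquiv.refl S.Mod with
      map_smul' := fun a m => by
        obtain ⟨x, rfl⟩ := Submodule.Quotient.mk_surjective _ m
        change Submodule.Quotient.mk (a • x) = (SkewMonoidAlgebra.single 1 a : SkewMonoidAlgebra A G) •
          (Submodule.Quotient.mk x : S.Mod)
        rw [smul_eq_single_mul]
        rfl }
  constructor
  · rintro ⟨X, Y, -, ⟨f⟩⟩
    refine over_of_ne_zero (e.symm.toLinearMap ∘ₗ X.subtype ∘ₗ f.toLinearMap) fun h0 => ?_
    have := IsSimpleModule.nontrivial A L.Mod
    obtain ⟨l, hl⟩ := exists_ne (0 : L.Mod)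
    have h1 := LinearMap.congr_fun h0 l
    have h2 : (e.symm (f l : Res (incl (A := A) (G := G)) S.Mod)) = e.symm 0 :=
      h1.trans (map_zero e.symm).symm
    exact hl (f.injective (Subtype.ext (e.symm.injective h2) |>.trans (map_zero f).symm))
  · intro h
    obtain ⟨f, hf⟩ := Over.exists_hom G h
    have := IsSemisimpleModule.congr e.symm
    have hi : Function.Injective (e.toLinearMap ∘ₗ f) :=
      e.injective.comp (LinearMap.injective_of_ne_zero hf)
    obtain ⟨Y, hY⟩ := exists_isCompl (LinearMap.range (e.toLinearMap ∘ₗ f))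
    exact ⟨_, Y, hY, ⟨LinearEquiv.ofInjective _ hi⟩⟩

theorem inducedLE_eq_overLE (le : Sim A → Sim A → Prop) :
    inducedLE (G := G) le = overLE k (SkewMonoidAlgebra A G) le := by
  funext S S'
  refine propext (or_congr Iff.rfl ?_)
  simp only [isSummand_iff_over (k := k)]

end SkewInstances

/-! ### The two equivalences. -/

section Transport

set_option linter.unusedSectionVars false

variable {k : Type w} [Field k] [IsAlgClosed k] {A : Type u} [Ring A] [Algebra k A]
  [Module.Finite k A]
  {Γ : Type v} [Ring Γ] [Algebra k Γ] [Module.Finite k Γ] [Module A Γ] [IsScalarTower A Γ Γ]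
  {G : Type*} [Group G] [Fintype G] [MulSemiringAction G A] [SkewExt A Γ G]
  {B : Subalgebra k A} {D : Subalgebra k Γ} [MulSemiringAction G B] [Module B D]
  [IsScalarTower B D D] [SkewExt B D G] [hP : SkewPair G B D]
  {le : Sim A → Sim A → Prop}

theorem isPartialOrder_comap {X Y : Type*} {le : Y → Y → Prop} (h : IsPartialOrder Y le)
    (f : X ≃ Y) : IsPartialOrder X fun x y => le (f x) (f y) where
  refl x := h.refl (f x)
  trans _ _ _ := h.trans _ _ _
  antisymm _ _ h1 h2 := f.injective (h.antisymm _ _ h1 h2)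

theorem lt_comap_iff {X Y : Type*} {l : X → X → Prop} {l' : Y → Y → Prop} (f : X ≃ Y)
    (h : ∀ x y, l x y ↔ l' (f x) (f y)) (x y : X) : Lt l x y ↔ Lt l' (f x) (f y) :=
  and_congr (h x y) (not_congr (Equiv.apply_eq_iff_eq f).symm)

theorem exactBorel_skew_iff (hG : (Fintype.card G : k) ≠ 0) (hle : ConjInvariant G le)
    (hA : IsQuasiHereditary k le) :
    (∃ leB : Sim B → Sim B → Prop, IsExactBorel le B leB) ↔
      ∃ leD : Sim D → Sim D → Prop, IsExactBorel (overLE k Γ le) D leD := by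
  constructor
  · rintro ⟨leB, i, h⟩
    obtain ⟨j, hj⟩ := exists_induced_skew_equiv (D := D) (Γ := Γ) hG hle hA i.injective
      h.induced_equiv
    obtain ⟨leD, hD⟩ := exists_isDirected_skew (Γ := D) hG h.directed
    exact ⟨leD, j, isQuasiHereditary_overLE hG hle hA, h.projective.skew G, hD, hj⟩
  · rintro ⟨leD, j, h⟩
    obtain ⟨i, hi⟩ := exists_induced_equiv_of_skew (B := B) hG hle hA j.injective h.induced_equiv
    obtain ⟨leB, hB⟩ := exists_isDirected_of_skew (R := B) hG h.directed
    exact ⟨leB, i, hA, IsRightProjective.of_skew G h.projective, hB, hi⟩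

theorem orderedExactBorel_skew_iff (hG : (Fintype.card G : k) ≠ 0) (hle : ConjInvariant G le)
    (hA : IsQuasiHereditary k le) :
    (∃ leB : Sim B → Sim B → Prop, IsOrderedExactBorel le B leB) ↔
      ∃ leD : Sim D → Sim D → Prop, IsOrderedExactBorel (overLE k Γ le) D leD := by
  have hpo := hA.adapted.partialOrder
  have hpo' := isPartialOrder_overLE (k := k) (Γ := Γ) hpo
  constructor
  · rintro ⟨leB, i, h, hord⟩
    obtain ⟨j, hj⟩ := exists_induced_skew_equiv (D := D) (Γ := Γ) hG hle hA i.injective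
      h.induced_equiv
    -- The order is pulled back along `j`, so compatibility is immediate and directedness has to be
    -- proved: a factor of `rad P_S` yields one of `rad P_L` for `L` under `S`, and `Over.compat`
    -- carries the inequality to `Γ`.
    refine ⟨fun S S' => overLE k Γ le (j S) (j S'), j, ⟨isQuasiHereditary_overLE hG hle hA,
      h.projective.skew G, ?_, hj⟩, fun _ _ => Iff.rfl⟩
    refine isDirectedAlgebra_of_inRad (isPartialOrder_comap hpo' j) fun S S' hS => ?_
    obtain ⟨L, hL⟩ := exists_under k B S
    obtain ⟨L', hL', hr⟩ := exists_inRad_of_over hG hS hL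
    refine (lt_comap_iff j (fun _ _ => Iff.rfl) S S').mpr ?_
    exact lt_overLE_of_lt hle (hL.compat G hpo h.induced_equiv hj)
      (hL'.compat G hpo h.induced_equiv hj) ((lt_comap_iff _ hord L L').mp (h.directed.lt_of_inRad hr))
  · rintro ⟨leD, j, h, hord⟩
    obtain ⟨i, hi⟩ := exists_induced_equiv_of_skew (B := B) hG hle hA j.injective h.induced_equiv
    -- Again the order is pulled back along the bijection, now from `A`; directedness comes down
    -- from `D` along `Over`.
    refine ⟨fun L L' => le (i L) (i L'), i, ⟨hA, IsRightProjective.of_skew G h.projective, ?_, hi⟩,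
      fun _ _ => Iff.rfl⟩
    refine isDirectedAlgebra_of_inRad (isPartialOrder_comap hpo i) fun L L' hL => ?_
    obtain ⟨S, hS⟩ := exists_over k D G L
    obtain ⟨S', hS', hr⟩ := exists_inRad_of_under hG hL hS
    refine (lt_comap_iff i (fun _ _ => Iff.rfl) L L').mpr ?_
    exact lt_of_lt_overLE ((lt_comap_iff _ hord S S').mp (h.directed.lt_of_inRad hr))
      (hS.compat G hpo hi h.induced_equiv) (hS'.compat G hpo hi h.induced_equiv)

end Transport

end QuasiHer

theorem mainTheorem2 {k : Type w} [Field k] [IsAlgClosed k]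
    {A : Type u} [Ring A] [Algebra k A] [Module.Finite k A]
    {G : Type v} [Group G] [Finite G] [MulSemiringAction G A] [SMulCommClass G k A]
    (hG : (Nat.card G : k) ≠ 0)
    (leA : Sim A → Sim A → Prop) (hleA : IsEquivariant G leA) (hA : IsQuasiHereditary k leA)
    (B : Subalgebra k A) (hB : ∀ g : G, B.map (MulSemiringAction.toAlgHom k A g) = B) :
    ((∃ leB : Sim B → Sim B → Prop, IsExactBorel leA B leB) ↔
      ∃ leBG : Sim (skewSubalgebra B hB) → Sim (skewSubalgebra B hB) → Prop,
        IsExactBorel (inducedLE (G := G) leA) (skewSubalgebra B hB) leBG) ∧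
    ((∃ leB : Sim B → Sim B → Prop, IsOrderedExactBorel leA B leB) ↔
      ∃ leBG : Sim (skewSubalgebra B hB) → Sim (skewSubalgebra B hB) → Prop,
        IsOrderedExactBorel (inducedLE (G := G) leA) (skewSubalgebra B hB) leBG) := by
  have := Fintype.ofFinite G
  rw [Nat.card_eq_fintype_card] at hG
  let _ := subAction hB
  let _ := subSkewExt hB
  have := skewPair_skewSubalgebra hB
  have hle : ConjInvariant G leA := fun _ _ _ _ h1 h2 => lt_iff_of_conj hleA h1 h2
  rw [inducedLE_eq_overLE (k := k)]
  exact ⟨exactBorel_skew_iff hG hle hA, orderedExactBorel_skew_iff hG hle hA⟩
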